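/- **Setting.** Fix integers $L\ge 2$ and $N\ge 1$. Parameters are complex numbers $\vec\kappa=(e_0,\dots,e_{L-1},\kappa_0,\dots,\kappa_{L-1},\theta_0,\dots,\theta_N)$ with $\sum_{n=0}^{L-1}e_n=\frac{L-1}{2}$ and $\sum_{n=0}^{L-1}\kappa_n=\sum_{i=0}^N\theta_i$. Let $\mathcal H_{L,N}(\vec\kappa)$ be the Hamiltonian system $$\frac{\partial q_n^{(i)}}{\partial s_j}=\frac{\partial H_j}{\partial p_n^{(i)}},\qquad \frac{\partial p_n^{(i)}}{\partial s_j}=-\frac{\partial H_j}{\partial q_n^{(i)}}\qquad(1\le i,j\le N,\ 1\le n\le L-1),$$ $$s_iH_i=\sum_{n=0}^{L-1}e_nq_n^{(i)}p_n^{(i)}+\sum_{j=0}^N\sum_{0\le m<n\le L-1}q_m^{(i)}p_m^{(j)}q_n^{(j)}p_n^{(i)}+\sum_{0\le j\le N,\ j\ne i}\frac{s_j}{s_i-s_j}\sum_{m,n=0}^{L-1}q_m^{(i)}p_m^{(j)}q_n^{(j)}p_n^{(i)},$$ where $s_0=q_n^{(0)}=q_0^{(i)}=1$, $p_n^{(0)}=\kappa_n-\sum_{i=1}^Nq_n^{(i)}p_n^{(i)}$,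 $p_0^{(i)}=\theta_i-\sum_{n=1}^{L-1}q_n^{(i)}p_n^{(i)}$. Indices are extended to $n\in\mathbb Z$ by $q_{n+L}^{(i)}=s_iq_n^{(i)}$, $p_{n+L}^{(i)}=p_n^{(i)}/s_i$, $e_{n+L}=e_n+1$, $\kappa_{n+L}=\kappa_n$. For $0\le n\le L-1$ put $\mathfrak a_n=e_{n+1}-e_n$, $\mathfrak b_n=e_{L-n}-e_{L-n-1}-\kappa_{L-n}+\kappa_{L-n-1}$, and $$D_n=\sum_{j=0}^Nq_{n+1}^{(j)}p_n^{(j)},\qquad D_n'=\sum_{j=0}^Nq_{L-n-1}^{(j)}p_{L-n}^{(j)}\ (n\ne0),\qquad D_0'=\sum_{j=0}^Nq_{-1}^{(j)}p_0^{(j)}.$$ **Transformations** (trivial actions are omitted). On the parameters: - $r_n$: $e_n\mapsto e_n+\mathfrak a_n$, $e_{n+1}\mapsto e_{n+1}-\mathfrak a_n$, $\kappa_n\mapsto\kappa_n+\mathfrak a_n$, $\kappa_{n+1}\mapsto\kappa_{n+1}-\mathfrak a_n$; - $r_n'$: $\kappa_{L-n}\mapsto\kappa_{L-n}+\mathfrak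 b_n$, $\kappa_{L-n-1}\mapsto\kappa_{L-n-1}-\mathfrak b_n$; - $\pi$: $e_n\mapsto e_{n+1}-\frac1L$, $\kappa_n\mapsto\kappa_{n+1}$; - $\rho$: $e_n\mapsto\kappa_{L-n}-e_{L-n}-\frac1L\sum_{i=0}^N\theta_i+1$, $\kappa_n\mapsto\kappa_{L-n}$. On the variables: - $r_n$ ($n\ne0$): $q_n^{(i)}\mapsto q_n^{(i)}+\frac{\mathfrak a_n(q_{n+1}^{(i)}-q_n^{(i)})}{\mathfrak a_n+D_n}$, $\ p_n^{(i)}\mapsto p_n^{(i)}\bigl(1+\frac{\mathfrak a_n}{D_n}\bigr)$, $\ p_{n+1}^{(i)}\mapsto p_{n+1}^{(i)}-\frac{\mathfrak a_np_n^{(i)}}{D_n}$; - $r_0$ (for $1\le n\le L-1$): $q_n^{(i)}\mapsto q_n^{(i)}\bigl(1-\frac{\mathfrak a_0(q_1^{(i)}-1)}{\mathfrak a_0q_1^{(i)}+D_0}\bigr)$, $\ p_n^{(i)}\mapsto p_n^{(i)}\bigl(1+\frac{\mathfrak a_0(q_1^{(i)}-1)}{\mathfrak a_0+D_0}\bigr)$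 if $n\ne1$, $\ p_1^{(i)}\mapsto\bigl(p_1^{(i)}-\frac{\mathfrak a_0p_0^{(i)}}{D_0}\bigr)\bigl(1+\frac{\mathfrak a_0(q_1^{(i)}-1)}{\mathfrak a_0+D_0}\bigr)$; - $r_n'$ ($n\ne0$): $q_{L-n}^{(i)}\mapsto q_{L-n}^{(i)}+\frac{\mathfrak b_n(q_{L-n-1}^{(i)}-q_{L-n}^{(i)})}{\mathfrak b_n+D_n'}$, $\ p_{L-n}^{(i)}\mapsto p_{L-n}^{(i)}\bigl(1+\frac{\mathfrak b_n}{D_n'}\bigr)$, $\ p_{L-n-1}^{(i)}\mapsto p_{L-n-1}^{(i)}-\frac{\mathfrak b_np_{L-n}^{(i)}}{D_n'}$; - $r_0'$ (for $1\le n\le L-1$): $q_n^{(i)}\mapsto q_n^{(i)}\bigl(1-\frac{\mathfrak b_0(q_{-1}^{(i)}-1)}{\mathfrak b_0q_{-1}^{(i)}+D_0'}\bigr)$, $\ p_n^{(i)}\mapsto p_n^{(i)}\bigl(1+\frac{\mathfrak b_0(q_{-1}^{(i)}-1)}{\mathfrak b_0+D_0'}\bigr)$ if $n\ne L-1$, $\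 p_{L-1}^{(i)}\mapsto\frac1{s_i}\bigl(p_{-1}^{(i)}-\frac{\mathfrak b_0p_0^{(i)}}{D_0'}\bigr)\bigl(1+\frac{\mathfrak b_0(q_{-1}^{(i)}-1)}{\mathfrak b_0+D_0'}\bigr)$; - $\pi$: $q_n^{(i)}\mapsto q_{n+1}^{(i)}/q_1^{(i)}$, $\ p_n^{(i)}\mapsto p_{n+1}^{(i)}q_1^{(i)}$; - $\rho$: $s_i\mapsto1/s_i$, $\ q_n^{(i)}\mapsto q_{L-n}^{(i)}/s_i$, $\ p_n^{(i)}\mapsto s_ip_{L-n}^{(i)}$. **Theorem.** For every $\vec\kappa$ these formulas define birational canonical transformations of the variables $(q_n^{(i)},p_n^{(i)},s_i)$, that is, automorphisms of the field $\mathbb C(s,q,p)$ that preserve the Poisson bracket for which the $q_n^{(i)},p_n^{(i)}$ are canonically conjugate and the $s_i$ are Casimirs; the displayed formulas for $r_n,r_n'$ with $n\neq 0$, and for $\pi,\rho$, also hold for the variables with extended indices. Each of them leaves the Hamiltonian system invariant up to the change of parameters: the new variables satisfy $\mathcal H_{L,N}$ with the new parameters along $\mathcal H_{L,N}(\vec\kappa)$,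 and in particular holomorphic solutions of $\mathcal H_{L,N}(\vec\kappa)$ on which the denominators do not vanish go to solutions of $\mathcal H_{L,N}$ with the new parameters. Composing the transformations, as substitutions in functions of the parameters and variables, and reading the indices $n$ of $r_n,r_n'$ modulo $L$, one has $$r_n^2=(r_n')^2=\pi^L=\rho^2=\mathrm{id},\qquad \pi r_n=r_{n+1}\pi,\qquad \pi r_n'=r_{n-1}'\pi,\qquad \rho r_n=r_n'\rho,$$ and, if $L\ge3$, $(r_nr_{n\pm1})^3=(r_n'r_{n\pm1}')^3=\mathrm{id}$. Moreover $r_mr_n'=r_n'r_m$ for all $m,n$, and each of the families $(r_n)$, $(r_n')$ gives a faithful realization of the affine Weyl group $W(A^{(1)}_{L-1})$ (the Coxeter group of the $L$-cycle for $L\ge3$, the infinite dihedral group for $L=2$), the simple reflections acting by $r_n$, respectively $r_n'$. -/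

import Mathlib

noncomputable section

namespace HLN

/-! ### Parameters -/

/-- The constant parameters `(e, κ, θ)` of the Hamiltonian system. The finite lists
`e_0, …, e_{L-1}` and `κ_0, …, κ_{L-1}` are extended to all integer indices by
`e_{n+L} = e_n + 1` and `κ_{n+L} = κ_n`, and satisfy the Fuchs-type relations. -/
@[ext]
structure Params (L N : ℕ) where
  e : ℤ → ℂ
  κ : ℤ → ℂ
  θ : Fin (N + 1) → ℂ
  e_add : ∀ n, e (n + L) = e n + 1
  κ_add : ∀ n, κ (n + L) = κ n
  sum_e : ∑ n ∈ Finset.range L, e n = ((L : ℂ) - 1) / 2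
  sum_κ : ∑ n ∈ Finset.range L, κ n = ∑ i, θ i

variable {L N : ℕ}

/-- The root variable `𝔞_n`. -/
def Params.a (k : Params L N) (n : ℤ) : ℂ := k.e (n + 1) - k.e n

/-- The root variable `𝔟_n`. -/
def Params.b (k : Params L N) (n : ℤ) : ℂ :=
  k.e (L - n) - k.e (L - n - 1) - k.κ (L - n) + k.κ (L - n - 1)

/-! ### Points of the extended phase space, with coordinates in a field -/

/-- Values of the independent variables `s_i` and of the canonical variables
`q_n^{(i)}, p_n^{(i)}` (`1 ≤ i ≤ N`, `1 ≤ n ≤ L - 1`). The index `i : Fin N` stands for `i + 1` and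
the index `n : Fin (L - 1)` stands for `n + 1`. -/
structure Point (L N : ℕ) (F : Type*) where
  s : Fin N → F
  q : Fin N → Fin (L - 1) → F
  p : Fin N → Fin (L - 1) → F

section Formulas

variable {F : Type*} [Field F]

/-- `s_i` for `0 ≤ i ≤ N`, with `s_0 = 1`. -/
def Point.sx (x : Point L N F) : Fin (N + 1) → F := Fin.cons 1 x.s

/-- `q_m^{(i)}` for `0 ≤ i ≤ N`, `0 ≤ m ≤ L - 1`, with `q_0^{(i)} = q_m^{(0)} = 1`. -/
def Point.qBase (x : Point L N F) (i : Fin (N + 1)) (m : ℕ) : F :=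
  Fin.cases 1 (fun i => if h : 1 ≤ m ∧ m < L then x.q i ⟨m - 1, by omega⟩ else 1) i

variable [Algebra ℂ F]

/-- `p_m^{(i)}` for `1 ≤ i ≤ N` (written `i : Fin N`) and `0 ≤ m ≤ L - 1`,
with `p_0^{(i)} = θ_i - ∑_{n=1}^{L-1} q_n^{(i)} p_n^{(i)}`. -/
def Point.pBasePos (k : Params L N) (x : Point L N F) (i : Fin N) (m : ℕ) : F :=
  if h : 1 ≤ m ∧ m < L then x.p i ⟨m - 1, by omega⟩
  else algebraMap ℂ F (k.θ i.succ) - ∑ n, x.q i n * x.p i n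

/-- `p_m^{(i)}` for `0 ≤ i ≤ N`, `0 ≤ m ≤ L - 1`,
with `p_m^{(0)} = κ_m - ∑_{i=1}^N q_m^{(i)} p_m^{(i)}`. -/
def Point.pBase (k : Params L N) (x : Point L N F) (i : Fin (N + 1)) (m : ℕ) : F :=
  Fin.cases
    (algebraMap ℂ F (k.κ m) - ∑ i : Fin N, x.qBase i.succ m * x.pBasePos k i m)
    (fun i => x.pBasePos k i m) i

/-- `q_n^{(i)}` for all `n ∈ ℤ`, extended by `q_{n+L}^{(i)} = s_i q_n^{(i)}`. -/
def Point.qx (x : Point L N F) (i : Fin (N + 1)) (n : ℤ) : F :=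
  x.sx i ^ (n / (L : ℤ)) * x.qBase i (n % (L : ℤ)).toNat

/-- `p_n^{(i)}` for all `n ∈ ℤ`, extended by `p_{n+L}^{(i)} = p_n^{(i)} / s_i`. -/
def Point.px (k : Params L N) (x : Point L N F) (i : Fin (N + 1)) (n : ℤ) : F :=
  x.sx i ^ (-(n / (L : ℤ))) * x.pBase k i (n % (L : ℤ)).toNat

/-- The Hamiltonian function `H_i`, `1 ≤ i ≤ N` (written `i : Fin N`). -/
def ham (k : Params L N) (x : Point L N F) (i : Fin N) : F :=
  (x.s i)⁻¹ *
    (∑ n ∈ Finset.range L, algebraMap ℂ F (k.e n) * x.qx i.succ n * x.px k i.succ n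
      + ∑ j : Fin (N + 1), ∑ n ∈ Finset.range L, ∑ m ∈ Finset.range n,
          x.qx i.succ m * x.px k j m * x.qx j n * x.px k i.succ n
      + ∑ j ∈ Finset.univ.erase i.succ, x.sx j / (x.s i - x.sx j) *
          ∑ m ∈ Finset.range L, ∑ n ∈ Finset.range L,
            x.qx i.succ m * x.px k j m * x.qx j n * x.px k i.succ n)

/-! ### The explicit transformations of the variables -/

/-- `∑_{j=0}^N q_{m}^{(j)} p_{n}^{(j)}`. -/
def Point.pairing (k : Params L N) (x : Point L N F) (m n : ℤ) : F :=
  ∑ j, x.qx j m * x.px k j n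

/-- The action of `r_n` on the variables, `0 ≤ n ≤ L - 1`. -/
def rPoint (n : ℕ) (k : Params L N) (x : Point L N F) : Point L N F :=
  let a : F := algebraMap ℂ F (k.a n)
  let D : F := x.pairing k (n + 1) n
  if n = 0 then
    { s := x.s
      q := fun i m =>
        x.q i m * (1 - a * (x.qx i.succ 1 - 1) / (a * x.qx i.succ 1 + D))
      p := fun i m =>
        if (m : ℕ) + 1 = 1 then
          (x.p i m - a * x.px k i.succ 0 / D) * (1 + a * (x.qx i.succ 1 - 1) / (a + D))
        else x.p i m * (1 + a * (x.qx i.succ 1 - 1) / (a + D)) }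
  else
    { s := x.s
      q := fun i m =>
        if (m : ℕ) + 1 = n then
          x.q i m + a * (x.qx i.succ (n + 1) - x.q i m) / (a + D)
        else x.q i m
      p := fun i m =>
        if (m : ℕ) + 1 = n then x.p i m * (1 + a / D)
        else if (m : ℕ) + 1 = n + 1 then x.p i m - a * x.px k i.succ n / D
        else x.p i m }

/-- The action of `r_n'` on the variables, `0 ≤ n ≤ L - 1`. -/
def rPoint' (n : ℕ) (k : Params L N) (x : Point L N F) : Point L N F :=
  let b : F := algebraMap ℂ F (k.b n)
  if n = 0 then
    let D : F := x.pairing k (-1) 0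
    { s := x.s
      q := fun i m =>
        x.q i m * (1 - b * (x.qx i.succ (-1) - 1) / (b * x.qx i.succ (-1) + D))
      p := fun i m =>
        if (m : ℕ) + 1 = L - 1 then
          1 / x.s i * (x.px k i.succ (-1) - b * x.px k i.succ 0 / D)
            * (1 + b * (x.qx i.succ (-1) - 1) / (b + D))
        else x.p i m * (1 + b * (x.qx i.succ (-1) - 1) / (b + D)) }
  else
    let D : F := x.pairing k (L - n - 1) (L - n)
    { s := x.s
      q := fun i m =>
        if (m : ℕ) + 1 = L - n then
          x.q i m + b * (x.qx i.succ (L - n - 1) - x.q i m) / (b + D)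
        else x.q i m
      p := fun i m =>
        if (m : ℕ) + 1 = L - n then x.p i m * (1 + b / D)
        else if (m : ℕ) + 1 = L - n - 1 then x.p i m - b * x.px k i.succ (L - n) / D
        else x.p i m }

/-- The action of `π` on the variables. -/
def piPoint (k : Params L N) (x : Point L N F) : Point L N F where
  s := x.s
  q := fun i m => x.qx i.succ ((m : ℤ) + 1 + 1) / x.qx i.succ 1
  p := fun i m => x.px k i.succ ((m : ℤ) + 1 + 1) * x.qx i.succ 1

/-- The action of `ρ` on the variables. -/
def rhoPoint (k : Params L N) (x : Point L N F) : Point L N F where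
  s := fun i => 1 / x.s i
  q := fun i m => x.qx i.succ (L - ((m : ℤ) + 1)) / x.s i
  p := fun i m => x.s i * x.px k i.succ (L - ((m : ℤ) + 1))

/-- All denominators occurring in `rPoint n` are nonzero. -/
def rRegular (n : ℕ) (k : Params L N) (x : Point L N F) : Prop :=
  let a : F := algebraMap ℂ F (k.a n)
  let D : F := x.pairing k (n + 1) n
  D ≠ 0 ∧ a + D ≠ 0 ∧ (n = 0 → ∀ i : Fin N, a * x.qx i.succ 1 + D ≠ 0)

/-- All denominators occurring in `rPoint' n` are nonzero. -/
def rRegular' (n : ℕ) (k : Params L N) (x : Point L N F) : Prop :=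
  let b : F := algebraMap ℂ F (k.b n)
  let D : F := if n = 0 then x.pairing k (-1) 0 else x.pairing k (L - n - 1) (L - n)
  D ≠ 0 ∧ b + D ≠ 0 ∧ (n = 0 → ∀ i : Fin N, b * x.qx i.succ (-1) + D ≠ 0)

/-- All denominators occurring in `piPoint` are nonzero. -/
def piRegular (x : Point L N F) : Prop := ∀ i : Fin N, x.qx i.succ 1 ≠ 0

end Formulas

/-! ### The differential system and its holomorphic solutions -/

/-- `∂H_j/∂p_n^{(i)}` at a point. -/
def hamDp (k : Params L N) (x : Point L N ℂ) (j i : Fin N) (n : Fin (L - 1)) : ℂ :=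
  deriv (fun y : ℂ =>
    ham k { x with p := Function.update x.p i (Function.update (x.p i) n y) } j) (x.p i n)

/-- `∂H_j/∂q_n^{(i)}` at a point. -/
def hamDq (k : Params L N) (x : Point L N ℂ) (j i : Fin N) (n : Fin (L - 1)) : ℂ :=
  deriv (fun y : ℂ =>
    ham k { x with q := Function.update x.q i (Function.update (x.q i) n y) } j) (x.q i n)

/-- `(q, p)` is a holomorphic solution, on the open set `U` of values of `s = (s_1, …, s_N)`, of the
canonical Hamiltonian system `∂q/∂s_j = ∂H_j/∂p`, `∂p/∂s_j = -∂H_j/∂q` with parameters `k`;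
`U` avoids the fixed singularities `s_i = 0`, `s_i = 1`, `s_i = s_j`. -/
structure IsSolution (k : Params L N) (U : Set (Fin N → ℂ))
    (q p : (Fin N → ℂ) → Fin N → Fin (L - 1) → ℂ) : Prop where
  isOpen : IsOpen U
  ne_zero : ∀ s ∈ U, ∀ i, s i ≠ 0
  ne_one : ∀ s ∈ U, ∀ i, s i ≠ 1
  ne : ∀ s ∈ U, ∀ i j, i ≠ j → s i ≠ s j
  deriv_q : ∀ s ∈ U, ∀ i n, HasFDerivAt (fun s => q s i n)
    (∑ j, hamDp k ⟨s, q s, p s⟩ j i n • ContinuousLinearMap.proj (R := ℂ) (φ := fun _ => ℂ) j) s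
  deriv_p : ∀ s ∈ U, ∀ i n, HasFDerivAt (fun s => p s i n)
    (∑ j, (-hamDq k ⟨s, q s, p s⟩ j i n) •
      ContinuousLinearMap.proj (R := ℂ) (φ := fun _ => ℂ) j) s

/-! ### The field of rational functions in the variables, and its derivations -/

/-- Names of the variables `s_i`, `q_n^{(i)}`, `p_n^{(i)}`. -/
inductive Coord (L N : ℕ)
  | s (i : Fin N)
  | q (i : Fin N) (n : Fin (L - 1))
  | p (i : Fin N) (n : Fin (L - 1))

/-- The field `ℂ(s, q, p)` of rational functions on the extended phase space. -/
abbrev RatField (L N : ℕ) : Type := FractionRing (MvPolynomial (Coord L N) ℂ)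

/-- The coordinate functions. -/
def var (c : Coord L N) : RatField L N :=
  algebraMap (MvPolynomial (Coord L N) ℂ) (RatField L N) (MvPolynomial.X c)

/-- The generic point: the tuple of the coordinate functions. -/
def gen (L N : ℕ) : Point L N (RatField L N) where
  s := fun i => var (.s i)
  q := fun i n => var (.q i n)
  p := fun i n => var (.p i n)

/-- A derivation `d` of `ℂ[s, q, p]`, as the algebra homomorphism `a ↦ a + ε d(a)`
into the dual numbers over `ℂ(s, q, p)`. -/
def dualHom (d : Derivation ℂ (MvPolynomial (Coord L N) ℂ) (MvPolynomial (Coord L N) ℂ)) :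
    MvPolynomial (Coord L N) ℂ →ₐ[ℂ] TrivSqZeroExt (RatField L N) (RatField L N) where
  toFun a := TrivSqZeroExt.inl (algebraMap _ _ a) + TrivSqZeroExt.inr (algebraMap _ _ (d a))
  map_one' := by ext <;> simp
  map_mul' a b := by
    ext
    · simp
    · simp only [TrivSqZeroExt.snd_add, TrivSqZeroExt.snd_inl, TrivSqZeroExt.snd_inr,
        TrivSqZeroExt.snd_mul, TrivSqZeroExt.fst_add, TrivSqZeroExt.fst_inl,
        TrivSqZeroExt.fst_inr, Derivation.leibniz, map_add, map_mul, smul_eq_mul,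
        MulOpposite.smul_eq_mul_unop, MulOpposite.unop_op]
      ring
  map_zero' := by ext <;> simp
  map_add' a b := by
    ext
    · simp
    · simp only [TrivSqZeroExt.snd_add, TrivSqZeroExt.snd_inl, TrivSqZeroExt.snd_inr, map_add]
      ring
  commutes' c := by
    ext
    · simp [TrivSqZeroExt.algebraMap_eq_inl']
      rfl
    · simp [TrivSqZeroExt.algebraMap_eq_inl']

theorem isUnit_dualHom
    (d : Derivation ℂ (MvPolynomial (Coord L N) ℂ) (MvPolynomial (Coord L N) ℂ))
    (y : nonZeroDivisors (MvPolynomial (Coord L N) ℂ)) : IsUnit (dualHom d y) := by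
  rw [TrivSqZeroExt.isUnit_iff_isUnit_fst]
  have h : (dualHom d y).fst = algebraMap _ (RatField L N) (y : MvPolynomial (Coord L N) ℂ) := by
    simp [dualHom]
  rw [h]
  exact IsLocalization.map_units (RatField L N) y

/-- The extension of `dualHom d` to the field of fractions. -/
def dualHomFrac (d : Derivation ℂ (MvPolynomial (Coord L N) ℂ) (MvPolynomial (Coord L N) ℂ)) :
    RatField L N →ₐ[ℂ] TrivSqZeroExt (RatField L N) (RatField L N) :=
  IsLocalization.liftAlgHom (M := nonZeroDivisors (MvPolynomial (Coord L N) ℂ))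
    (f := dualHom d) (isUnit_dualHom d)

theorem dualHomFrac_algebraMap
    (d : Derivation ℂ (MvPolynomial (Coord L N) ℂ) (MvPolynomial (Coord L N) ℂ))
    (a : MvPolynomial (Coord L N) ℂ) :
    dualHomFrac d (algebraMap _ (RatField L N) a) = dualHom d a := by
  simp [dualHomFrac, IsLocalization.liftAlgHom_apply]

theorem fst_dualHomFrac
    (d : Derivation ℂ (MvPolynomial (Coord L N) ℂ) (MvPolynomial (Coord L N) ℂ))
    (f : RatField L N) : (dualHomFrac d f).fst = f := by
  have h : ((TrivSqZeroExt.fstHom ℂ (RatField L N) (RatField L N)).comp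
      (dualHomFrac d)).toRingHom = RingHom.id _ := by
    apply IsLocalization.ringHom_ext (nonZeroDivisors (MvPolynomial (Coord L N) ℂ))
    apply RingHom.ext
    intro a
    simp [dualHomFrac_algebraMap, dualHom]
  exact congrArg (fun g : RatField L N →+* RatField L N => g f) h

/-- The extension of a derivation of `ℂ[s, q, p]` to `ℂ(s, q, p)`. -/
def fracDerivation
    (d : Derivation ℂ (MvPolynomial (Coord L N) ℂ) (MvPolynomial (Coord L N) ℂ)) :
    Derivation ℂ (RatField L N) (RatField L N) :=
  Derivation.mk' ((TrivSqZeroExt.sndHom (RatField L N) (RatField L N)).restrictScalars ℂ ∘ₗ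
    (dualHomFrac d).toLinearMap) (by
      intro f g
      simp [fst_dualHomFrac, mul_comm])

theorem fracDerivation_algebraMap
    (d : Derivation ℂ (MvPolynomial (Coord L N) ℂ) (MvPolynomial (Coord L N) ℂ))
    (a : MvPolynomial (Coord L N) ℂ) :
    fracDerivation d (algebraMap _ _ a) = algebraMap _ _ (d a) := by
  change (dualHomFrac d (algebraMap _ _ a)).snd = _
  rw [dualHomFrac_algebraMap]
  change (TrivSqZeroExt.inl _ + TrivSqZeroExt.inr _ :
    TrivSqZeroExt (RatField L N) (RatField L N)).snd = _
  rw [TrivSqZeroExt.snd_add, TrivSqZeroExt.snd_inl, TrivSqZeroExt.snd_inr, zero_add]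

/-- The partial derivative of a rational function with respect to one of the variables. -/
def pd (c : Coord L N) : Derivation ℂ (RatField L N) (RatField L N) :=
  fracDerivation (Derivation.restrictScalars ℂ (MvPolynomial.pderiv c))

/-- The Poisson bracket for which `q, p` are canonical variables and the `s_i` are constants. -/
def poisson (f g : RatField L N) : RatField L N :=
  ∑ i, ∑ n, (pd (.p i n) f * pd (.q i n) g - pd (.q i n) f * pd (.p i n) g)

/-- The total derivative `d/ds_j` of rational functions of `s, q, p` along the Hamiltonian system
with parameters `k`: the derivation with `s_i ↦ δ_{ij}`, `q_n^{(i)} ↦ ∂H_j/∂p_n^{(i)}`,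
`p_n^{(i)} ↦ -∂H_j/∂q_n^{(i)}`. -/
def flow (k : Params L N) (j : Fin N) : Derivation ℂ (RatField L N) (RatField L N) :=
  pd (.s j) + ∑ i, ∑ n,
    (pd (.p i n) (ham k (gen L N) j) • pd (.q i n) - pd (.q i n) (ham k (gen L N) j) • pd (.p i n))

/-! ### Birational transformations acting also on the parameters -/

/-- A bijection `param` of the parameter space together with, for each parameter value `k`, a
birational transformation of the `(s, q, p)`-space, given as an automorphism of the field of
rational functions. The images under `field k` are the new variables, which belong to the
parameter value `param k`. -/
@[ext]
structure ParamBirational (L N : ℕ) where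
  param : Params L N ≃ Params L N
  field : Params L N → (RatField L N ≃ₐ[ℂ] RatField L N)

namespace ParamBirational

/-- Action on a function `F` of the parameters `k` and the variables `(s, q, p)`, rational in the
latter: substitute the images of the parameters and of the variables. -/
def act (T : ParamBirational L N) (F : Params L N → RatField L N) : Params L N → RatField L N :=
  fun k => T.field k (F (T.param k))

/-- The group structure is composition of the actions on functions, see `act_mul`. -/
instance : Group (ParamBirational L N) where
  mul T S := ⟨T.param.trans S.param, fun k => (S.field (T.param k)).trans (T.field k)⟩
  one := ⟨Equiv.refl _, fun _ => AlgEquiv.refl⟩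
  inv T := ⟨T.param.symm, fun k => (T.field (T.param.symm k)).symm⟩
  mul_assoc _ _ _ := rfl
  one_mul _ := rfl
  mul_one _ := rfl
  inv_mul_cancel T := by
    apply ParamBirational.ext
    · exact Equiv.symm_trans_self _
    · funext k
      exact AlgEquiv.self_trans_symm _

theorem act_mul (T S : ParamBirational L N) (F : Params L N → RatField L N) :
    (T * S).act F = T.act (S.act F) := rfl

theorem act_one (F : Params L N → RatField L N) : (1 : ParamBirational L N).act F = F := rfl

/-- The images of the variables `s, q, p` are given by the formulas `τ`. -/
def ActsBy (T : ParamBirational L N)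
    (τ : Params L N → Point L N (RatField L N) → Point L N (RatField L N)) : Prop :=
  ∀ k, (∀ i, T.field k (var (.s i)) = (τ k (gen L N)).s i) ∧
    (∀ i n, T.field k (var (.q i n)) = (τ k (gen L N)).q i n) ∧
    (∀ i n, T.field k (var (.p i n)) = (τ k (gen L N)).p i n)

/-- The transformation is canonical: it preserves the Poisson brackets. -/
def IsCanonical (T : ParamBirational L N) : Prop :=
  ∀ k f g, poisson (T.field k f) (T.field k g) = T.field k (poisson f g)

/-- The new variables satisfy, along the Hamiltonian system with parameters `k`, the Hamiltonian
system with parameters `T.param k`: writing `S, Q, P` for the new variables,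
`df(S, Q, P)/ds_j = ∑_l (dS_l/ds_j) (df/ds_l)(S, Q, P)` for all rational functions `f`, where `d/ds_j`
on the left is taken with respect to `k` and `df/ds_l` on the right with respect to `T.param k`. -/
def IsInvariant (T : ParamBirational L N) : Prop :=
  ∀ k j f, flow k j (T.field k f) =
    ∑ l, flow k j (T.field k (var (.s l))) * T.field k (flow (T.param k) l f)

/-- The formulas `τ` map each holomorphic solution with parameters `k` on whose graph the
denominators do not vanish (`reg`) to a solution with parameters `T.param k`.
The involution `σ` is the induced transformation of `s = (s_1, …, s_N)`. -/
def MapsSolutions (T : ParamBirational L N) (σ : (Fin N → ℂ) → Fin N → ℂ)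
    (τ : Params L N → Point L N ℂ → Point L N ℂ)
    (reg : Params L N → Point L N ℂ → Prop) : Prop :=
  ∀ k U q p, IsSolution k U q p → (∀ s ∈ U, reg k ⟨s, q s, p s⟩) →
    IsSolution (T.param k) (σ ⁻¹' U)
      (fun s => (τ k ⟨σ s, q (σ s), p (σ s)⟩).q) (fun s => (τ k ⟨σ s, q (σ s), p (σ s)⟩).p)

end ParamBirational

/-! ### The affine Weyl group -/

/-- The Coxeter matrix of type `A_{L-1}^{(1)}` (`L ≥ 2`): the diagram is the cycle `ℤ/Lℤ` if
`L ≥ 3`; for `L = 2` the two generators satisfy no braid relation (entry `0`). -/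
def affineA (L : ℕ) : CoxeterMatrix (ZMod L) where
  M := Matrix.of fun m n =>
    if m = n then 1 else if m = n + 1 ∨ n = m + 1 then (if L = 2 then 0 else 3) else 2
  isSymm := by
    ext m n
    simp only [Matrix.transpose_apply, Matrix.of_apply, eq_comm (a := n) (b := m),
      or_comm (a := n = m + 1)]
  diagonal := by simp
  off_diagonal m n h := by
    simp only [Matrix.of_apply, if_neg h]
    split_ifs <;> norm_num

end HLN

end

open HLN

noncomputable section
namespace HLN
variable {L N : ℕ} {F K : Type*}

/-! The formulas become simple once the normalization q_n^{(0)} = q_0^{(j)} = 1 is dropped. A point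
is encoded by homogeneous coordinates q_n^{(j)}, p_n^{(j)} (0 ≤ j ≤ N, n ∈ ℤ), taken modulo the
torus q ↦ l_n u_j q, p ↦ p/(l_n u_j), with quasi-periods s_j and moments ∑_j q_n p_n = κ_n, ∑_n q_n
p_n = θ_j (`Cfg.Admissible`). The normalization is a slice for the torus, so a point is recovered
from its class (`Point.eq_of_cfg_equiv`). In these coordinates r_n is the shear q_n ↦ q_n + (a/D_n)
q_{n+1}, p_{n+1} ↦ p_{n+1} − (a/D_n) p_n, π is the shift of the index, ρ is n ↦ −n, and r_n' = ρ r_n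
ρ. The displayed formulas result from restoring the normalization (`rPoint_cfg_of_ne_zero`,
`rPoint_cfg_zero`, `piPoint_cfg`, `rhoPoint_cfg`).

The relations are then short identities between shears (`Cfg.r_r`, `Cfg.r_braid`,
`Cfg.r_r'_comm_equiv`), and the L-fold shift is an element of the torus. Rational inverses of the
formulas turn them into automorphisms of the function field (`exists_algEquiv`).

Canonicity and invariance both follow from the preservation of ω = ∑ dp∧dq − ∑ dH_i∧ds_i. Fibrewise
ω determines the Poisson bracket, and the Hamiltonian flows are the lifts of ∂/∂s_j that are
ω-orthogonal to the fibres (`PreservesForm.isCanonical`, `PreservesForm.isInvariant`). In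
homogeneous coordinates ω is a sum over any L consecutive indices; it is unchanged by the torus, by
moving this window, by the shears and by reversal (`Cfg.form_gauge`, `Cfg.form_window`,
`Cfg.form_r`, `Cfg.form_rev`). Evaluating the resulting identity of derivations along a solution
gives the statement on holomorphic solutions.

Faithfulness is visible on the parameters alone: the 𝔞_n transform as the simple affine roots, and
at a point where all of them are positive only the identity keeps them positive (`root_pos`,
`eq_one_of_root_pos`). -/

theorem Point.ext' {x y : Point L N F} (hs : ∀ i, x.s i = y.s i) (hq : ∀ i n, x.q i n = y.q i n)
    (hp : ∀ i n, x.p i n = y.p i n) : x = y := by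
  cases x; cases y
  simp only [Point.mk.injEq]
  exact ⟨funext hs, funext fun i => funext (hq i), funext fun i => funext (hp i)⟩

variable [Field F] [Field K]

/-! ### Naturality -/

/-- The image of a point under a homomorphism of fields. -/
def Point.map (φ : F →+* K) (x : Point L N F) : Point L N K where
  s := fun i => φ (x.s i)
  q := fun i n => φ (x.q i n)
  p := fun i n => φ (x.p i n)

@[simp] theorem Point.map_s (φ : F →+* K) (x : Point L N F) (i : Fin N) :
    (x.map φ).s i = φ (x.s i) := rfl

@[simp] theorem Point.map_q (φ : F →+* K) (x : Point L N F) (i : Fin N) (n : Fin (L - 1)) :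
    (x.map φ).q i n = φ (x.q i n) := rfl

@[simp] theorem Point.map_p (φ : F →+* K) (x : Point L N F) (i : Fin N) (n : Fin (L - 1)) :
    (x.map φ).p i n = φ (x.p i n) := rfl

@[simp] theorem Point.sx_zero (x : Point L N F) : x.sx 0 = 1 := rfl

@[simp] theorem Point.sx_succ (x : Point L N F) (i : Fin N) : x.sx i.succ = x.s i := rfl

theorem Point.sx_ne_zero {x : Point L N F} (hs : ∀ i, x.s i ≠ 0) (j : Fin (N + 1)) :
    x.sx j ≠ 0 := by
  refine Fin.cases ?_ (fun i => ?_) j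
  · simp
  · exact hs i

theorem Point.sx_map (φ : F →+* K) (x : Point L N F) (j : Fin (N + 1)) :
    (x.map φ).sx j = φ (x.sx j) := by
  refine Fin.cases ?_ (fun i => ?_) j
  · simp
  · rfl

theorem Point.qBase_map (φ : F →+* K) (x : Point L N F) (j : Fin (N + 1)) (m : ℕ) :
    (x.map φ).qBase j m = φ (x.qBase j m) := by
  refine Fin.cases ?_ (fun i => ?_) j
  · simp [Point.qBase]
  · simp only [Point.qBase, Fin.cases_succ]
    split_ifs
    · rfl
    · simp

theorem Point.qx_map (φ : F →+* K) (x : Point L N F) (j : Fin (N + 1)) (m : ℤ) :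
    (x.map φ).qx j m = φ (x.qx j m) := by
  simp [Point.qx, Point.sx_map, Point.qBase_map]

/-! ### Extended indices -/

theorem Point.qx_add (hL : 2 ≤ L) {x : Point L N F} (hs : ∀ i, x.s i ≠ 0) (j : Fin (N + 1))
    (n : ℤ) : x.qx j (n + L) = x.sx j * x.qx j n := by
  have hL' : (L : ℤ) ≠ 0 := by omega
  have h1 : (n + (L : ℤ)) / L = n / L + 1 := Int.add_ediv_of_dvd_right dvd_rfl |>.trans (by
    rw [Int.ediv_self hL'])
  rw [Point.qx, Point.qx, Int.add_emod_right, h1, zpow_add_one₀ (Point.sx_ne_zero hs j)]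
  ring

@[simp] theorem Point.qx_zero_left (x : Point L N F) (n : ℤ) : x.qx 0 n = 1 := by
  simp [Point.qx, Point.qBase]

@[simp] theorem Point.qx_zero (x : Point L N F) (j : Fin (N + 1)) : x.qx j 0 = 1 := by
  refine Fin.cases ?_ (fun i => ?_) j <;> simp [Point.qx, Point.qBase]

theorem Point.qx_fin (hL : 2 ≤ L) (x : Point L N F) (i : Fin N) (m : Fin (L - 1)) :
    x.qx i.succ ((m : ℤ) + 1) = x.q i m := by
  have h0 : (m : ℕ) < L - 1 := m.2
  have h1 : ((m : ℤ) + 1) / L = 0 := Int.ediv_eq_zero_of_lt (by omega) (by omega)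
  have h2 : ((m : ℤ) + 1) % L = ((m + 1 : ℕ) : ℤ) := by
    rw [Int.emod_eq_of_lt (by omega) (by omega)]; push_cast; ring
  rw [Point.qx, h1, h2, Int.toNat_natCast]
  simp only [Point.qBase, Fin.cases_succ]
  rw [dif_pos (by omega)]
  simp

variable [Algebra ℂ F] [Algebra ℂ K]

theorem Point.pBasePos_map (φ : F →ₐ[ℂ] K) (k : Params L N) (x : Point L N F) (i : Fin N) (m : ℕ) :
    (x.map (φ : F →+* K)).pBasePos k i m = φ (x.pBasePos k i m) := by
  simp only [Point.pBasePos]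
  split_ifs
  · rfl
  · simp [Point.map]

theorem Point.pBase_map (φ : F →ₐ[ℂ] K) (k : Params L N) (x : Point L N F) (j : Fin (N + 1))
    (m : ℕ) : (x.map (φ : F →+* K)).pBase k j m = φ (x.pBase k j m) := by
  refine Fin.cases ?_ (fun i => ?_) j
  · simp [Point.pBase, Point.pBasePos_map, Point.qBase_map]
  · simp [Point.pBase, Point.pBasePos_map]

theorem Point.px_map (φ : F →ₐ[ℂ] K) (k : Params L N) (x : Point L N F) (j : Fin (N + 1))
    (m : ℤ) : (x.map (φ : F →+* K)).px k j m = φ (x.px k j m) := by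
  simp [Point.px, Point.sx_map, Point.pBase_map]

theorem Point.pairing_map (φ : F →ₐ[ℂ] K) (k : Params L N) (x : Point L N F)
    (m n : ℤ) : (x.map (φ : F →+* K)).pairing k m n = φ (x.pairing k m n) := by
  simp [Point.pairing, Point.qx_map, Point.px_map]

/-- Rational formulas commute with homomorphisms of fields. This turns composition of substitutions
into iterated application of the formulas (`ParamBirational.mul_rB_pt`), and allows a formula to be
evaluated in a subfield (`adjoin_eq_top_of_inverse`). -/
theorem rPoint_map (φ : F →ₐ[ℂ] K) (n : ℕ) (k : Params L N) (x : Point L N F) :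
    rPoint n k (x.map (φ : F →+* K)) = (rPoint n k x).map (φ : F →+* K) := by
  by_cases h : n = 0 <;> apply Point.ext' <;> intros <;>
    simp [rPoint, h, apply_ite (f := φ), Point.qx_map, Point.px_map, Point.pairing_map]

theorem piPoint_map (φ : F →ₐ[ℂ] K) (k : Params L N) (x : Point L N F) :
    piPoint k (x.map (φ : F →+* K)) = (piPoint k x).map (φ : F →+* K) := by
  apply Point.ext' <;> intros <;>
    simp [piPoint, Point.qx_map, Point.px_map]

theorem rhoPoint_map (φ : F →ₐ[ℂ] K) (k : Params L N) (x : Point L N F) :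
    rhoPoint k (x.map (φ : F →+* K)) = (rhoPoint k x).map (φ : F →+* K) := by
  apply Point.ext' <;> intros <;>
    simp [rhoPoint, Point.qx_map, Point.px_map]

theorem Point.px_add (hL : 2 ≤ L) (k : Params L N) {x : Point L N F} (hs : ∀ i, x.s i ≠ 0)
    (j : Fin (N + 1)) (n : ℤ) : x.px k j (n + L) = x.px k j n / x.sx j := by
  have hL' : (L : ℤ) ≠ 0 := by omega
  have h1 : (n + (L : ℤ)) / L = n / L + 1 := Int.add_ediv_of_dvd_right dvd_rfl |>.trans (by
    rw [Int.ediv_self hL'])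
  rw [Point.px, Point.px, Int.add_emod_right, h1, neg_add, ← sub_eq_add_neg,
    zpow_sub_one₀ (Point.sx_ne_zero hs j)]
  field_simp

theorem Point.px_fin (hL : 2 ≤ L) (k : Params L N) (x : Point L N F) (i : Fin N)
    (m : Fin (L - 1)) : x.px k i.succ ((m : ℤ) + 1) = x.p i m := by
  have h0 : (m : ℕ) < L - 1 := m.2
  have h1 : ((m : ℤ) + 1) / L = 0 := Int.ediv_eq_zero_of_lt (by omega) (by omega)
  have h2 : ((m : ℤ) + 1) % L = ((m + 1 : ℕ) : ℤ) := by
    rw [Int.emod_eq_of_lt (by omega) (by omega)]; push_cast; ring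
  rw [Point.px, h1, h2, Int.toNat_natCast]
  simp only [Point.pBase, Fin.cases_succ, Point.pBasePos]
  rw [dif_pos (by omega)]
  simp

theorem Params.κ_emod (hL : 2 ≤ L) (k : Params L N) (n : ℤ) :
    k.κ ((n % (L : ℤ)).toNat : ℤ) = k.κ n := by
  have hp : Function.Periodic k.κ (L : ℤ) := k.κ_add
  rw [Int.toNat_of_nonneg (Int.emod_nonneg _ (by omega)), Int.emod_def, mul_comm]
  exact hp.sub_int_mul_eq (n / L)

/-- Built into the definition of p_n^{(0)}; the powers of s_i cancel in each product q_n p_n, so it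
persists for all integer indices. -/
theorem Point.sum_left (hL : 2 ≤ L) (k : Params L N) {x : Point L N F} (hs : ∀ i, x.s i ≠ 0)
    (n : ℤ) : ∑ j, x.qx j n * x.px k j n = algebraMap ℂ F (k.κ n) := by
  rw [Fin.sum_univ_succ, Point.qx_zero_left, one_mul, Point.px]
  simp only [Point.sx_zero, one_zpow, one_mul, Point.pBase, Fin.cases_zero]
  rw [Params.κ_emod hL]
  have : ∀ i : Fin N, x.qx i.succ n * x.px k i.succ n =
      x.qBase i.succ (n % (L : ℤ)).toNat * x.pBasePos k i (n % (L : ℤ)).toNat := by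
    intro i
    have h0 : x.s i ≠ 0 := hs i
    simp only [Point.qx, Point.px, Point.sx_succ, Point.pBase, Fin.cases_succ]
    rw [zpow_neg]
    field_simp
  simp only [this]
  ring

theorem Point.sum_right_succ (hL : 2 ≤ L) (k : Params L N) (x : Point L N F)
    (i : Fin N) : ∑ n ∈ Finset.range L, x.qx i.succ n * x.px k i.succ n
      = algebraMap ℂ F (k.θ i.succ) := by
  obtain ⟨M, rfl⟩ : ∃ M, L = M + 1 := ⟨L - 1, by omega⟩
  rw [Finset.sum_range_succ']
  have h : ∑ n ∈ Finset.range M, x.qx i.succ ((n + 1 : ℕ) : ℤ) * x.px k i.succ ((n + 1 : ℕ) : ℤ)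
      = ∑ n : Fin (M + 1 - 1), x.q i n * x.p i n := by
    rw [Finset.sum_range]
    refine Finset.sum_congr rfl fun n _ => ?_
    have h1 := Point.qx_fin hL x i n
    have h2 := Point.px_fin hL k x i n
    push_cast at h1 h2 ⊢
    rw [← h1, ← h2]
  rw [h]
  simp [Point.px, Point.pBase, Point.pBasePos]

/-- For j ≥ 1 this is the definition of p_0^{(j)}. For j = 0 it is forced by summing over all n and
j, and here the relation ∑ κ_n = ∑ θ_i is used. -/
theorem Point.sum_right (hL : 2 ≤ L) (k : Params L N) {x : Point L N F} (hs : ∀ i, x.s i ≠ 0)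
    (j : Fin (N + 1)) : ∑ n ∈ Finset.range L, x.qx j n * x.px k j n
      = algebraMap ℂ F (k.θ j) := by
  refine Fin.cases ?_ (fun i => Point.sum_right_succ hL k x i) j
  have h := Finset.sum_comm (s := Finset.range L) (t := Finset.univ)
    (f := fun (n : ℕ) (j : Fin (N + 1)) => x.qx j n * x.px k j n)
  simp only [Point.sum_left hL k hs] at h
  rw [Fin.sum_univ_succ] at h
  simp only [Point.sum_right_succ hL k x] at h
  rw [← map_sum, k.sum_κ, Fin.sum_univ_succ, map_add, map_sum] at h
  exact (add_right_cancel h).symm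
end HLN
end

noncomputable section
namespace HLN
variable {L N : ℕ} {F K : Type*} [Field F] [Field K]

/-! ### Transformations of the parameters -/

theorem Params.ext' {k l : Params L N} (he : ∀ n, k.e n = l.e n) (hκ : ∀ n, k.κ n = l.κ n)
    (hθ : k.θ = l.θ) : k = l :=
  Params.ext (funext he) (funext hκ) hθ

theorem Params.a_add (k : Params L N) (n : ℤ) : k.a (n + L) = k.a n := by
  rw [Params.a, Params.a, k.e_add, show n + (L : ℤ) + 1 = n + 1 + L by ring, k.e_add]
  ring

theorem Params.b_add (k : Params L N) (n : ℤ) : k.b (n + L) = k.b n := by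
  have h1 := k.e_add (L - (n + L))
  have h2 := k.e_add (L - (n + L) - 1)
  have h3 := k.κ_add (L - (n + L))
  have h4 := k.κ_add (L - (n + L) - 1)
  rw [show (L : ℤ) - (n + L) + L = L - n by ring] at h1 h3
  rw [show (L : ℤ) - (n + L) - 1 + L = L - n - 1 by ring] at h2 h4
  rw [Params.b, Params.b, h1, h2, h3, h4]
  ring

theorem eq_of_intCast_eq {α : Type*} {f : ℤ → α} (hf : ∀ n, f (n + L) = f n) {m n : ℤ}
    (h : (m : ZMod L) = n) : f m = f n := by
  obtain ⟨c, hc⟩ := (ZMod.intCast_eq_intCast_iff_dvd_sub m n L).1 h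
  have hp : Function.Periodic f (L : ℤ) := hf
  rw [show n = m + c * L by rw [mul_comm]; omega]
  exact (hp.int_mul c m).symm

theorem Params.a_eq [NeZero L] (k : Params L N) {m : ℤ} {n : ZMod L} (h : (m : ZMod L) = n) :
    k.a n.val = k.a m :=
  eq_of_intCast_eq k.a_add (by simp [h])

theorem Params.b_eq [NeZero L] (k : Params L N) {m : ℤ} {n : ZMod L} (h : (m : ZMod L) = n) :
    k.b n.val = k.b m :=
  eq_of_intCast_eq k.b_add (by simp [h])

theorem natCast_zmod_eq_iff [NeZero L] {m : ℕ} (hm : m < L) (n : ZMod L) :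
    (m : ZMod L) = n ↔ m = n.val := by
  constructor
  · rintro rfl
    exact (ZMod.val_cast_of_lt hm).symm
  · rintro rfl
    simp

theorem sum_range_ite_cast [NeZero L] {M : Type*} [AddCommMonoid M] (n : ZMod L) (c : M) :
    ∑ m ∈ Finset.range L, (if ((m : ℤ) : ZMod L) = n then c else 0) = c := by
  rw [Finset.sum_eq_single n.val]
  · simp
  · intro m hm hmn
    rw [if_neg]
    rw [Int.cast_natCast, natCast_zmod_eq_iff (Finset.mem_range.1 hm)]
    exact hmn
  · intro h
    exact absurd (Finset.mem_range.2 (ZMod.val_lt n)) h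

/-- The action of `r_n` on the parameters. -/
def rParam [NeZero L] (n : ZMod L) (k : Params L N) : Params L N where
  e m := k.e m + (if (m : ZMod L) = n then k.a n.val else 0)
    - (if (m : ZMod L) = n + 1 then k.a n.val else 0)
  κ m := k.κ m + (if (m : ZMod L) = n then k.a n.val else 0)
    - (if (m : ZMod L) = n + 1 then k.a n.val else 0)
  θ := k.θ
  e_add m := by
    simp only [k.e_add, Int.cast_add, Int.cast_natCast, CharP.cast_eq_zero, add_zero]
    ring
  κ_add m := by
    simp only [k.κ_add, Int.cast_add, Int.cast_natCast, CharP.cast_eq_zero, add_zero]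
  sum_e := by
    simp only [Finset.sum_sub_distrib, Finset.sum_add_distrib, sum_range_ite_cast, k.sum_e]
    ring
  sum_κ := by
    simp only [Finset.sum_sub_distrib, Finset.sum_add_distrib, sum_range_ite_cast, k.sum_κ]
    ring

/-- Moving a window of L consecutive indices by one step trades its first term for the term L places
further on, which quasi-periodicity then compares with the first. -/
theorem sum_range_shift {M : Type*} [AddCommGroup M] (f : ℤ → M) (w : ℤ) :
    ∑ n ∈ Finset.range L, f (w + 1 + n) = ∑ n ∈ Finset.range L, f (w + n) + f (w + L) - f w := by
  have h := Finset.sum_range_succ (fun n : ℕ => f (w + n)) L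
  rw [Finset.sum_range_succ'] at h
  rw [← h]
  simp only [Nat.cast_zero, add_zero, add_sub_cancel_right]
  refine Finset.sum_congr rfl fun n _ => ?_
  push_cast
  ring_nf

theorem sum_range_reflect_int {M : Type*} [AddCommGroup M] (f : ℤ → M) (w : ℤ) :
    ∑ n ∈ Finset.range L, f (w - n) = ∑ n ∈ Finset.range L, f (w + 1 - L + n) := by
  rw [← Finset.sum_range_reflect]
  refine Finset.sum_congr rfl fun n hn => ?_
  have := Finset.mem_range.1 hn
  congr 1
  omega

/-- The action of `π` on the parameters. -/
def piParam [NeZero L] (k : Params L N) : Params L N where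
  e m := k.e (m + 1) - 1 / (L : ℂ)
  κ m := k.κ (m + 1)
  θ := k.θ
  e_add m := by
    rw [show m + (L : ℤ) + 1 = m + 1 + L by ring, k.e_add]
    ring
  κ_add m := by
    rw [show m + (L : ℤ) + 1 = m + 1 + L by ring, k.κ_add]
  sum_e := by
    have h := sum_range_shift (L := L) k.e 0
    have h2 := k.e_add 0
    have hL : (L : ℂ) ≠ 0 := Nat.cast_ne_zero.2 (NeZero.ne L)
    simp only [zero_add] at h h2
    rw [Finset.sum_sub_distrib]
    simp only [Finset.sum_const, Finset.card_range, nsmul_eq_mul]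
    simp only [add_comm _ (1 : ℤ), h, h2, k.sum_e]
    field_simp
    ring
  sum_κ := by
    have h := sum_range_shift (L := L) k.κ 0
    have h2 := k.κ_add 0
    simp only [zero_add] at h h2
    simp only [add_comm _ (1 : ℤ), h, h2, k.sum_κ]
    ring

/-- The action of `ρ` on the parameters. -/
def rhoParam [NeZero L] (k : Params L N) : Params L N where
  e m := k.κ (L - m) - k.e (L - m) - (∑ i, k.θ i) / (L : ℂ) + 1
  κ m := k.κ (L - m)
  θ := k.θ
  e_add m := by
    have h1 := k.e_add (L - (m + L))
    have h2 := k.κ_add (L - (m + L))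
    rw [show (L : ℤ) - (m + L) + L = L - m by ring] at h1 h2
    rw [h1, h2]
    ring
  κ_add m := by
    have h2 := k.κ_add (L - (m + L))
    rw [show (L : ℤ) - (m + L) + L = L - m by ring] at h2
    rw [h2]
  sum_e := by
    have hL : (L : ℂ) ≠ 0 := Nat.cast_ne_zero.2 (NeZero.ne L)
    have h1 := sum_range_shift (L := L) k.e 0
    have h2 := sum_range_shift (L := L) k.κ 0
    have h3 := k.e_add 0
    have h4 := k.κ_add 0
    simp only [zero_add] at h1 h2 h3 h4
    simp only [Finset.sum_add_distrib, Finset.sum_sub_distrib, sum_range_reflect_int,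
      show (L : ℤ) + 1 - L = 1 by ring, h1, h2, h3, h4, k.sum_e, k.sum_κ]
    simp only [Finset.sum_const, Finset.card_range, nsmul_eq_mul]
    field_simp
    ring
  sum_κ := by
    have h2 := sum_range_shift (L := L) k.κ 0
    have h4 := k.κ_add 0
    simp only [zero_add] at h2 h4
    simp only [sum_range_reflect_int, show (L : ℤ) + 1 - L = 1 by ring, h2, h4, k.sum_κ]
    ring

theorem rhoParam_rhoParam [NeZero L] (k : Params L N) : rhoParam (rhoParam k) = k := by
  have hL : (L : ℂ) ≠ 0 := Nat.cast_ne_zero.2 (NeZero.ne L)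
  refine Params.ext' (fun n => ?_) (fun n => ?_) rfl
  · simp [rhoParam]
    ring
  · simp [rhoParam]

/-- Since ρ exchanges the two families of roots, r_n' can be treated as the conjugate of r_n by ρ.
-/
theorem rhoParam_a [NeZero L] (k : Params L N) (n : ℤ) : (rhoParam k).a n = k.b n := by
  simp only [Params.a, rhoParam, Params.b, show (L : ℤ) - (n + 1) = L - n - 1 by ring]
  ring

theorem piParam_a [NeZero L] (k : Params L N) (n : ℤ) : (piParam k).a n = k.a (n + 1) := by
  simp only [Params.a, piParam]
  ring

theorem intCast_ne_add_one (hL : 2 ≤ L) {m : ℤ} {n : ZMod L} (h : (m : ZMod L) = n) :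
    ¬ (m : ZMod L) = n + 1 := by
  rw [h]
  have : Fact (1 < L) := ⟨by omega⟩
  simp

theorem rParam_a_self [NeZero L] (hL : 2 ≤ L) (k : Params L N) (n : ZMod L) :
    (rParam n k).a n.val = - k.a n.val := by
  have : Fact (1 < L) := ⟨by omega⟩
  simp only [Params.a, rParam]
  simp

theorem rParam_rParam [NeZero L] (hL : 2 ≤ L) (k : Params L N) (n : ZMod L) :
    rParam n (rParam n k) = k := by
  have h := rParam_a_self hL k n
  refine Params.ext' (fun m => ?_) (fun m => ?_) rfl
  · change (rParam n k).e m + (if (m : ZMod L) = n then (rParam n k).a n.val else 0)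
      - (if (m : ZMod L) = n + 1 then (rParam n k).a n.val else 0) = _
    rw [h]
    simp only [rParam]
    split_ifs <;> ring
  · change (rParam n k).κ m + (if (m : ZMod L) = n then (rParam n k).a n.val else 0)
      - (if (m : ZMod L) = n + 1 then (rParam n k).a n.val else 0) = _
    rw [h]
    simp only [rParam]
    split_ifs <;> ring

theorem piParam_rParam [NeZero L] (k : Params L N) (n : ZMod L) :
    rParam n (piParam k) = piParam (rParam (n + 1) k) := by
  have h : (piParam k).a n.val = k.a (n + 1).val := by
    rw [piParam_a, k.a_eq]
    simp
  refine Params.ext' (fun m => ?_) (fun m => ?_) rfl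
  · simp only [rParam, h]
    simp only [piParam, Int.cast_add, Int.cast_one, add_left_inj]
    ring
  · simp only [rParam, h]
    simp only [piParam, Int.cast_add, Int.cast_one, add_left_inj]

/-- The action of `r_n'` on the parameters. -/
def rParam' [NeZero L] (n : ZMod L) (k : Params L N) : Params L N :=
  rhoParam (rParam n (rhoParam k))

/-- Under r_n the parameters e and κ receive equal increments, and these cancel in the combination κ
− e that ρ uses for the new e. -/
theorem rParam'_e [NeZero L] (k : Params L N) (n : ZMod L) : (rParam' n k).e = k.e := by
  funext m
  simp [rParam', rParam, rhoParam]
  ring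

theorem rParam'_κ [NeZero L] (k : Params L N) (n : ZMod L) (m : ℤ) :
    (rParam' n k).κ m = k.κ m + (if (m : ZMod L) = -n then k.b n.val else 0)
      - (if (m : ZMod L) = -n - 1 then k.b n.val else 0) := by
  change (rhoParam k).κ (L - m) + (if ((L - m : ℤ) : ZMod L) = n then (rhoParam k).a n.val else 0)
      - (if ((L - m : ℤ) : ZMod L) = n + 1 then (rhoParam k).a n.val else 0) = _
  rw [rhoParam_a]
  have h1 : ((L - m : ℤ) : ZMod L) = n ↔ (m : ZMod L) = -n := by
    simp [neg_eq_iff_eq_neg]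
  have h2 : ((L - m : ℤ) : ZMod L) = n + 1 ↔ (m : ZMod L) = -n - 1 := by
    simp [neg_eq_iff_eq_neg, sub_eq_add_neg, add_comm]
  simp only [h1, h2, rhoParam, sub_sub_cancel]

end HLN
end

noncomputable section
namespace HLN
variable {L N : ℕ} {F K : Type*} [Field F] [Field K]

/-! ### Homogeneous configurations -/

/-- Homogeneous coordinates: the variables `q_n^{(j)}, p_n^{(j)}` for `0 ≤ j ≤ N` and `n ∈ ℤ`,
without the normalization `q_n^{(0)} = q_0^{(j)} = 1`. -/
@[ext]
structure Cfg (N : ℕ) (F : Type*) where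
  q : Fin (N + 1) → ℤ → F
  p : Fin (N + 1) → ℤ → F

/-- The action of the torus on homogeneous coordinates. -/
@[simps]
def Cfg.gauge (C : Cfg N F) (l : ℤ → F) (u : Fin (N + 1) → F) : Cfg N F where
  q j n := l n * u j * C.q j n
  p j n := C.p j n / (l n * u j)

/-- Equality up to the action of the torus. -/
def Cfg.Equiv (C C' : Cfg N F) : Prop :=
  ∃ l u, (∀ n, l n ≠ 0) ∧ (∀ j, u j ≠ 0) ∧ C' = C.gauge l u

theorem Cfg.Equiv.refl (C : Cfg N F) : C.Equiv C :=
  ⟨1, 1, by simp, by simp, by ext <;> simp⟩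

theorem Cfg.Equiv.symm {C C' : Cfg N F} (h : C.Equiv C') : C'.Equiv C := by
  obtain ⟨l, u, hl, hu, rfl⟩ := h
  refine ⟨l⁻¹, u⁻¹, fun n => inv_ne_zero (hl n), fun n => inv_ne_zero (hu n), ?_⟩
  ext j n
  · have := hl n
    have := hu j
    simp only [Cfg.gauge_q, Pi.inv_apply]
    field_simp
  · have := hl n
    have := hu j
    simp only [Cfg.gauge_p, Pi.inv_apply]
    field_simp

theorem Cfg.Equiv.trans {C C' C'' : Cfg N F} (h : C.Equiv C') (h' : C'.Equiv C'') :
    C.Equiv C'' := by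
  obtain ⟨l, u, hl, hu, rfl⟩ := h
  obtain ⟨l', u', hl', hu', rfl⟩ := h'
  refine ⟨l' * l, u' * u, fun n => mul_ne_zero (hl' n) (hl n), fun n => mul_ne_zero (hu' n) (hu n), ?_⟩
  ext j n
  · simp only [Cfg.gauge_q, Pi.mul_apply]
    ring
  · have := hl n
    have := hu j
    have := hl' n
    have := hu' j
    simp only [Cfg.gauge_p, Pi.mul_apply]
    field_simp

/-- `∑_j q_{n+1}^{(j)} p_n^{(j)}`. -/
def Cfg.D (C : Cfg N F) (n : ℤ) : F := ∑ j, C.q j (n + 1) * C.p j n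

/-- `∑_j q_{n-1}^{(j)} p_n^{(j)}`. -/
def Cfg.D' (C : Cfg N F) (n : ℤ) : F := ∑ j, C.q j (n - 1) * C.p j n

/-- `r_n` in homogeneous coordinates. -/
@[simps]
def Cfg.r (C : Cfg N F) (n : ZMod L) (a : F) : Cfg N F where
  q j m := C.q j m + if (m : ZMod L) = n then a / C.D m * C.q j (m + 1) else 0
  p j m := C.p j m - if (m : ZMod L) = n + 1 then a / C.D (m - 1) * C.p j (m - 1) else 0

/-- Shift of the indices. -/
@[simps]
def Cfg.shift (C : Cfg N F) : Cfg N F where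
  q j m := C.q j (m + 1)
  p j m := C.p j (m + 1)

/-- Reversal of the indices. -/
@[simps]
def Cfg.rev (C : Cfg N F) : Cfg N F where
  q j m := C.q j (-m)
  p j m := C.p j (-m)

/-- `r_n'` in homogeneous coordinates. -/
@[simps]
def Cfg.r' (C : Cfg N F) (l : ZMod L) (b : F) : Cfg N F where
  q j m := C.q j m + if (m : ZMod L) = l then b / C.D' m * C.q j (m - 1) else 0
  p j m := C.p j m - if (m : ZMod L) = l - 1 then b / C.D' (m + 1) * C.p j (m + 1) else 0

theorem Cfg.rev_r_rev (C : Cfg N F) (n : ZMod L) (b : F) :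
    (C.rev.r n b).rev = C.r' (-n) b := by
  have h1 : ∀ m : ℤ, ((-m : ℤ) : ZMod L) = n ↔ (m : ZMod L) = -n := by
    simp [neg_eq_iff_eq_neg]
  have h2 : ∀ m : ℤ, ((-m : ℤ) : ZMod L) = n + 1 ↔ (m : ZMod L) = -n - 1 := by
    simp [neg_eq_iff_eq_neg, sub_eq_add_neg, add_comm]
  have e1 : ∀ m : ℤ, -(-m + 1) = m - 1 := fun m => by ring
  have e2 : ∀ m : ℤ, -(-m - 1) = m + 1 := fun m => by ring
  have e3 : ∀ m : ℤ, -(-m - 1 + 1) = m + 1 - 1 := fun m => by ring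
  ext j m
  · simp only [Cfg.rev_q, Cfg.r_q, Cfg.r'_q, Cfg.D, Cfg.D', Cfg.rev_p, h1, e1, neg_neg]
  · simp only [Cfg.rev_p, Cfg.r_p, Cfg.r'_p, Cfg.D, Cfg.D', Cfg.rev_q, h2, e2, e3, neg_neg]

theorem Cfg.gauge_D {C : Cfg N F} {l : ℤ → F} {u : Fin (N + 1) → F}
    (hu : ∀ j, u j ≠ 0) (n : ℤ) : (C.gauge l u).D n = l (n + 1) / l n * C.D n := by
  simp only [Cfg.D, Cfg.gauge_q, Cfg.gauge_p, Finset.mul_sum]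
  refine Finset.sum_congr rfl fun j _ => ?_
  have := hu j
  field_simp

/-- D_n has weight l_{n+1}/l_n under the torus, so (a/D_n) q_{n+1} scales like q_n and (a/D_n) p_n
like p_{n+1}. The shear is therefore equivariant, with the same l and u. -/
theorem Cfg.Equiv.r {C C' : Cfg N F} (h : C.Equiv C') (n : ZMod L) (a : F) :
    (C.r n a).Equiv (C'.r n a) := by
  obtain ⟨l, u, hl, hu, rfl⟩ := h
  refine ⟨l, u, hl, hu, ?_⟩
  ext j m
  · have h1 := hl m
    have h2 := hl (m + 1)
    have h3 := hu j
    simp only [Cfg.r_q, Cfg.gauge_D hu, Cfg.gauge_q]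
    split_ifs
    · field_simp
    · simp
  · have h1 := hl m
    have h2 := hl (m - 1)
    have h3 := hu j
    simp only [Cfg.r_p, Cfg.gauge_D hu, Cfg.gauge_p, sub_add_cancel]
    split_ifs
    · field_simp
    · simp

theorem Cfg.Equiv.shift {C C' : Cfg N F} (h : C.Equiv C') : C.shift.Equiv C'.shift := by
  obtain ⟨l, u, hl, hu, rfl⟩ := h
  exact ⟨fun n => l (n + 1), u, fun n => hl _, hu, rfl⟩

theorem Cfg.Equiv.rev {C C' : Cfg N F} (h : C.Equiv C') : C.rev.Equiv C'.rev := by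
  obtain ⟨l, u, hl, hu, rfl⟩ := h
  exact ⟨fun n => l (-n), u, fun n => hl _, hu, rfl⟩

theorem Cfg.shift_r (C : Cfg N F) (n : ZMod L) (a : F) :
    C.shift.r n a = (C.r (n + 1) a).shift := by
  ext j m
  · simp [Cfg.D]
  · simp [Cfg.D]

theorem eq_of_quasiperiodic {f g : ℤ → F} {s : F} (hs : s ≠ 0) (hL : 2 ≤ L)
    (hf : ∀ n, f (n + L) = s * f n) (hg : ∀ n, g (n + L) = s * g n)
    (h : ∀ n : ℕ, n < L → f n = g n) (n : ℤ) : f n = g n := by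
  have key : ∀ (c : ℤ) (m : ℤ), f (m + c * L) = g (m + c * L) ↔ f m = g m := by
    intro c m
    induction c with
    | zero => simp
    | succ c ih =>
      rw [← ih, add_mul, one_mul, ← add_assoc, hf, hg, mul_right_inj' hs]
    | pred c ih =>
      rw [← ih, show m + -(c : ℤ) * L = m + (-(c : ℤ) - 1) * L + L by ring, hf, hg,
        mul_right_inj' hs]
  have h1 := key (n / L) (n % L)
  rw [show n % (L : ℤ) + n / L * L = n by rw [mul_comm]; exact Int.emod_add_mul_ediv n L] at h1
  rw [h1]
  have h2 : 0 ≤ n % (L : ℤ) := Int.emod_nonneg _ (by omega)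
  have h3 : n % (L : ℤ) < L := Int.emod_lt_of_pos _ (by omega)
  obtain ⟨m, hm⟩ := Int.eq_ofNat_of_zero_le h2
  rw [hm]
  exact h m (by omega)

variable [Algebra ℂ F] [Algebra ℂ K]

/-- Homogeneous coordinates with prescribed quasi-periods and moments. -/
structure Cfg.Admissible (C : Cfg N F) (k : Params L N) (s : Fin (N + 1) → F) : Prop where
  q_add : ∀ j n, C.q j (n + L) = s j * C.q j n
  p_add : ∀ j n, C.p j (n + L) = C.p j n / s j
  sum_left : ∀ n, ∑ j, C.q j n * C.p j n = algebraMap ℂ F (k.κ n)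
  sum_right : ∀ j, ∑ n ∈ Finset.range L, C.q j n * C.p j n = algebraMap ℂ F (k.θ j)

/-- The homogeneous coordinates of a point. -/
@[simps]
def Point.cfg (k : Params L N) (x : Point L N F) : Cfg N F where
  q := x.qx
  p := x.px k

theorem Point.cfg_admissible (hL : 2 ≤ L) (k : Params L N) {x : Point L N F}
    (hs : ∀ i, x.s i ≠ 0) : (x.cfg k).Admissible k x.sx :=
  ⟨Point.qx_add hL hs, Point.px_add hL k hs, Point.sum_left hL k hs, Point.sum_right hL k hs⟩

/-- Recognition principle: a normalized admissible configuration is determined by the free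
coordinates, because p_0^{(i)} is forced by the moment θ_i, then p_n^{(0)} by the moment κ_n, and
all other indices by quasi-periodicity. Hence only the normalization and the free coordinates of a
transformed point have to be compared. -/
theorem Cfg.Admissible.eq_cfg (hL : 2 ≤ L) {k : Params L N} {y : Point L N F}
    (hs : ∀ i, y.s i ≠ 0) {C : Cfg N F} (hC : C.Admissible k y.sx)
    (h0 : ∀ n, C.q 0 n = 1) (h1 : ∀ j, C.q j 0 = 1)
    (hq : ∀ i (m : Fin (L - 1)), C.q i.succ ((m : ℤ) + 1) = y.q i m)
    (hp : ∀ i (m : Fin (L - 1)), C.p i.succ ((m : ℤ) + 1) = y.p i m) : C = y.cfg k := by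
  have hy := Point.cfg_admissible hL k hs
  have hqq : ∀ j n, C.q j n = (y.cfg k).q j n := by
    intro j
    refine eq_of_quasiperiodic (Point.sx_ne_zero hs j) hL (hC.q_add j) (hy.q_add j) ?_
    intro n hn
    refine Fin.cases ?_ (fun i => ?_) j
    · rw [h0]
      simp
    · cases n with
      | zero => simpa using h1 i.succ
      | succ n =>
        have h2 := hq i ⟨n, by omega⟩
        have h3 := Point.qx_fin hL y i ⟨n, by omega⟩
        push_cast at h2 h3 ⊢
        rw [h2, Point.cfg_q, h3]
  have hpp : ∀ i : Fin N, ∀ n, C.p i.succ n = (y.cfg k).p i.succ n := by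
    intro i
    have hsi : (y.sx i.succ)⁻¹ ≠ 0 := inv_ne_zero (Point.sx_ne_zero hs _)
    have hpos : ∀ n : ℕ, n + 1 < L →
        C.p i.succ ((n + 1 : ℕ) : ℤ) = (y.cfg k).p i.succ ((n + 1 : ℕ) : ℤ) := by
      intro n hn
      have h2 := hp i ⟨n, by omega⟩
      have h3 := Point.px_fin hL k y i ⟨n, by omega⟩
      push_cast at h2 h3 ⊢
      rw [h2, Point.cfg_p, h3]
    refine eq_of_quasiperiodic hsi hL
      (fun n => by rw [hC.p_add]; field_simp) (fun n => by rw [hy.p_add]; field_simp) ?_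
    intro n hn
    cases n with
    | zero =>
      have h2 := (hC.sum_right i.succ).trans (hy.sum_right i.succ).symm
      obtain ⟨M, rfl⟩ : ∃ M, L = M + 1 := ⟨L - 1, by omega⟩
      rw [Finset.sum_range_succ', Finset.sum_range_succ',
        Finset.sum_congr rfl fun n hn => by
          rw [hqq, hpos n (by have := Finset.mem_range.1 hn; omega)]] at h2
      have h3 := add_left_cancel h2
      simpa [h1] using h3
    | succ n => exact hpos n hn
  ext j n
  · exact hqq j n
  · refine Fin.cases ?_ (fun i => hpp i n) j
    have h2 := (hC.sum_left n).trans (hy.sum_left n).symm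
    rw [Fin.sum_univ_succ, Fin.sum_univ_succ] at h2
    simp only [hqq, hpp] at h2
    simpa using h2

/-- Normalization of both sides gives l_n u_0 = 1 and l_0 u_j = 1, hence l_n u_j = 1 throughout. The
free coordinates do not involve the parameters, so `k` and `k'` may differ. -/
theorem Point.eq_of_cfg_equiv (hL : 2 ≤ L) {k k' : Params L N} {x y : Point L N F}
    (hs : x.s = y.s) (h : (x.cfg k).Equiv (y.cfg k')) : x = y := by
  obtain ⟨l, u, hl, hu, h⟩ := h
  have h1 : ∀ n, l n * u 0 = 1 := fun n => by
    have := congrArg (fun C => C.q 0 n) h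
    simpa using this.symm
  have h2 : ∀ j, l 0 * u j = 1 := fun j => by
    have := congrArg (fun C => C.q j 0) h
    simpa using this.symm
  have h3 : ∀ n j, l n * u j = 1 := fun n j => by
    have e1 := h1 n
    have e2 := h2 j
    have e3 := h1 0
    calc l n * u j = (l n * u 0) * (l 0 * u j) / (l 0 * u 0) := by
          have := hl 0
          have := hu 0
          field_simp
      _ = 1 := by rw [e1, e2, e3]; simp
  refine Point.ext' (fun i => congrFun hs i) (fun i m => ?_) (fun i m => ?_)
  · have := congrArg (fun C => C.q i.succ ((m : ℤ) + 1)) h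
    simp only [Cfg.gauge_q, h3, Point.cfg_q, Point.qx_fin hL] at this
    rw [this, one_mul]
  · have := congrArg (fun C => C.p i.succ ((m : ℤ) + 1)) h
    simp only [Cfg.gauge_p, h3, Point.cfg_p, Point.px_fin hL] at this
    rw [this, div_one]

theorem Cfg.Admissible.gauge {C : Cfg N F} {k : Params L N} {s : Fin (N + 1) → F}
    (hC : C.Admissible k s) {l : ℤ → F} {u : Fin (N + 1) → F} (hl : ∀ n, l n ≠ 0)
    (hu : ∀ j, u j ≠ 0) (hlp : ∀ n, l (n + L) = l n) : (C.gauge l u).Admissible k s where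
  q_add j n := by simp only [Cfg.gauge_q, hlp, hC.q_add]; ring
  p_add j n := by simp only [Cfg.gauge_p, hlp, hC.p_add, div_right_comm]
  sum_left n := by
    rw [← hC.sum_left]
    refine Finset.sum_congr rfl fun j _ => ?_
    have := hl n
    have := hu j
    simp only [Cfg.gauge_q, Cfg.gauge_p]
    field_simp
  sum_right j := by
    rw [← hC.sum_right]
    refine Finset.sum_congr rfl fun n _ => ?_
    have := hl n
    have := hu j
    simp only [Cfg.gauge_q, Cfg.gauge_p]
    field_simp

theorem Cfg.Admissible.D_add {C : Cfg N F} {k : Params L N} {s : Fin (N + 1) → F}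
    (hC : C.Admissible k s) (hs : ∀ j, s j ≠ 0) (n : ℤ) : C.D (n + L) = C.D n := by
  refine Finset.sum_congr rfl fun j _ => ?_
  have := hs j
  rw [show n + (L : ℤ) + 1 = n + 1 + L by ring, hC.q_add, hC.p_add]
  field_simp

theorem Cfg.Admissible.D'_add {C : Cfg N F} {k : Params L N} {s : Fin (N + 1) → F}
    (hC : C.Admissible k s) (hs : ∀ j, s j ≠ 0) (n : ℤ) : C.D' (n + L) = C.D' n := by
  refine Finset.sum_congr rfl fun j _ => ?_
  have := hs j
  rw [show n + (L : ℤ) - 1 = n - 1 + L by ring, hC.q_add, hC.p_add]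
  field_simp

/-- The shear by a/D_n transfers (a/D_n)·D_n = a from the moment at n+1 to the moment at n, which is
the action of r_n on κ. The moments θ_j are unchanged because the increments telescope. -/
theorem Cfg.Admissible.r [NeZero L] (hL : 2 ≤ L) {C : Cfg N F} {k : Params L N}
    {s : Fin (N + 1) → F}
    (hC : C.Admissible k s) (hs : ∀ j, s j ≠ 0) (n : ZMod L) (hD : C.D n.val ≠ 0) :
    (C.r n (algebraMap ℂ F (k.a n.val))).Admissible (rParam n k) s where
  q_add j m := by
    simp only [Cfg.r_q, show m + (L : ℤ) + 1 = m + 1 + L by ring, hC.q_add, hC.D_add hs,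
      Int.cast_add, Int.cast_natCast, CharP.cast_eq_zero, add_zero]
    split_ifs <;> ring
  p_add j m := by
    simp only [Cfg.r_p, show m + (L : ℤ) - 1 = m - 1 + L by ring, hC.p_add, hC.D_add hs,
      Int.cast_add, Int.cast_natCast, CharP.cast_eq_zero, add_zero]
    split_ifs <;> ring
  sum_left m := by
    have hm : ∀ m : ℤ, (m : ZMod L) = n → C.D m ≠ 0 := fun m h => by
      rwa [eq_of_intCast_eq (hC.D_add hs) (m := m) (n := (n.val : ℤ)) (by simpa using h)]
    simp only [Cfg.r_q, Cfg.r_p, rParam]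
    by_cases h1 : (m : ZMod L) = n
    · have h2 := intCast_ne_add_one hL h1
      simp only [if_pos h1, if_neg h2, sub_zero, add_mul, Finset.sum_add_distrib, hC.sum_left,
        map_add]
      simp only [mul_assoc, ← Finset.mul_sum]
      congr 1
      exact div_mul_cancel₀ _ (hm m h1)
    · by_cases h2 : (m : ZMod L) = n + 1
      · have h3 : ((m - 1 : ℤ) : ZMod L) = n := by simp [h2]
        have h4 := hm _ h3
        simp only [if_neg h1, if_pos h2, add_zero, mul_sub, Finset.sum_sub_distrib, hC.sum_left,
          map_sub]
        congr 1
        simp only [mul_left_comm _ (_ / _), ← Finset.mul_sum]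
        have : ∑ j, C.q j m * C.p j (m - 1) = C.D (m - 1) := by simp [Cfg.D]
        rw [this, div_mul_cancel₀ _ h4]
      · simp only [if_neg h1, if_neg h2, add_zero, sub_zero, hC.sum_left]
  sum_right j := by
    -- `f m` is the gain of q_m p_m at m ≡ n, and the loss at m + 1 is the same; since f has period
    -- L, the sum of f(m) − f(m−1) over a period vanishes.
    set f : ℤ → F := fun m => if (m : ZMod L) = n then
      algebraMap ℂ F (k.a n.val) / C.D m * (C.q j (m + 1) * C.p j m) else 0 with hf
    have hfp : ∀ m, f (m + L) = f m := fun m => by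
      have := hs j
      simp only [hf, show m + (L : ℤ) + 1 = m + 1 + L by ring, hC.q_add, hC.p_add, hC.D_add hs,
        Int.cast_add, Int.cast_natCast, CharP.cast_eq_zero, add_zero]
      split_ifs
      · field_simp
      · rfl
    have h := sum_range_shift (L := L) f (-1)
    rw [hfp] at h
    simp only [neg_add_cancel, zero_add, add_sub_cancel_right] at h
    have h2 : ∀ m : ℤ, (C.r n (algebraMap ℂ F (k.a n.val))).q j m *
        (C.r n (algebraMap ℂ F (k.a n.val))).p j m = C.q j m * C.p j m + f m - f (-1 + m) := by
      intro m
      have h3 : ((m - 1 : ℤ) : ZMod L) = n ↔ (m : ZMod L) = n + 1 := by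
        rw [Int.cast_sub, Int.cast_one, sub_eq_iff_eq_add]
      simp only [Cfg.r_q, Cfg.r_p, hf, show -1 + m = m - 1 by ring, sub_add_cancel, h3]
      by_cases h1 : (m : ZMod L) = n
      · simp only [if_pos h1, if_neg (intCast_ne_add_one hL h1)]
        ring
      · simp only [if_neg h1]
        split_ifs <;> ring
    simp only [h2, Finset.sum_sub_distrib, Finset.sum_add_distrib, ← h, hC.sum_right, rParam]
    ring

theorem Cfg.Admissible.shift [NeZero L] {C : Cfg N F} {k : Params L N} {s : Fin (N + 1) → F}
    (hC : C.Admissible k s) (hs : ∀ j, s j ≠ 0) : C.shift.Admissible (piParam k) s where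
  q_add j m := by
    simp only [Cfg.shift_q, show m + (L : ℤ) + 1 = m + 1 + L by ring, hC.q_add]
  p_add j m := by
    simp only [Cfg.shift_p, show m + (L : ℤ) + 1 = m + 1 + L by ring, hC.p_add]
  sum_left m := hC.sum_left (m + 1)
  sum_right j := by
    have h := sum_range_shift (L := L) (fun n => C.q j n * C.p j n) 0
    have := hs j
    have h0 := hC.q_add j 0
    have h1 := hC.p_add j 0
    simp only [zero_add] at h h0 h1
    simp only [add_comm (1 : ℤ), h0, h1, hC.sum_right] at h
    simp only [Cfg.shift_q, Cfg.shift_p, h, piParam]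
    field_simp
    ring

theorem Cfg.Admissible.rev [NeZero L] {C : Cfg N F} {k : Params L N} {s : Fin (N + 1) → F}
    (hC : C.Admissible k s) (hs : ∀ j, s j ≠ 0) :
    C.rev.Admissible (rhoParam k) (fun j => (s j)⁻¹) where
  q_add j m := by
    have := hs j
    have h := hC.q_add j (-(m + L))
    rw [show -(m + (L : ℤ)) + L = -m by ring] at h
    simp only [Cfg.rev_q, h]
    field_simp
  p_add j m := by
    have := hs j
    have h := hC.p_add j (-(m + L))
    rw [show -(m + (L : ℤ)) + L = -m by ring] at h
    simp only [Cfg.rev_p, h]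
    field_simp
  sum_left m := by
    have h := k.κ_add (-m)
    simp only [Cfg.rev_q, Cfg.rev_p, hC.sum_left, rhoParam, ← h]
    ring_nf
  sum_right j := by
    have hp : ∀ n, C.q j (n + L) * C.p j (n + L) = C.q j n * C.p j n := fun n => by
      have := hs j
      rw [hC.q_add, hC.p_add]
      field_simp
    have h := sum_range_reflect_int (L := L) (fun n => C.q j n * C.p j n) 0
    have h2 := sum_range_shift (L := L) (fun n => C.q j n * C.p j n) (-L)
    have h3 : ∑ n ∈ Finset.range L, C.q j (-L + n) * C.p j (-L + n) =
        ∑ n ∈ Finset.range L, C.q j n * C.p j n :=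
      Finset.sum_congr rfl fun n _ => by
        rw [← hp]
        ring_nf
    have h4 := hp (-L)
    simp only [zero_sub, zero_add] at h
    simp only [Cfg.rev_q, Cfg.rev_p, h, show (1 : ℤ) - L = -L + 1 by ring, h2, h3, h4, rhoParam,
      hC.sum_right]
    ring

end HLN
end

noncomputable section
namespace HLN
variable {L N : ℕ} {F K : Type*} [Field F] [Field K] [Algebra ℂ F] [Algebra ℂ K]

/-! ### The transformations in homogeneous coordinates -/

theorem rhoPoint_sx (k : Params L N) (x : Point L N F) :
    (rhoPoint k x).sx = fun j => (x.sx j)⁻¹ := by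
  funext j
  refine Fin.cases ?_ (fun i => ?_) j
  · simp
  · simp [rhoPoint]

/-- Reversal respects the normalization, so no torus factor is needed; q_{L−n}/s_i and s_i p_{L−n}
are q_{−n} and p_{−n}. -/
theorem rhoPoint_cfg [NeZero L] (hL : 2 ≤ L) (k : Params L N) {x : Point L N F}
    (hs : ∀ i, x.s i ≠ 0) : (rhoPoint k x).cfg (rhoParam k) = (x.cfg k).rev := by
  symm
  have hC := (Point.cfg_admissible hL k hs).rev (Point.sx_ne_zero hs)
  rw [← rhoPoint_sx k] at hC
  refine hC.eq_cfg hL (fun i => by simpa [rhoPoint] using hs i) (by simp) (by simp)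
    (fun i m => ?_) (fun i m => ?_)
  · have h := Point.qx_add hL hs i.succ (-((m : ℤ) + 1))
    rw [show -((m : ℤ) + 1) + L = L - (m + 1) by ring] at h
    have := hs i
    simp only [Cfg.rev_q, Point.cfg_q, rhoPoint, h, Point.sx_succ]
    field_simp
  · have h := Point.px_add hL k hs i.succ (-((m : ℤ) + 1))
    rw [show -((m : ℤ) + 1) + L = L - (m + 1) by ring] at h
    have := hs i
    simp only [Cfg.rev_p, Point.cfg_p, rhoPoint, h, Point.sx_succ]
    field_simp

/-- The shift puts q_1^{(j)} in the place of q_0^{(j)} = 1; dividing row j by it restores the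
normalization. -/
theorem piPoint_cfg [NeZero L] (hL : 2 ≤ L) (k : Params L N) {x : Point L N F}
    (hs : ∀ i, x.s i ≠ 0) (hq : piRegular x) : (piPoint k x).cfg (piParam k) =
      (x.cfg k).shift.gauge 1 fun j => (x.qx j 1)⁻¹ := by
  symm
  have hq' : ∀ j, x.qx j 1 ≠ 0 := fun j => by
    refine Fin.cases ?_ (fun i => ?_) j
    · simp
    · exact hq i
  have hC := ((Point.cfg_admissible hL k hs).shift (Point.sx_ne_zero hs)).gauge
    (l := 1) (u := fun j => (x.qx j 1)⁻¹) (by simp) (fun j => inv_ne_zero (hq' j)) (by simp)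
  refine Cfg.Admissible.eq_cfg (y := piPoint k x) hL hs hC (by simp) (fun j => ?_)
    (fun i m => ?_) (fun i m => ?_)
  · have := hq' j
    simp [this]
  · simp [piPoint]
    ring
  · simp [piPoint]

theorem Cfg.Admissible.pairing_eq {C : Cfg N F} {k : Params L N} {s : Fin (N + 1) → F}
    (hC : C.Admissible k s) (hs : ∀ j, s j ≠ 0) {m n : ℤ} (h : (m : ZMod L) = n) :
    C.D m = C.D n :=
  eq_of_intCast_eq (hC.D_add hs) h

theorem intCast_succ_eq_iff [NeZero L] {m : ℕ} (hm : m + 1 < L) (n : ZMod L) :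
    (((m : ℤ) + 1 : ℤ) : ZMod L) = n ↔ m + 1 = n.val := by
  rw [← natCast_zmod_eq_iff hm]
  push_cast
  rfl

theorem intCast_succ_eq_add_one_iff [NeZero L] {m : ℕ} (hm : m + 1 < L) (n : ZMod L) :
    (((m : ℤ) + 1 : ℤ) : ZMod L) = n + 1 ↔ m + 1 = n.val + 1 := by
  rw [add_left_inj, ← natCast_zmod_eq_iff (by omega : m < L)]
  push_cast
  rw [add_left_inj]

theorem rPoint_s (n : ℕ) (k : Params L N) (x : Point L N F) : (rPoint n k x).s = x.s := by
  rw [rPoint]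
  split_ifs <;> rfl

theorem rPoint_sx (n : ℕ) (k : Params L N) (x : Point L N F) : (rPoint n k x).sx = x.sx := by
  rw [Point.sx, rPoint_s, Point.sx]

/-- The shear changes q_n^{(0)} = 1 into 1 + a/D and leaves q_0^{(j)} alone, so rescaling the single
index class n restores the normalization. -/
theorem rPoint_cfg_of_ne_zero [NeZero L] (hL : 2 ≤ L) {n : ZMod L} (hn : n ≠ 0) (k : Params L N)
    {x : Point L N F} (hs : ∀ i, x.s i ≠ 0) (hr : rRegular n.val k x) :
    (rPoint n.val k x).cfg (rParam n k) =
      ((x.cfg k).r n (algebraMap ℂ F (k.a n.val))).gauge (fun m => if (m : ZMod L) = n then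
        (1 + algebraMap ℂ F (k.a n.val) / x.pairing k (n.val + 1) n.val)⁻¹ else 1) 1 := by
  symm
  obtain ⟨hD, haD, -⟩ := hr
  have hn' : n.val ≠ 0 := (ZMod.val_ne_zero n).2 hn
  have hadm := Point.cfg_admissible hL k hs
  have hc : 1 + algebraMap ℂ F (k.a n.val) / x.pairing k (n.val + 1) n.val ≠ 0 := by
    rw [← div_self hD, ← add_div, add_comm]
    exact div_ne_zero haD hD
  have hDm : ∀ m : ℤ, (m : ZMod L) = n → (x.cfg k).D m = x.pairing k (n.val + 1) n.val :=
    fun m hm => hadm.pairing_eq (Point.sx_ne_zero hs) (n := (n.val : ℤ)) (by simpa using hm)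
  have hC := (hadm.r hL (Point.sx_ne_zero hs) n hD).gauge
    (l := fun m => if (m : ZMod L) = n then
        (1 + algebraMap ℂ F (k.a n.val) / x.pairing k (n.val + 1) n.val)⁻¹ else 1)
    (u := 1) (fun m => by split_ifs; exacts [inv_ne_zero hc, one_ne_zero]) (by simp) (by simp)
  rw [← rPoint_sx n.val k] at hC
  refine hC.eq_cfg hL (by rwa [rPoint_s]) (fun m => ?_) (fun j => ?_)
    (fun i m => ?_) (fun i m => ?_)
  · by_cases h : (m : ZMod L) = n
    · simp only [Cfg.gauge_q, Cfg.r_q, Point.cfg_q, Point.qx_zero_left, if_pos h, hDm m h,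
        Pi.one_apply, mul_one, inv_mul_cancel₀ hc]
    · simp [h]
  · simp [hn.symm]
  · have hm : (m : ℕ) + 1 < L := by omega
    simp only [Cfg.gauge_q, Cfg.r_q, Point.cfg_q, rPoint, hn', if_false, Pi.one_apply]
    by_cases h : (m : ℕ) + 1 = n.val
    · have h' := (intCast_succ_eq_iff hm n).2 h
      have h2 : ((n.val : ℕ) : ℤ) = (m : ℤ) + 1 := by rw [← h]; push_cast; ring
      simp only [h, h', hDm _ h', if_true, Point.qx_fin hL, h2]
      simp only [h2] at hD haD hc
      rw [show 1 + algebraMap ℂ F (k.a ((m : ℤ) + 1)) /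
        x.pairing k ((m : ℤ) + 1 + 1) ((m : ℤ) + 1) = (algebraMap ℂ F (k.a ((m : ℤ) + 1)) +
          x.pairing k ((m : ℤ) + 1 + 1) ((m : ℤ) + 1)) / x.pairing k ((m : ℤ) + 1 + 1) ((m : ℤ) + 1)
          by field_simp; ring]
      field_simp
      ring
    · have h' := mt (intCast_succ_eq_iff hm n).1 h
      simp only [if_neg h, if_neg h', Point.qx_fin hL, one_mul, add_zero]
  · have hm : (m : ℕ) + 1 < L := by omega
    simp only [Cfg.gauge_p, Cfg.r_p, Point.cfg_p, rPoint, hn', if_false, Pi.one_apply]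
    by_cases h : (m : ℕ) + 1 = n.val
    · have h' := (intCast_succ_eq_iff hm n).2 h
      have h'' := intCast_ne_add_one hL h'
      simp only [if_pos h, if_pos h', if_neg h'', Point.px_fin hL, mul_one, sub_zero, div_inv_eq_mul]
    · have h' := mt (intCast_succ_eq_iff hm n).1 h
      simp only [if_neg h', if_neg h, intCast_succ_eq_add_one_iff hm, mul_one, div_one,
        Point.px_fin hL]
      by_cases h2 : (m : ℕ) = n.val
      · have h3 := hDm ((m : ℕ) : ℤ) (by simp [h2])
        simp only [h2, if_true, add_sub_cancel_right]
        rw [h2] at h3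
        rw [h3]
        ring
      · simp [h2]

/-- For n = 0 the shear turns q_0^{(j)} = 1 into 1 + (a/D) q_1^{(j)}, so every row j must be
rescaled by the inverse of this. For j = 0 that factor is (1 + a/D)⁻¹, which l has to compensate at
the indices m ≢ 0 in order to keep q_m^{(0)} = 1. This is why r_0 moves all the variables. -/
theorem rPoint_cfg_zero [NeZero L] (hL : 2 ≤ L) (k : Params L N)
    {x : Point L N F} (hs : ∀ i, x.s i ≠ 0) (hr : rRegular 0 k x) :
    (rPoint 0 k x).cfg (rParam 0 k) =
      ((x.cfg k).r (0 : ZMod L) (algebraMap ℂ F (k.a 0))).gauge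
        (fun m => if (m : ZMod L) = 0 then 1 else
          1 + algebraMap ℂ F (k.a 0) / x.pairing k 1 0)
        (fun j => (1 + algebraMap ℂ F (k.a 0) / x.pairing k 1 0 * x.qx j 1)⁻¹) := by
  symm
  obtain ⟨hD, haD, hqD⟩ := hr
  simp only [Nat.cast_zero, zero_add, true_imp_iff] at hD haD hqD
  have hadm := Point.cfg_admissible hL k hs
  have hc : 1 + algebraMap ℂ F (k.a 0) / x.pairing k 1 0 ≠ 0 := by
    rw [← div_self hD, ← add_div, add_comm]
    exact div_ne_zero haD hD
  have hcq : ∀ j, 1 + algebraMap ℂ F (k.a 0) / x.pairing k 1 0 * x.qx j 1 ≠ 0 := fun j => by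
    refine Fin.cases ?_ (fun i => ?_) j
    · simpa using hc
    · rw [div_mul_eq_mul_div, ← div_self hD, ← add_div, add_comm]
      exact div_ne_zero (hqD i) hD
  have hDm : ∀ m : ℤ, (m : ZMod L) = 0 → (x.cfg k).D m = x.pairing k 1 0 :=
    fun m hm => hadm.pairing_eq (Point.sx_ne_zero hs) (n := 0) (by simpa using hm)
  have hC := (hadm.r hL (Point.sx_ne_zero hs) (0 : ZMod L) (by simpa [Cfg.D, Point.pairing] using hD)).gauge
    (l := fun m => if (m : ZMod L) = 0 then 1 else
          1 + algebraMap ℂ F (k.a 0) / x.pairing k 1 0)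
    (u := fun j => (1 + algebraMap ℂ F (k.a 0) / x.pairing k 1 0 * x.qx j 1)⁻¹)
    (fun m => by split_ifs <;> simp [hc]) (fun j => inv_ne_zero (hcq j)) (by simp)
  simp only [ZMod.val_zero, Nat.cast_zero] at hC
  rw [← rPoint_sx 0 k] at hC
  have key : ∀ m : Fin (L - 1), ¬ (((m : ℤ) + 1 : ℤ) : ZMod L) = 0 := fun m => by
    rw [intCast_succ_eq_iff (by omega)]
    simp
  have h0 := hDm 0 (by simp)
  -- The torus factor l_m u_i at m ≢ 0, written in the shape in which it occurs in `rPoint`; `hfac'`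
  -- does the same for its inverse, which multiplies p.
  have hfac : ∀ i : Fin N, (1 + algebraMap ℂ F (k.a 0) / x.pairing k 1 0) *
      (1 + algebraMap ℂ F (k.a 0) / x.pairing k 1 0 * x.qx i.succ 1)⁻¹ =
      1 - algebraMap ℂ F (k.a 0) * (x.qx i.succ 1 - 1) /
        (algebraMap ℂ F (k.a 0) * x.qx i.succ 1 + x.pairing k 1 0) := fun i => by
    have h1 := hqD i
    rw [show 1 + algebraMap ℂ F (k.a 0) / x.pairing k 1 0 * x.qx i.succ 1 =
      (algebraMap ℂ F (k.a 0) * x.qx i.succ 1 + x.pairing k 1 0) / x.pairing k 1 0 by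
        field_simp; ring]
    field_simp
    ring
  have hfac' : ∀ (i : Fin N) (z : F), z / ((1 + algebraMap ℂ F (k.a 0) / x.pairing k 1 0) *
      (1 + algebraMap ℂ F (k.a 0) / x.pairing k 1 0 * x.qx i.succ 1)⁻¹) =
      z * (1 + algebraMap ℂ F (k.a 0) * (x.qx i.succ 1 - 1) /
        (algebraMap ℂ F (k.a 0) + x.pairing k 1 0)) := fun i z => by
    rw [show 1 + algebraMap ℂ F (k.a 0) / x.pairing k 1 0 =
      (algebraMap ℂ F (k.a 0) + x.pairing k 1 0) / x.pairing k 1 0 by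
        field_simp; ring]
    field_simp
    ring
  refine hC.eq_cfg hL (by rwa [rPoint_s]) (fun m => ?_) (fun j => ?_)
    (fun i m => ?_) (fun i m => ?_)
  · by_cases h : (m : ZMod L) = 0
    · simp [h, hDm m h, hc]
    · simp [h, hc]
  · have := hcq j
    simp [h0, this]
  · simp only [Cfg.gauge_q, Cfg.r_q, Point.cfg_q, key, if_false, hfac, Point.qx_fin hL, rPoint]
    simp
    ring
  · simp only [Cfg.gauge_p, Cfg.r_p, Point.cfg_p, key, if_false, hfac',
      Point.px_fin hL, rPoint, intCast_succ_eq_add_one_iff (show (m : ℕ) + 1 < L by omega)]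
    by_cases h : (m : ℕ) = 0
    · have : ((m : ℕ) : ℤ) = 0 := by simp [h]
      simp [h, h0, div_mul_eq_mul_div]
    · simp [h]

theorem rPoint_cfg_equiv [NeZero L] (hL : 2 ≤ L) (n : ZMod L) (k : Params L N)
    {x : Point L N F} (hs : ∀ i, x.s i ≠ 0) (hr : rRegular n.val k x) :
    ((x.cfg k).r n (algebraMap ℂ F (k.a n.val))).Equiv ((rPoint n.val k x).cfg (rParam n k)) := by
  by_cases hn : n = 0
  · subst hn
    rw [ZMod.val_zero] at hr ⊢
    have h := rPoint_cfg_zero hL k hs hr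
    obtain ⟨hD, haD, hqD⟩ := hr
    simp only [Nat.cast_zero, zero_add, true_imp_iff] at hD haD hqD
    have hc : 1 + algebraMap ℂ F (k.a 0) / x.pairing k 1 0 ≠ 0 := by
      rw [← div_self hD, ← add_div, add_comm]
      exact div_ne_zero haD hD
    refine ⟨_, _, fun m => ?_, fun j => ?_, h⟩
    · split_ifs <;> simp [hc]
    · refine Fin.cases ?_ (fun i => ?_) j
      · simpa using hc
      · rw [div_mul_eq_mul_div, ← div_self hD, ← add_div, add_comm]
        exact inv_ne_zero (div_ne_zero (hqD i) hD)
  · have h := rPoint_cfg_of_ne_zero hL hn k hs hr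
    obtain ⟨hD, haD, -⟩ := hr
    have hc : 1 + algebraMap ℂ F (k.a n.val) / x.pairing k (n.val + 1) n.val ≠ 0 := by
      rw [← div_self hD, ← add_div, add_comm]
      exact div_ne_zero haD hD
    refine ⟨_, 1, fun m => ?_, by simp, h⟩
    split_ifs
    exacts [inv_ne_zero hc, one_ne_zero]

theorem piPoint_cfg_equiv [NeZero L] (hL : 2 ≤ L) (k : Params L N) {x : Point L N F}
    (hs : ∀ i, x.s i ≠ 0) (hq : piRegular x) :
    (x.cfg k).shift.Equiv ((piPoint k x).cfg (piParam k)) := by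
  refine ⟨1, _, by simp, fun j => ?_, piPoint_cfg hL k hs hq⟩
  refine Fin.cases ?_ (fun i => ?_) j
  · simp
  · exact inv_ne_zero (hq i)

/-- The displayed r_n' is literally ρ r_n ρ: in reversed indices D_n becomes D_n', and the factors
s_i introduced by L − n in place of −n cancel. No denominator has to be nonzero apart from the s_i.
-/
theorem rPoint'_eq [NeZero L] (hL : 2 ≤ L) (n : ℕ) (hn : n < L) (k : Params L N) {x : Point L N F}
    (hs : ∀ i, x.s i ≠ 0) :
    rPoint' n k x =
      rhoPoint (rParam (n : ZMod L) (rhoParam k)) (rPoint n (rhoParam k) (rhoPoint k x)) := by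
  have hcfg := rhoPoint_cfg hL k hs
  have hq : ∀ j m, (rhoPoint k x).qx j m = x.qx j (-m) := fun j m =>
    congrArg (fun C : Cfg N F => C.q j m) hcfg
  have hp : ∀ j m, (rhoPoint k x).px (rhoParam k) j m = x.px k j (-m) := fun j m =>
    congrArg (fun C : Cfg N F => C.p j m) hcfg
  have hpair : ∀ m l, (rhoPoint k x).pairing (rhoParam k) m l = x.pairing k (-m) (-l) := by
    intro m l
    simp [Point.pairing, hq, hp]
  have hqL : ∀ j m, x.qx j (L - m) = x.sx j * x.qx j (-m) := fun j m => by
    rw [← Point.qx_add hL hs]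
    ring_nf
  have hpL : ∀ j m, x.px k j (L - m) = x.px k j (-m) / x.sx j := fun j m => by
    rw [← Point.px_add hL k hs]
    ring_nf
  have hidx : ∀ m : Fin (L - 1), (L : ℤ) - (m + 1) = ((L - 2 - m : ℕ) : ℤ) + 1 := by
    intro m; omega
  have hqr : ∀ (l : Params L N) (y : Point L N F) i (m : Fin (L - 1)),
      y.qx i.succ (L - ((m : ℤ) + 1)) = y.q i ⟨L - 2 - m, by omega⟩ := fun l y i m => by
    rw [hidx, ← Point.qx_fin hL]
  have hpr : ∀ (l : Params L N) (y : Point L N F) i (m : Fin (L - 1)),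
      y.px l i.succ (L - ((m : ℤ) + 1)) = y.p i ⟨L - 2 - m, by omega⟩ := fun l y i m => by
    rw [hidx, ← Point.px_fin hL l]
  have hidx3 : ∀ m : Fin (L - 1), (L : ℤ) - (((L - 2 - m : ℕ) : ℤ) + 1) = m + 1 := by
    intro m; omega
  have hpair2 : x.pairing k (L - n - 1) (L - n) = x.pairing k (-((n : ℤ) + 1)) (-n) := by
    refine Finset.sum_congr rfl fun j _ => ?_
    have := Point.sx_ne_zero hs j
    rw [show (L : ℤ) - n - 1 = L - (n + 1) by ring, hqL, hpL]
    field_simp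
  have hsr : ∀ i, (rhoPoint k x).s i = 1 / x.s i := fun i => rfl
  have hq1 : ∀ i (m : Fin (L - 1)), (rhoPoint k x).q i ⟨L - 2 - m, by omega⟩ = x.q i m / x.s i :=
    fun i m => by
      rw [← Point.qx_fin hL x]
      simp only [rhoPoint]
      rw [hidx3]
  have hp1 : ∀ i (m : Fin (L - 1)), (rhoPoint k x).p i ⟨L - 2 - m, by omega⟩ = x.s i * x.p i m :=
    fun i m => by
      rw [← Point.px_fin hL k x]
      simp only [rhoPoint]
      rw [hidx3]
  refine Point.ext' (fun i => ?_) (fun i m => ?_) (fun i m => ?_)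
  · have : (rPoint' n k x).s = x.s := by
      rw [rPoint']
      split_ifs <;> rfl
    simp [this, rhoPoint, rPoint_s]
  · have hsi := hs i
    change _ = (rPoint n (rhoParam k) (rhoPoint k x)).qx i.succ (L - ((m : ℤ) + 1)) /
      (rPoint n (rhoParam k) (rhoPoint k x)).s i
    rw [hqr k, rPoint_s, hsr]
    by_cases h0 : n = 0
    · simp only [rPoint, rPoint', if_pos h0, rhoParam_a, hq, hq1, hpair]
      simp [h0]
      field_simp
    · have hidx2 : L - 2 - (m : ℕ) + 1 = n ↔ (m : ℕ) + 1 = L - n := by omega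
      have e1 := hqL i.succ (n + 1)
      rw [show (L : ℤ) - (n + 1) = L - n - 1 by ring, Point.sx_succ] at e1
      simp only [rPoint, rPoint', if_neg h0, rhoParam_a, hq, hq1, hpair, hpair2, hidx2, e1]
      split_ifs
      · field_simp
      · field_simp
  · have hsi := hs i
    change _ = (rPoint n (rhoParam k) (rhoPoint k x)).s i *
      (rPoint n (rhoParam k) (rhoPoint k x)).px (rParam n (rhoParam k)) i.succ (L - ((m : ℤ) + 1))
    rw [hpr (rParam n (rhoParam k)), rPoint_s, hsr]
    by_cases h0 : n = 0
    · have hidx2 : L - 2 - (m : ℕ) + 1 = 1 ↔ (m : ℕ) + 1 = L - 1 := by omega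
      simp only [rPoint, rPoint', if_pos h0, rhoParam_a, hq, hp, hp1, hpair, hidx2]
      by_cases h1 : (m : ℕ) + 1 = L - 1
      · have e1 := hpL i.succ 1
        rw [show (L : ℤ) - 1 = m + 1 by omega, Point.px_fin hL, Point.sx_succ] at e1
        simp only [if_pos h1, e1, h0]
        simp
        field_simp
      · simp only [if_neg h1, h0]
        simp
        field_simp
    · have hidx2 : L - 2 - (m : ℕ) + 1 = n ↔ (m : ℕ) + 1 = L - n := by omega
      have hidx4 : L - 2 - (m : ℕ) + 1 = n + 1 ↔ (m : ℕ) + 1 = L - n - 1 := by omega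
      simp only [rPoint, rPoint', if_neg h0, rhoParam_a, hp, hp1, hpair, hpair2, hidx2, hidx4, hpL,
        Point.sx_succ]
      split_ifs <;> field_simp

end HLN
end

noncomputable section
namespace HLN
variable {L N : ℕ}

/-! ### Rational functions -/

theorem var_injective : Function.Injective (var : Coord L N → RatField L N) :=
  (IsFractionRing.injective (MvPolynomial (Coord L N) ℂ) (RatField L N)).comp
    MvPolynomial.X_injective

theorem var_ne_zero (c : Coord L N) : var c ≠ 0 := by
  rw [var, Ne, FaithfulSMul.algebraMap_eq_zero_iff]
  exact MvPolynomial.X_ne_zero c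

theorem var_ne_one (c : Coord L N) : var c ≠ 1 := by
  rw [var, ← map_one (algebraMap (MvPolynomial (Coord L N) ℂ) (RatField L N)), Ne,
    (IsFractionRing.injective (MvPolynomial (Coord L N) ℂ) (RatField L N)).eq_iff]
  intro h
  have := congrArg (MvPolynomial.eval (0 : Coord L N → ℂ)) h
  simp at this

theorem pd_var_self (c : Coord L N) : pd c (var c) = 1 := by
  rw [pd, var, fracDerivation_algebraMap]
  simp

theorem pd_var_of_ne {c c' : Coord L N} (h : c' ≠ c) : pd c (var c') = 0 := by
  rw [pd, var, fracDerivation_algebraMap]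
  change algebraMap _ _ (MvPolynomial.pderiv c (MvPolynomial.X c')) = _
  rw [MvPolynomial.pderiv_X_of_ne h, map_zero]

theorem derivation_ext {X Y : Derivation ℂ (RatField L N) (RatField L N)}
    (h : ∀ c, X (var c) = Y (var c)) : X = Y := by
  have h1 : X.compAlgebraMap (MvPolynomial (Coord L N) ℂ) =
      Y.compAlgebraMap (MvPolynomial (Coord L N) ℂ) :=
    MvPolynomial.derivation_ext h
  have h2 : ∀ a : MvPolynomial (Coord L N) ℂ, X (algebraMap _ _ a) = Y (algebraMap _ _ a) :=
    fun a => congrArg (fun Z : Derivation ℂ (MvPolynomial (Coord L N) ℂ) (RatField L N) => Z a) h1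
  ext f
  obtain ⟨a, b, hb, rfl⟩ := IsFractionRing.div_surjective (A := MvPolynomial (Coord L N) ℂ) f
  rw [Derivation.leibniz_div, Derivation.leibniz_div, h2, h2]

theorem derivation_sum_apply {ι A M : Type*} [CommRing A] [Algebra ℂ A] [AddCommGroup M] [Module A M]
    [Module ℂ M] (s : Finset ι) (X : ι → Derivation ℂ A M) (f : A) :
    (∑ i ∈ s, X i) f = ∑ i ∈ s, X i f := by
  have := congrFun (map_sum (Derivation.coeFnAddMonoidHom (R := ℂ) (A := A) (M := M)) X s) f
  rw [Finset.sum_apply] at this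
  exact this

/-- The chain rule. -/
theorem derivation_eq_sum_pd [Fintype (Coord L N)] (X : Derivation ℂ (RatField L N) (RatField L N))
    (f : RatField L N) : X f = ∑ c, X (var c) * pd c f := by
  classical
  have h : X = ∑ c, X (var c) • pd c := by
    apply derivation_ext
    intro c'
    rw [derivation_sum_apply, Finset.sum_eq_single c']
    · simp [pd_var_self]
    · intro c _ hc
      simp [pd_var_of_ne (Ne.symm hc)]
    · simp
  conv_lhs => rw [h]
  rw [derivation_sum_apply]
  rfl

theorem gen_s (i : Fin N) : (gen L N).s i = var (.s i) := rfl
theorem gen_q (i : Fin N) (n : Fin (L - 1)) : (gen L N).q i n = var (.q i n) := rfl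
theorem gen_p (i : Fin N) (n : Fin (L - 1)) : (gen L N).p i n = var (.p i n) := rfl

/-- Subtracting κ_n removes the term j = 0, since q^{(0)} is constantly 1. What remains involves
only the rows i ≥ 1, so its derivative in a coordinate p can be computed. -/
theorem pairing_eq_sum {F : Type*} [Field F] [Algebra ℂ F] (hL : 2 ≤ L) (k : Params L N)
    {x : Point L N F} (hs : ∀ i, x.s i ≠ 0) (n : ℤ) :
    x.pairing k (n + 1) n = algebraMap ℂ F (k.κ n) +
      ∑ i : Fin N, (x.qx i.succ (n + 1) - x.qx i.succ n) * x.px k i.succ n := by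
  rw [← Point.sum_left hL k hs, Point.pairing, Fin.sum_univ_succ, Fin.sum_univ_succ]
  simp only [Point.qx_zero_left, one_mul, sub_mul, Finset.sum_sub_distrib]
  ring

theorem qx_one {F : Type*} [Field F] (hL : 2 ≤ L) (x : Point L N F) (i : Fin N) :
    x.qx i.succ 1 = x.q i ⟨0, by omega⟩ := by
  rw [← Point.qx_fin hL]
  simp

theorem px_zero_eq {F : Type*} [Field F] [Algebra ℂ F] (k : Params L N) (x : Point L N F)
    (i : Fin N) :
    x.px k i.succ 0 = algebraMap ℂ F (k.θ i.succ) - ∑ n, x.q i n * x.p i n := by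
  simp [Point.px, Point.pBase, Point.pBasePos]

theorem qx_succ_cases {F : Type*} [Field F] (hL : 2 ≤ L) {x : Point L N F} (hs : ∀ i, x.s i ≠ 0)
    (i : Fin N) (n : Fin (L - 1)) :
    x.qx i.succ ((n : ℤ) + 1 + 1) = if h : (n : ℕ) + 1 < L - 1 then x.q i ⟨n + 1, h⟩
      else x.s i := by
  split_ifs with h
  · rw [← Point.qx_fin hL x i ⟨n + 1, h⟩]
    push_cast
    rfl
  · have h1 := Point.qx_add hL hs i.succ 0
    rw [show (n : ℤ) + 1 + 1 = 0 + L by omega, h1]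
    simp

/-- D_n has a nonzero derivative with respect to some p, so adding a function independent of p
cannot make it vanish. The cases t = 0, 𝔞_n and 𝔞_0 q_1 are the denominators of r_n. -/
theorem add_pairing_ne_zero (hL : 2 ≤ L) (hN : 1 ≤ N) (k : Params L N) {n : ℕ} (hn : n < L)
    {t : RatField L N} (ht : ∀ i m, pd (.p i m) t = 0) :
    t + (gen L N).pairing k (n + 1) n ≠ 0 := by
  have hs : ∀ i, (gen L N).s i ≠ 0 := fun i => var_ne_zero _
  have hqq : ∀ i n i' n', pd (.p i n) ((gen L N).q i' n') = 0 := fun i n i' n' => by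
    rw [gen_q]
    exact pd_var_of_ne (by simp)
  have hps : ∀ i n i', pd (.p i n) ((gen L N).s i') = 0 := fun i n i' => by
    rw [gen_s]
    exact pd_var_of_ne (by simp)
  have hpp : ∀ i n i' n', pd (.p i n) ((gen L N).p i' n') = if i' = i ∧ n' = n then 1 else 0 := by
    intro i n i' n'
    rw [gen_p]
    split_ifs with h
    · rw [h.1, h.2]
      exact pd_var_self _
    · exact pd_var_of_ne (by simpa using h)
  intro h
  rw [pairing_eq_sum hL k hs] at h
  rcases Nat.eq_zero_or_pos n with rfl | hpos
  · have h2 := congrArg (pd (.p ⟨0, hN⟩ ⟨0, by omega⟩)) h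
    simp [ht, qx_one hL, px_zero_eq, hqq, hpp, Derivation.leibniz] at h2
    rw [Finset.sum_eq_single ⟨0, hN⟩ (fun i _ hi => by simp [hi]) (by simp)] at h2
    rw [Finset.sum_eq_single ⟨0, by omega⟩ (fun i _ hi => by simp [hi]) (by simp)] at h2
    simp only [and_self, if_true, mul_one, mul_eq_zero, sub_eq_zero] at h2
    rcases h2 with h2 | h2
    · exact var_ne_one _ h2
    · exact var_ne_zero _ h2
  · obtain ⟨m, rfl⟩ : ∃ m, n = m + 1 := ⟨n - 1, by omega⟩
    -- Here the derivative is q_{n+1}^{(1)} − q_n^{(1)}, a difference of two distinct variables; for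
    -- n = L − 1 the first of them is s_1.
    have h2 := congrArg (pd (.p ⟨0, hN⟩ ⟨m, by omega⟩)) h
    have e1 : ∀ i : Fin N, (gen L N).qx i.succ ((m : ℤ) + 1) = (gen L N).q i ⟨m, by omega⟩ :=
      fun i => Point.qx_fin hL (gen L N) i ⟨m, by omega⟩
    have e2 : ∀ i : Fin N, (gen L N).px k i.succ ((m : ℤ) + 1) = (gen L N).p i ⟨m, by omega⟩ :=
      fun i => Point.px_fin hL k (gen L N) i ⟨m, by omega⟩
    have e3 : ∀ i : Fin N, _ := fun i => qx_succ_cases hL hs i ⟨m, by omega⟩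
    simp only at e3
    push_cast at h2
    simp only [e1, e2, e3] at h2
    have e4 : ∀ i i' : Fin N, pd (.p i' ⟨m, by omega⟩) (if h : m + 1 < L - 1 then
        (gen L N).q i ⟨m + 1, h⟩ else (gen L N).s i) = 0 := fun i i' => by
      split_ifs
      · exact hqq _ _ _ _
      · exact hps _ _ _
    simp [ht, hqq, hpp, Derivation.leibniz, e4] at h2
    rw [sub_eq_zero] at h2
    split_ifs at h2
    · have := var_injective h2
      simp at this
    · have := var_injective h2
      simp at this

/-! ### Generic points -/

/-- The point with coordinates given by a homomorphism of the field of rational functions. -/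
def pt (φ : RatField L N →ₐ[ℂ] RatField L N) : Point L N (RatField L N) :=
  (gen L N).map (φ : RatField L N →+* RatField L N)

theorem pt_s_ne_zero (φ : RatField L N →ₐ[ℂ] RatField L N) (i : Fin N) : (pt φ).s i ≠ 0 := by
  change φ (var (.s i)) ≠ 0
  rw [Ne, map_eq_zero]
  exact var_ne_zero _

theorem pt_piRegular (hL : 2 ≤ L) (φ : RatField L N →ₐ[ℂ] RatField L N) : piRegular (pt φ) := by
  intro i
  rw [qx_one hL]
  change φ (var _) ≠ 0
  rw [Ne, map_eq_zero]
  exact var_ne_zero _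

theorem pt_rRegular (hL : 2 ≤ L) (hN : 1 ≤ N) (φ : RatField L N →ₐ[ℂ] RatField L N)
    (k : Params L N) {n : ℕ} (hn : n < L) : rRegular n k (pt φ) := by
  have h := fun t ht => add_pairing_ne_zero hL hN k hn (t := t) ht
  rw [rRegular]
  dsimp only [pt]
  simp only [Point.pairing_map, Point.qx_map, AlgHom.coe_toRingHom]
  refine ⟨?_, ?_, fun h0 i => ?_⟩
  · rw [Ne, map_eq_zero]
    simpa using h 0 (by simp)
  · rw [← φ.commutes, ← map_add, Ne, map_eq_zero]
    exact h _ (by simp)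
  · rw [← φ.commutes, ← map_mul, ← map_add, Ne, map_eq_zero]
    refine h _ fun i' m => ?_
    rw [qx_one hL, Derivation.leibniz, gen_q, pd_var_of_ne (by simp)]
    simp

instance : Finite (Coord L N) := by
  let f : Coord L N → Fin N ⊕ (Fin N × Fin (L - 1)) ⊕ (Fin N × Fin (L - 1)) := fun c =>
    match c with
    | .s i => .inl i
    | .q i n => .inr (.inl (i, n))
    | .p i n => .inr (.inr (i, n))
  refine Finite.of_injective f fun c c' h => ?_
  cases c <;> cases c' <;> simp [f] at h <;> simp [h]

/-- The coordinate of a point with a given name. -/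
def Point.coord {F : Type*} (x : Point L N F) : Coord L N → F
  | .s i => x.s i
  | .q i n => x.q i n
  | .p i n => x.p i n

theorem gen_coord (c : Coord L N) : (gen L N).coord c = var c := by cases c <;> rfl

theorem Point.map_coord {F K : Type*} [Field F] [Field K] (φ : F →+* K) (x : Point L N F)
    (c : Coord L N) : (x.map φ).coord c = φ (x.coord c) := by cases c <;> rfl

theorem Point.ext_coord {F : Type*} {x y : Point L N F} (h : ∀ c, x.coord c = y.coord c) : x = y :=
  Point.ext' (fun i => h (.s i)) (fun i n => h (.q i n)) (fun i n => h (.p i n))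

theorem algHom_ext_pt {φ ψ : RatField L N →ₐ[ℂ] RatField L N} (h : pt φ = pt ψ) : φ = ψ := by
  apply IsLocalization.algHom_ext (R := ℂ) (nonZeroDivisors (MvPolynomial (Coord L N) ℂ))
  apply MvPolynomial.algHom_ext
  intro c
  have := congrArg (fun x : Point L N (RatField L N) => x.coord c) h
  simp only [pt, Point.map_coord, gen_coord] at this
  exact this

/-- A generating family with as many members as the transcendence degree is a transcendence basis.
Thus generating the field is already enough for a substitution to be injective. -/
theorem algebraicIndependent_of_adjoin_eq_top (y : Point L N (RatField L N))
    (h : IntermediateField.adjoin ℂ (Set.range y.coord) = ⊤) :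
    AlgebraicIndependent ℂ y.coord := by
  have halg : Algebra.IsAlgebraic (Algebra.adjoin ℂ (Set.range y.coord)) (RatField L N) := by
    refine ⟨fun f => ?_⟩
    have hf : f ∈ IntermediateField.adjoin ℂ (Set.range y.coord) := h ▸ IntermediateField.mem_top
    obtain ⟨a, ha, b, hb, rfl⟩ := (IntermediateField.mem_adjoin_iff_div).1 hf
    rw [div_eq_mul_inv]
    exact (isAlgebraic_algebraMap (⟨a, ha⟩ : Algebra.adjoin ℂ (Set.range y.coord))).mul
      (isAlgebraic_algebraMap (⟨b, hb⟩ : Algebra.adjoin ℂ (Set.range y.coord))).inv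
  refine (Algebra.IsAlgebraic.isTranscendenceBasis_of_le_trdeg_of_finite ℂ y.coord ?_).1
  have hX : AlgebraicIndependent ℂ (fun c : Coord L N => (MvPolynomial.X c : MvPolynomial _ ℂ)) :=
    MvPolynomial.algebraicIndependent_X _ _
  exact (hX.map' (f := IsScalarTower.toAlgHom ℂ (MvPolynomial (Coord L N) ℂ) (RatField L N))
    (IsFractionRing.injective _ _)).cardinalMk_le_trdeg

/-- A formula with a rational inverse defines an automorphism of the field of rational functions. -/
theorem exists_algEquiv (y : Point L N (RatField L N))
    (h : IntermediateField.adjoin ℂ (Set.range y.coord) = ⊤) :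
    ∃ φ : RatField L N ≃ₐ[ℂ] RatField L N, pt (φ : RatField L N →ₐ[ℂ] RatField L N) = y := by
  have hy : Function.Injective (MvPolynomial.aeval (R := ℂ) y.coord) :=
    algebraicIndependent_of_adjoin_eq_top y h
  let φ : RatField L N →ₐ[ℂ] RatField L N :=
    IsFractionRing.liftAlgHom (K := RatField L N) (g := MvPolynomial.aeval y.coord) hy
  have hφ : ∀ c, φ (var c) = y.coord c := fun c => by
    change IsFractionRing.liftAlgHom (K := RatField L N) (g := MvPolynomial.aeval y.coord) hy
      (algebraMap _ _ _) = _
    rw [IsFractionRing.liftAlgHom_apply, IsFractionRing.lift_algebraMap]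
    exact MvPolynomial.aeval_X _ _
  have hsurj : Function.Surjective φ := by
    intro f
    have hf : f ∈ φ.fieldRange := by
      have : IntermediateField.adjoin ℂ (Set.range y.coord) ≤ φ.fieldRange := by
        rw [IntermediateField.adjoin_le_iff]
        rintro _ ⟨c, rfl⟩
        exact ⟨var c, hφ c⟩
      rw [h] at this
      exact this IntermediateField.mem_top
    exact hf
  refine ⟨AlgEquiv.ofBijective φ ⟨φ.injective, hsurj⟩, Point.ext_coord fun c => ?_⟩
  rw [pt, Point.map_coord, gen_coord]
  exact hφ c

/-- A formula which has a rational inverse generates the field of rational functions. -/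
theorem adjoin_eq_top_of_inverse (y : Point L N (RatField L N))
    (σ : ∀ {F : Type} [Field F] [Algebra ℂ F], Point L N F → Point L N F)
    (hσ : ∀ {F K : Type} [Field F] [Field K] [Algebra ℂ F] [Algebra ℂ K] (φ : F →ₐ[ℂ] K)
      (x : Point L N F), σ (x.map (φ : F →+* K)) = (σ x).map (φ : F →+* K))
    (h : σ y = gen L N) : IntermediateField.adjoin ℂ (Set.range y.coord) = ⊤ := by
  set E := IntermediateField.adjoin ℂ (Set.range y.coord) with hE
  have hmem : ∀ c, y.coord c ∈ E := fun c => IntermediateField.subset_adjoin _ _ ⟨c, rfl⟩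
  let z : Point L N E :=
    -- The point y is read over the subfield E generated by its coordinates. Since σ is rational,
    -- its value at this point has coordinates in E, and by `h` these are all the variables.
    ⟨fun i => ⟨_, hmem (.s i)⟩, fun i n => ⟨_, hmem (.q i n)⟩, fun i n => ⟨_, hmem (.p i n)⟩⟩
  have hz : z.map (E.val : E →+* RatField L N) = y := rfl
  have hgen : ∀ c, var c ∈ E := fun c => by
    have h1 := hσ E.val z
    rw [hz, h] at h1
    rw [← gen_coord, h1, Point.map_coord]
    exact ((σ z).coord c).2
  rw [eq_top_iff]
  rintro f -
  obtain ⟨a, b, hb, rfl⟩ := IsFractionRing.div_surjective (A := MvPolynomial (Coord L N) ℂ) f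
  have hpoly : ∀ a : MvPolynomial (Coord L N) ℂ, algebraMap _ (RatField L N) a ∈ E := by
    intro a
    induction a using MvPolynomial.induction_on with
    | C c =>
      rw [← MvPolynomial.algebraMap_eq, ← IsScalarTower.algebraMap_apply]
      exact E.algebraMap_mem c
    | add a b ha hb =>
      rw [map_add]
      exact add_mem ha hb
    | mul_X a c ha =>
      rw [map_mul]
      exact mul_mem ha (hgen c)
  exact div_mem (hpoly a) (hpoly b)

end HLN
end

noncomputable section
namespace HLN
variable {L N : ℕ} {F : Type*} [Field F]

/-! ### Relations in homogeneous coordinates -/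

theorem ZMod.one_ne_zero' (hL : 2 ≤ L) : (1 : ZMod L) ≠ 0 := by
  have : Fact (1 < L) := ⟨by omega⟩
  exact one_ne_zero

theorem ZMod.two_ne_zero' (hL : 3 ≤ L) : (2 : ZMod L) ≠ 0 := by
  intro h
  have h2 : ((2 : ℕ) : ZMod L) = 0 := by exact_mod_cast h
  have := Nat.le_of_dvd (by norm_num) ((ZMod.natCast_eq_zero_iff 2 L).1 h2)
  omega

theorem Cfg.D_r_self (hL : 2 ≤ L) (C : Cfg N F) {n : ZMod L} (a : F) {m : ℤ}
    (hm : (m : ZMod L) = n) : (C.r n a).D m = C.D m := by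
  have h1 := ZMod.one_ne_zero' hL
  simp [Cfg.D, hm, h1]

/-- The shear changes neither q_{n+1} nor p_n, hence not D_n, so the shears by a and −a cancel. -/
theorem Cfg.r_r (hL : 2 ≤ L) (C : Cfg N F) (n : ZMod L) (a : F) :
    (C.r n a).r n (-a) = C := by
  have h1 := ZMod.one_ne_zero' hL
  ext j m
  · by_cases hm : (m : ZMod L) = n
    · simp only [Cfg.r_q (C.r n a), if_pos hm, C.D_r_self hL a hm]
      simp [hm, h1]
      ring
    · simp [hm]
  · by_cases hm : (m : ZMod L) = n + 1
    · have hm' : ((m - 1 : ℤ) : ZMod L) = n := by simp [hm]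
      simp only [Cfg.r_p (C.r n a), if_pos hm, C.D_r_self hL a hm']
      simp [hm, h1]
      ring
    · simp [hm]

theorem Cfg.D_r_far (C : Cfg N F) {l n : ZMod L} (a : F) (h1 : n ≠ l + 1)
    (h2 : l ≠ n + 1) {m : ℤ} (hm : (m : ZMod L) = l) : (C.r n a).D m = C.D m := by
  simp [Cfg.D, hm, h1.symm, h2]

theorem Cfg.r_comm_far (hL : 2 ≤ L) (C : Cfg N F) {l n : ZMod L} (a b : F) (h0 : l ≠ n)
    (h1 : n ≠ l + 1) (h2 : l ≠ n + 1) : (C.r n a).r l b = (C.r l b).r n a := by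
  ext j m
  · by_cases hm : (m : ZMod L) = n
    · simp only [Cfg.r_q (C.r l b), if_pos hm, C.D_r_far b h2 h1 hm]
      simp [hm, h0.symm, h2.symm]
    · by_cases hm' : (m : ZMod L) = l
      · simp only [Cfg.r_q (C.r n a), if_pos hm', C.D_r_far a h1 h2 hm']
        simp [hm', h0, h1.symm]
      · simp [hm, hm']
  · by_cases hm : (m : ZMod L) = n + 1
    · have hm1 : ((m - 1 : ℤ) : ZMod L) = n := by simp [hm]
      simp only [Cfg.r_p (C.r l b), if_pos hm, C.D_r_far b h2 h1 hm1]
      simp [hm, h0.symm, h1]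
    · by_cases hm' : (m : ZMod L) = l + 1
      · have hm1 : ((m - 1 : ℤ) : ZMod L) = l := by simp [hm']
        simp only [Cfg.r_p (C.r n a), if_pos hm', C.D_r_far a h1 h2 hm1]
        simp [hm', h0, h2]
      · simp [hm, hm']

/-- `∑_j q_{n+1}^{(j)} p_{n-1}^{(j)}`. -/
def Cfg.E (C : Cfg N F) (n : ℤ) : F := ∑ j, C.q j (n + 1) * C.p j (n - 1)

theorem Cfg.D_r_succ (hL : 3 ≤ L) (C : Cfg N F) {n : ZMod L} (a : F) {m : ℤ}
    (hm : (m : ZMod L) = n + 1) : (C.r n a).D m = C.D m - a / C.D (m - 1) * C.E m := by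
  have h2 : n + 1 + 1 ≠ n := by
    rw [add_assoc, Ne, add_eq_left, one_add_one_eq_two]
    exact ZMod.two_ne_zero' hL
  simp only [Cfg.D, Cfg.E, Cfg.r_q, Cfg.r_p, Int.cast_add, Int.cast_one, hm, if_neg h2, if_true,
    Finset.mul_sum, add_zero, mul_sub, Finset.sum_sub_distrib]
  congr 1
  exact Finset.sum_congr rfl fun j _ => by ring

theorem Cfg.D_r_pred (hL : 3 ≤ L) (C : Cfg N F) {n : ZMod L} (a : F) {m : ℤ}
    (hm : (m : ZMod L) = n) : (C.r (n + 1) a).D m = C.D m + a / C.D (m + 1) * C.E (m + 1) := by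
  have h2 : n ≠ n + 1 + 1 := by
    rw [add_assoc, Ne, left_eq_add, one_add_one_eq_two]
    exact ZMod.two_ne_zero' hL
  simp only [Cfg.D, Cfg.E, Cfg.r_q, Cfg.r_p, Int.cast_add, Int.cast_one, hm, if_neg h2, if_true,
    Finset.mul_sum, sub_zero, add_mul, Finset.sum_add_distrib, add_sub_cancel_right]
  congr 1
  exact Finset.sum_congr rfl fun j _ => by ring

theorem Cfg.E_r_succ (hL : 3 ≤ L) (C : Cfg N F) {n : ZMod L} (a : F) {m : ℤ}
    (hm : (m : ZMod L) = n + 1) : (C.r n a).E m = C.E m := by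
  have h1 := ZMod.one_ne_zero' (by omega : 2 ≤ L)
  have h2 : n + 1 + 1 ≠ n := by
    rw [add_assoc, Ne, add_eq_left, one_add_one_eq_two]
    exact ZMod.two_ne_zero' hL
  simp [Cfg.E, hm, h1, h2]

theorem Cfg.E_r_pred (hL : 3 ≤ L) (C : Cfg N F) {n : ZMod L} (a : F) {m : ℤ}
    (hm : (m : ZMod L) = n) : (C.r n a).E m = C.E m := by
  have h1 := ZMod.one_ne_zero' (by omega : 2 ≤ L)
  have h2 : n - 1 ≠ n + 1 := by
    rw [Ne, sub_eq_iff_eq_add, add_assoc, left_eq_add, one_add_one_eq_two]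
    exact ZMod.two_ne_zero' hL
  simp [Cfg.E, hm, h1, h2]

/-- With E = ∑ q_{n+2} p_n, the first shear r_n replaces D_{n+1} by D_{n+1} − aE/D_n, the first
shear r_{n+1} replaces D_n by D_n + bE/D_{n+1}, and neither changes E. All denominators are then
products and quotients of D_n, D_{n+1}, D_n D_{n+1} − aE and D_n D_{n+1} + bE, and the two sides
agree exactly, not only up to the torus. -/
theorem Cfg.r_braid (hL : 3 ≤ L) (C : Cfg N F) (n : ZMod L) (a b : F)
    (h1 : ∀ m : ℤ, (m : ZMod L) = n → C.D m ≠ 0)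
    (h2 : ∀ m : ℤ, (m : ZMod L) = n + 1 → C.D m ≠ 0)
    (h3 : ∀ m : ℤ, (m : ZMod L) = n + 1 → (C.r n a).D m ≠ 0)
    (h4 : ∀ m : ℤ, (m : ZMod L) = n → (C.r (n + 1) b).D m ≠ 0) :
    ((C.r n a).r (n + 1) (a + b)).r n b = ((C.r (n + 1) b).r n (a + b)).r (n + 1) a := by
  have z1 := ZMod.one_ne_zero' (by omega : 2 ≤ L)
  have z2 : n + 1 + 1 ≠ n := by
    rw [add_assoc, Ne, add_eq_left, one_add_one_eq_two]
    exact ZMod.two_ne_zero' hL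
  have n1 : n + 1 ≠ n := by simpa using z1
  have n2 : n + 1 + 1 ≠ n + 1 := by simpa using z1
  -- the pairings along both sides
  have X : ∀ m : ℤ, (m : ZMod L) = n → C.D m * C.D (m + 1) - a * C.E (m + 1) ≠ 0 := by
    intro m hm
    have hm1 : ((m + 1 : ℤ) : ZMod L) = n + 1 := by simp [hm]
    have e := h3 (m + 1) hm1
    have d := h1 m hm
    rw [C.D_r_succ hL a hm1, add_sub_cancel_right] at e
    contrapose! e
    field_simp
    linear_combination e
  have Y : ∀ m : ℤ, (m : ZMod L) = n → C.D m * C.D (m + 1) + b * C.E (m + 1) ≠ 0 := by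
    intro m hm
    have hm1 : ((m + 1 : ℤ) : ZMod L) = n + 1 := by simp [hm]
    have e := h4 m hm
    have d := h2 (m + 1) hm1
    rw [C.D_r_pred hL b hm] at e
    contrapose! e
    field_simp
    linear_combination e
  have d1 : ∀ m : ℤ, (m : ZMod L) = n → (C.r n a).D (m + 1) =
      (C.D m * C.D (m + 1) - a * C.E (m + 1)) / C.D m := by
    intro m hm
    have d := h1 m hm
    rw [C.D_r_succ hL a (by simp [hm]), add_sub_cancel_right]
    field_simp
  have d2 : ∀ m : ℤ, (m : ZMod L) = n → ((C.r n a).r (n + 1) (a + b)).D m =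
      C.D m * (C.D m * C.D (m + 1) + b * C.E (m + 1)) /
        (C.D m * C.D (m + 1) - a * C.E (m + 1)) := by
    intro m hm
    have d := h1 m hm
    have x := X m hm
    rw [(C.r n a).D_r_pred hL _ hm, d1 m hm, C.E_r_succ hL a (by simp [hm]),
      C.D_r_self (by omega) a hm]
    field_simp
    ring
  have d3 : ∀ m : ℤ, (m : ZMod L) = n → (C.r (n + 1) b).D m =
      (C.D m * C.D (m + 1) + b * C.E (m + 1)) / C.D (m + 1) := by
    intro m hm
    have d := h2 (m + 1) (by simp [hm])
    rw [C.D_r_pred hL b hm]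
    field_simp
  have d4 : ∀ m : ℤ, (m : ZMod L) = n → ((C.r (n + 1) b).r n (a + b)).D (m + 1) =
      C.D (m + 1) * (C.D m * C.D (m + 1) - a * C.E (m + 1)) /
        (C.D m * C.D (m + 1) + b * C.E (m + 1)) := by
    intro m hm
    have d := h2 (m + 1) (by simp [hm])
    have y := Y m hm
    rw [(C.r (n + 1) b).D_r_succ hL _ (by simp [hm]), add_sub_cancel_right, d3 m hm,
      C.E_r_pred hL b (by simp [hm]), C.D_r_self (by omega) b (by simp [hm])]
    generalize hy : C.D m * C.D (m + 1) + b * C.E (m + 1) = y' at *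
    field_simp
    rw [← hy]
    ring
  ext j m
  · by_cases hm : (m : ZMod L) = n
    · have := h1 m hm
      have := h2 (m + 1) (by simp [hm])
      have := X m hm
      have := Y m hm
      rw [Cfg.r_q, if_pos hm, d2 m hm]
      simp only [Cfg.r_q, Int.cast_add, Int.cast_one, hm, d1 m hm, d3 m hm, if_pos, if_neg n1,
        if_neg n1.symm, if_neg z2]
      field_simp
      ring
    · by_cases hm' : (m : ZMod L) = n + 1
      · have hm0 : ((m - 1 : ℤ) : ZMod L) = n := by simp [hm']
        have e1 := d1 _ hm0
        have e4 := d4 _ hm0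
        have := h1 _ hm0
        have := h2 m hm'
        have := X _ hm0
        have := Y _ hm0
        rw [sub_add_cancel] at *
        rw [Cfg.r_q (((C.r (n + 1) b).r n (a + b))), if_pos hm', e4]
        simp only [Cfg.r_q, Int.cast_add, Int.cast_one, hm', e1, if_pos, if_neg n1,
          if_neg n1.symm, if_neg z2, if_neg n2]
        field_simp
        ring
      · simp [hm, hm']
  · by_cases hm : (m : ZMod L) = n + 1
    · have hm0 : ((m - 1 : ℤ) : ZMod L) = n := by simp [hm]
      have e2 := d2 _ hm0
      have e3 := d3 _ hm0
      have := h1 _ hm0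
      have := h2 m hm
      have := X _ hm0
      have := Y _ hm0
      rw [sub_add_cancel] at *
      rw [Cfg.r_p _ n b, if_pos hm, e2]
      simp only [Cfg.r_p, Int.cast_sub, Int.cast_one, hm, add_sub_cancel_right, e3, if_pos,
        if_neg n1, if_neg n1.symm, if_neg z2.symm, if_neg n2.symm, if_neg n2]
      field_simp
      ring
    · by_cases hm' : (m : ZMod L) = n + 1 + 1
      · have hm1 : ((m - 1 : ℤ) : ZMod L) = n + 1 := by simp [hm']
        have hm0 : ((m - 1 - 1 : ℤ) : ZMod L) = n := by simp [hm']
        have e1 := d1 _ hm0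
        have e3 := d3 _ hm0
        have e4 := d4 _ hm0
        have := h1 _ hm0
        have := h2 _ hm1
        have := X _ hm0
        have := Y _ hm0
        rw [sub_add_cancel] at *
        rw [Cfg.r_p _ (n + 1) a, if_pos hm', e4]
        simp only [Cfg.r_p, Int.cast_sub, Int.cast_one, hm', add_sub_cancel_right, e1, e3,
          if_pos, if_neg n1, if_neg n1.symm, if_neg z2, if_neg n2, if_neg n2.symm, if_neg z2.symm]
        field_simp
        ring
      · simp [hm, hm']

theorem Cfg.D_r' (C : Cfg N F) {n l : ZMod L} (b : F) (h : l ≠ n + 1) {m : ℤ}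
    (hm : (m : ZMod L) = n) : (C.r' l b).D m = C.D m := by
  have h1 : n ≠ l - 1 := fun h' => h (by rw [h', sub_add_cancel])
  simp [Cfg.D, hm, h1, h.symm]

theorem Cfg.D'_r (C : Cfg N F) {n l : ZMod L} (a : F) (h : l ≠ n + 1) {m : ℤ}
    (hm : (m : ZMod L) = l) : (C.r n a).D' m = C.D' m := by
  have h1 : l - 1 ≠ n := fun h' => h (by rw [← h', sub_add_cancel])
  simp [Cfg.D', hm, h1, h]

/-- r_n adds multiples of q_{n+1}, p_n to q_n, p_{n+1}, while r'_l adds multiples of q_{l−1}, p_l to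
q_l, p_{l−1}. Unless l = n + 1, neither alters what the other reads, so the increments simply add
up. -/
theorem Cfg.r_r'_comm_of_ne (hL : 2 ≤ L) (C : Cfg N F) {n l : ZMod L} (a b : F) (h : l ≠ n + 1) :
    (C.r n a).r' l b = (C.r' l b).r n a := by
  have h1 : l - 1 ≠ n := fun h' => h (by rw [← h', sub_add_cancel])
  ext j m
  · by_cases hm : (m : ZMod L) = n
    · by_cases hm' : (m : ZMod L) = l
      · rw [Cfg.r'_q, Cfg.r_q (C.r' l b), if_pos hm, if_pos hm', C.D'_r a h hm', C.D_r' b h hm]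
        simp only [Cfg.r_q, Cfg.r'_q, Int.cast_add, Int.cast_sub, Int.cast_one, if_pos hm, if_pos hm']
        rw [if_neg (by rwa [hm']), if_neg (by rw [hm]; exact h.symm)]
        ring
      · rw [Cfg.r'_q, Cfg.r_q (C.r' l b), if_pos hm, if_neg hm', C.D_r' b h hm]
        have e : n ≠ l := fun e => hm' (hm.trans e)
        simp [hm, e, h.symm]
    · by_cases hm' : (m : ZMod L) = l
      · rw [Cfg.r'_q, Cfg.r_q (C.r' l b), if_neg hm, if_pos hm', C.D'_r a h hm']
        have e : l ≠ n := fun e => hm (hm'.trans e)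
        simp [hm', e, h1]
      · simp [hm, hm']
  · by_cases hm : (m : ZMod L) = n + 1
    · have hm1 : ((m - 1 : ℤ) : ZMod L) = n := by simp [hm]
      by_cases hm' : (m : ZMod L) = l - 1
      · have hm2 : ((m + 1 : ℤ) : ZMod L) = l := by simp [hm']
        rw [Cfg.r'_p, Cfg.r_p (C.r' l b), if_pos hm, if_pos hm', C.D'_r a h hm2, C.D_r' b h hm1]
        simp only [Cfg.r_p, Cfg.r'_p, if_pos hm, if_pos hm']
        rw [if_neg (by rwa [hm2]), if_neg (by rw [hm1]; exact h1.symm)]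
        ring
      · rw [Cfg.r'_p, Cfg.r_p (C.r' l b), if_pos hm, if_neg hm', C.D_r' b h hm1]
        have e : n + 1 ≠ l - 1 := fun e => hm' (hm.trans e)
        simp [hm, e, h1.symm]
    · by_cases hm' : (m : ZMod L) = l - 1
      · have hm2 : ((m + 1 : ℤ) : ZMod L) = l := by simp [hm']
        rw [Cfg.r'_p, Cfg.r_p (C.r' l b), if_neg hm, if_pos hm', C.D'_r a h hm2]
        have e : l - 1 ≠ n + 1 := fun e => hm (hm'.trans e)
        simp [hm', e, h]
      · simp [hm, hm']

/-- The nontrivial case of the commutation of `r_m` and `r_n'`: equality up to the torus. -/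
theorem Cfg.r_r'_comm_equiv (hL : 2 ≤ L) (C : Cfg N F) (n : ZMod L) (a b : F)
    (h1 : ∀ m : ℤ, (m : ZMod L) = n → C.D m ≠ 0)
    (h2 : ∀ m : ℤ, (m : ZMod L) = n + 1 → C.D' m ≠ 0)
    (h3 : ∀ m : ℤ, (m : ZMod L) = n → (C.r' (n + 1) b).D m ≠ 0)
    (hκ : ∀ m : ℤ, (m : ZMod L) = n →
      ∑ j, C.q j m * C.p j m - ∑ j, C.q j (m + 1) * C.p j (m + 1) = b - a) :
    ((C.r n a).r' (n + 1) b).Equiv ((C.r' (n + 1) b).r n a) := by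
  have z1 := ZMod.one_ne_zero' hL
  have n1 : n + 1 ≠ n := by simpa using z1
  -- Writing D' for D'_{n+1}, the new pairing is D + (b/D')(κ_n − κ_{n+1}) − b²/D', and κ_n −
  -- κ_{n+1} = b − a reduces it to D − ab/D'.
  have e1 : ∀ m : ℤ, (m : ZMod L) = n → (C.r' (n + 1) b).D m =
      (C.D m * C.D' (m + 1) - a * b) / C.D' (m + 1) := by
    intro m hm
    have d := h2 (m + 1) (by simp [hm])
    have k := hκ m hm
    have s1 : (C.r' (n + 1) b).D m = C.D m + b / C.D' (m + 1) * ∑ j, C.q j m * C.p j m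
        - b / C.D' (m + 1) * ∑ j, C.q j (m + 1) * C.p j (m + 1)
        - b / C.D' (m + 1) * (b / C.D' (m + 1)) * C.D' (m + 1) := by
      conv_rhs => rw [Cfg.D, Cfg.D']
      simp only [Finset.mul_sum, ← Finset.sum_add_distrib, ← Finset.sum_sub_distrib, Cfg.D,
        Cfg.r'_q, Cfg.r'_p, Int.cast_add, Int.cast_one, hm, add_sub_cancel_right, if_true, Cfg.D']
      exact Finset.sum_congr rfl fun j _ => by ring
    rw [s1, sub_eq_iff_eq_add] at *
    rw [k]
    field_simp
    ring
  have e2 : ∀ m : ℤ, (m : ZMod L) = n → (C.r n a).D' (m + 1) =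
      (C.D m * C.D' (m + 1) - a * b) / C.D m := by
    intro m hm
    have d := h1 m hm
    have k := hκ m hm
    have s1 : (C.r n a).D' (m + 1) = C.D' (m + 1) - a / C.D m * ∑ j, C.q j m * C.p j m
        + a / C.D m * ∑ j, C.q j (m + 1) * C.p j (m + 1)
        - a / C.D m * (a / C.D m) * C.D m := by
      conv_rhs => rw [Cfg.D, Cfg.D']
      simp only [Finset.mul_sum, ← Finset.sum_add_distrib, ← Finset.sum_sub_distrib, Cfg.D',
        Cfg.r_q, Cfg.r_p, Int.cast_add, Int.cast_one, hm, add_sub_cancel_right, if_true, Cfg.D]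
      exact Finset.sum_congr rfl fun j _ => by ring
    rw [s1, sub_eq_iff_eq_add] at *
    rw [k]
    field_simp
    ring
  have X : ∀ m : ℤ, (m : ZMod L) = n → C.D m * C.D' (m + 1) - a * b ≠ 0 := by
    intro m hm e
    apply h3 m hm
    rw [e1 m hm, e, zero_div]
  -- The factor is read off from q_n: applying r' and then r gives q_n + aD'/(DD' − ab)·(q_{n+1} +
  -- (b/D') q_n) = DD'/(DD' − ab)·(q_n + (a/D) q_{n+1}). At n + 1 the inverse factor occurs.
  refine ⟨fun m => if (m : ZMod L) = n then
      C.D m * C.D' (m + 1) / (C.D m * C.D' (m + 1) - a * b)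
    else if (m : ZMod L) = n + 1 then
      (C.D (m - 1) * C.D' m - a * b) / (C.D (m - 1) * C.D' m) else 1, 1, fun m => ?_,
    by simp, ?_⟩
  · dsimp only
    split_ifs with hm hm'
    · exact div_ne_zero (mul_ne_zero (h1 m hm) (h2 _ (by simp [hm]))) (X m hm)
    · have hm1 : ((m - 1 : ℤ) : ZMod L) = n := by simp [hm']
      have := X _ hm1
      rw [sub_add_cancel] at this
      exact div_ne_zero this (mul_ne_zero (h1 _ hm1) (h2 _ hm'))
    · exact one_ne_zero
  · ext j m
    · rw [Cfg.gauge_q]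
      by_cases hm : (m : ZMod L) = n
      · have := h1 m hm
        have := h2 (m + 1) (by simp [hm])
        have := X m hm
        rw [Cfg.r_q, if_pos hm, e1 m hm]
        simp only [Cfg.r_q, Cfg.r'_q, Int.cast_add, Int.cast_one, hm, if_pos, if_neg n1.symm,
          add_sub_cancel_right, Pi.one_apply]
        field_simp
        ring
      · by_cases hm' : (m : ZMod L) = n + 1
        · have hm0 : ((m - 1 : ℤ) : ZMod L) = n := by simp [hm']
          have e := e2 _ hm0
          have := h1 _ hm0
          have := h2 m hm'
          have := X _ hm0
          rw [sub_add_cancel] at *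
          rw [Cfg.r'_q, if_pos hm', e]
          simp only [Cfg.r_q, Cfg.r'_q, Int.cast_sub, Int.cast_one, hm', if_pos, if_neg n1,
            add_sub_cancel_right, Pi.one_apply]
          simp only [sub_add_cancel]
          generalize hx : C.D (m - 1) * C.D' m - a * b = x at *
          field_simp
          rw [← hx]
          ring
        · simp [hm, hm']
    · rw [Cfg.gauge_p]
      by_cases hm : (m : ZMod L) = n
      · have := h1 m hm
        have := h2 (m + 1) (by simp [hm])
        have := X m hm
        rw [Cfg.r'_p, add_sub_cancel_right, if_pos hm, e2 m hm]
        simp only [Cfg.r_p, Cfg.r'_p, Int.cast_add, Int.cast_one, hm, if_pos, if_neg n1.symm,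
          add_sub_cancel_right, Pi.one_apply]
        generalize hx : C.D m * C.D' (m + 1) - a * b = x at *
        field_simp
        rw [← hx]
        ring
      · by_cases hm' : (m : ZMod L) = n + 1
        · have hm0 : ((m - 1 : ℤ) : ZMod L) = n := by simp [hm']
          have e := e1 _ hm0
          have := h1 _ hm0
          have := h2 m hm'
          have := X _ hm0
          rw [sub_add_cancel] at *
          rw [Cfg.r_p, if_pos hm', e]
          simp only [Cfg.r_p, Cfg.r'_p, Int.cast_sub, Int.cast_one, hm', if_pos, if_neg n1,
            add_sub_cancel_right, Pi.one_apply]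
          simp only [sub_add_cancel]
          field_simp
          ring
        · simp [hm, hm']

end HLN
end

noncomputable section
namespace HLN
variable {L N : ℕ}

/-! ### More on the action on parameters -/

/-- The affine reflection on simple roots: 𝔞_n changes sign and is added to its neighbours. The
indicators are kept separate because for L = 2 the two neighbours coincide and 2𝔞_n is added. -/
theorem rParam_a [NeZero L] (k : Params L N) (n : ZMod L) (m : ℤ) :
    (rParam n k).a m = k.a m + (if (m : ZMod L) + 1 = n then k.a n.val else 0)
      - (if (m : ZMod L) = n then k.a n.val else 0)
      - (if (m : ZMod L) = n then k.a n.val else 0)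
      + (if (m : ZMod L) = n + 1 then k.a n.val else 0) := by
  rw [Params.a, rParam]
  simp only [Int.cast_add, Int.cast_one, add_left_inj, Params.a]
  ring

/-- 𝔟 depends on e and κ only through e − κ, which r_n leaves unchanged. -/
theorem rParam_b [NeZero L] (k : Params L N) (n : ZMod L) (m : ℤ) :
    (rParam n k).b m = k.b m := by
  simp only [Params.b, rParam]
  ring

theorem rParam'_a [NeZero L] (k : Params L N) (n : ZMod L) (m : ℤ) :
    (rParam' n k).a m = k.a m := by
  simp only [Params.a, rParam'_e]

theorem rParam_rParam'_comm [NeZero L] (k : Params L N) (m n : ZMod L) :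
    rParam' n (rParam m k) = rParam m (rParam' n k) := by
  have h : (rParam' n k).a m.val = k.a m.val := rParam'_a k n _
  refine Params.ext' (fun l => ?_) (fun l => ?_) rfl
  · rw [rParam'_e]
    simp only [rParam, h, rParam'_e]
  · rw [rParam'_κ, rParam_b]
    simp only [rParam, h, rParam'_κ]
    ring

/-- ρπ is an involution on the parameters; this makes ρπρ the inverse of π. -/
theorem rhoParam_piParam [NeZero L] (k : Params L N) :
    rhoParam (piParam (rhoParam (piParam k))) = k := by
  have e1 := k.e_add
  refine Params.ext' (fun n => ?_) (fun n => ?_) rfl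
  · simp only [rhoParam, piParam]
    have h1 : (L : ℤ) - (L - n + 1) + 1 = n := by ring
    rw [h1]
    ring
  · simp only [rhoParam, piParam]
    have h1 : (L : ℤ) - (L - n + 1) + 1 = n := by ring
    rw [h1]

theorem piParam_rhoParam [NeZero L] (k : Params L N) :
    piParam (rhoParam (piParam k)) = rhoParam k := by
  rw [← rhoParam_rhoParam (piParam (rhoParam (piParam k))), rhoParam_piParam]

/-- The first four identities say that the roots met along the two words are a, a+b, b and b, a+b,
a, which are the coefficients required by `Cfg.r_braid`. -/
theorem rParam_braid [NeZero L] (hL : 3 ≤ L) (k : Params L N) (n : ZMod L) :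
    (rParam n k).a (n + 1).val = k.a n.val + k.a (n + 1).val ∧
    (rParam (n + 1) (rParam n k)).a n.val = k.a (n + 1).val ∧
    (rParam (n + 1) k).a n.val = k.a n.val + k.a (n + 1).val ∧
    (rParam n (rParam (n + 1) k)).a (n + 1).val = k.a n.val ∧
    rParam n (rParam (n + 1) (rParam n k)) = rParam (n + 1) (rParam n (rParam (n + 1) k)) := by
  have z1 := ZMod.one_ne_zero' (by omega : 2 ≤ L)
  have n1 : n + 1 ≠ n := by simpa using z1
  have n2 : n + 1 + 1 ≠ n + 1 := by simpa using z1
  have z2 : n + 1 + 1 ≠ n := by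
    rw [add_assoc, Ne, add_eq_left, one_add_one_eq_two]
    exact ZMod.two_ne_zero' hL
  have c : ∀ n : ZMod L, ((n.val : ℤ) : ZMod L) = n := fun n => by simp
  have e1 : (rParam n k).a (n + 1).val = k.a n.val + k.a (n + 1).val := by
    rw [rParam_a, c, if_neg z2, if_neg n1, if_pos rfl]
    ring
  have e2 : (rParam (n + 1) k).a n.val = k.a n.val + k.a (n + 1).val := by
    rw [rParam_a, c, if_pos rfl, if_neg n1.symm, if_neg z2.symm]
    ring
  have e3 : (rParam (n + 1) (rParam n k)).a n.val = k.a (n + 1).val := by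
    rw [rParam_a, c, if_pos rfl, if_neg n1.symm, if_neg z2.symm, e1,
      rParam_a_self (by omega) k n]
    ring
  have e4 : (rParam n (rParam (n + 1) k)).a (n + 1).val = k.a n.val := by
    rw [rParam_a, c, if_neg z2, if_neg n1, if_pos rfl, e2,
      rParam_a_self (by omega) k (n + 1)]
    ring
  refine ⟨e1, e3, e2, e4, ?_⟩
  refine Params.ext' (fun m => ?_) (fun m => ?_) rfl
  · have h : ∀ (l : ZMod L) (k' : Params L N), (rParam l k').e m = k'.e m +
      (if (m : ZMod L) = l then k'.a l.val else 0)
      - (if (m : ZMod L) = l + 1 then k'.a l.val else 0) := fun _ _ => rfl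
    simp only [h, e1, e2, e3, e4]
    split_ifs <;> ring
  · have h : ∀ (l : ZMod L) (k' : Params L N), (rParam l k').κ m = k'.κ m +
      (if (m : ZMod L) = l then k'.a l.val else 0)
      - (if (m : ZMod L) = l + 1 then k'.a l.val else 0) := fun _ _ => rfl
    simp only [h, e1, e2, e3, e4]
    split_ifs <;> ring

theorem rParam_a_far [NeZero L] (k : Params L N) {l n : ZMod L} (h0 : l ≠ n)
    (h1 : n ≠ l + 1) (h2 : l ≠ n + 1) : (rParam n k).a l.val = k.a l.val := by
  have c : ((l.val : ℤ) : ZMod L) = l := by simp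
  rw [rParam_a, c, if_neg h1.symm, if_neg h0, if_neg h2]
  ring

theorem rParam_comm_far [NeZero L] (k : Params L N) {l n : ZMod L} (h0 : l ≠ n)
    (h1 : n ≠ l + 1) (h2 : l ≠ n + 1) : rParam l (rParam n k) = rParam n (rParam l k) := by
  have e1 := rParam_a_far k h0 h1 h2
  have e2 := rParam_a_far k h0.symm h2 h1
  refine Params.ext' (fun m => ?_) (fun m => ?_) rfl
  · have h : ∀ (l : ZMod L) (k' : Params L N), (rParam l k').e m = k'.e m +
      (if (m : ZMod L) = l then k'.a l.val else 0)
      - (if (m : ZMod L) = l + 1 then k'.a l.val else 0) := fun _ _ => rfl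
    simp only [h, e1, e2]
    ring
  · have h : ∀ (l : ZMod L) (k' : Params L N), (rParam l k').κ m = k'.κ m +
      (if (m : ZMod L) = l then k'.a l.val else 0)
      - (if (m : ZMod L) = l + 1 then k'.a l.val else 0) := fun _ _ => rfl
    simp only [h, e1, e2]
    ring

/-! ### Inverses of the explicit formulas -/

section Inverse

variable {F : Type*} [Field F] [Algebra ℂ F]

/-- After r_n the pairing is a + D while the root is −a: the denominators D and a + D change places,
so the formula can be applied a second time. -/
theorem rRegular_rPoint [NeZero L] (hL : 2 ≤ L) (n : ZMod L) (k : Params L N) {x : Point L N F}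
    (hs : ∀ i, x.s i ≠ 0) (hr : rRegular n.val k x) :
    rRegular n.val (rParam n k) (rPoint n.val k x) := by
  have hr' := hr
  obtain ⟨hD, haD, hqD⟩ := hr
  have n1 : ¬ n + 1 = n := by simpa using ZMod.one_ne_zero' hL
  have c : ((n.val : ℤ) : ZMod L) = n := by simp
  -- For n = 0 and for n ≠ 0 the normalizing torus elements differ, but both have l_{n+1}/l_n = 1 +
  -- a/D, the weight by which D_n is multiplied.
  have key : ∀ (l : ℤ → F) (u : Fin (N + 1) → F), (∀ j, u j ≠ 0) →
      (rPoint n.val k x).cfg (rParam n k) =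
        ((x.cfg k).r n (algebraMap ℂ F (k.a n.val))).gauge l u →
      l (n.val + 1) / l n.val =
        1 + algebraMap ℂ F (k.a n.val) / x.pairing k (n.val + 1) n.val →
      (rPoint n.val k x).pairing (rParam n k) (n.val + 1) n.val =
        algebraMap ℂ F (k.a n.val) + x.pairing k (n.val + 1) n.val := by
    intro l u hu h hl
    have h2 : (rPoint n.val k x).pairing (rParam n k) (n.val + 1) n.val =
        ((rPoint n.val k x).cfg (rParam n k)).D n.val := rfl
    rw [h2, h, Cfg.gauge_D hu, hl, Cfg.D_r_self hL _ _ c]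
    change _ * x.pairing k (n.val + 1) n.val = _
    field_simp
    ring
  have hD' : (rPoint n.val k x).pairing (rParam n k) (n.val + 1) n.val =
        algebraMap ℂ F (k.a n.val) + x.pairing k (n.val + 1) n.val := by
    by_cases hn : n = 0
    · subst hn
      simp only [ZMod.val_zero, Nat.cast_zero, zero_add] at *
      have hcq : ∀ j, 1 + algebraMap ℂ F (k.a 0) / x.pairing k 1 0 * x.qx j 1 ≠ 0 := fun j => by
        refine Fin.cases ?_ (fun i => ?_) j
        · rw [Point.qx_zero_left, mul_one, ← div_self hD, ← add_div, add_comm]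
          exact div_ne_zero haD hD
        · rw [div_mul_eq_mul_div, ← div_self hD, ← add_div, add_comm]
          exact div_ne_zero (hqD trivial i) hD
      refine key _ _ (fun j => inv_ne_zero (hcq j)) (rPoint_cfg_zero hL k hs hr') ?_
      simp [ZMod.one_ne_zero' hL]
    · refine key _ _ (by simp) (rPoint_cfg_of_ne_zero hL hn k hs hr') ?_
      rw [if_pos c, if_neg (by simpa using ZMod.one_ne_zero' hL), one_div, inv_inv]
  rw [rRegular]
  rw [hD', rParam_a_self hL, map_neg]
  refine ⟨haD, by simpa using hD, fun h0 i => ?_⟩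
  have hn : n = 0 := by simpa using h0
  subst hn
  simp only [ZMod.val_zero, Nat.cast_zero, zero_add, true_imp_iff] at *
  have hi := hqD i
  have e : (rPoint 0 k x).qx i.succ 1 = _ :=
    congrArg (fun C : Cfg N F => C.q i.succ 1) (rPoint_cfg_zero hL k hs hr')
  simp only [Cfg.gauge_q, Cfg.r_q, Point.cfg_q, Int.cast_one, if_neg (ZMod.one_ne_zero' hL),
    add_zero] at e
  have h3 : 1 + algebraMap ℂ F (k.a 0) / x.pairing k 1 0 * x.qx i.succ 1 =
      (algebraMap ℂ F (k.a 0) * x.qx i.succ 1 + x.pairing k 1 0) / x.pairing k 1 0 := by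
    field_simp
    ring
  rw [e, h3]
  have h4 : -algebraMap ℂ F (k.a 0) * ((1 + algebraMap ℂ F (k.a 0) / x.pairing k 1 0) *
      ((algebraMap ℂ F (k.a 0) * x.qx i.succ 1 + x.pairing k 1 0) / x.pairing k 1 0)⁻¹ *
        x.qx i.succ 1) + (algebraMap ℂ F (k.a 0) + x.pairing k 1 0) =
      (algebraMap ℂ F (k.a 0) + x.pairing k 1 0) * x.pairing k 1 0 /
        (algebraMap ℂ F (k.a 0) * x.qx i.succ 1 + x.pairing k 1 0) := by
    field_simp
    ring
  rw [h4]
  exact div_ne_zero (mul_ne_zero haD hD) hi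

theorem rPoint_rPoint [NeZero L] (hL : 2 ≤ L) (n : ZMod L) (k : Params L N) {x : Point L N F}
    (hs : ∀ i, x.s i ≠ 0) (hr : rRegular n.val k x) :
    rPoint n.val (rParam n k) (rPoint n.val k x) = x := by
  have hs' : ∀ i, (rPoint n.val k x).s i ≠ 0 := by rwa [rPoint_s]
  have h1 := (rPoint_cfg_equiv hL n k hs hr).r n (algebraMap ℂ F ((rParam n k).a n.val))
  have h2 := rPoint_cfg_equiv hL n (rParam n k) hs' (rRegular_rPoint hL n k hs hr)
  have h3 := h1.trans h2
  rw [rParam_a_self hL, map_neg, Cfg.r_r hL] at h3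
  exact (Point.eq_of_cfg_equiv hL (by rw [rPoint_s, rPoint_s]) h3).symm

theorem rhoPoint_rhoPoint [NeZero L] (hL : 2 ≤ L) (k : Params L N) {x : Point L N F}
    (hs : ∀ i, x.s i ≠ 0) : rhoPoint (rhoParam k) (rhoPoint k x) = x := by
  have h1 := rhoPoint_cfg hL k hs
  have h2 := rhoPoint_cfg hL (rhoParam k) (x := rhoPoint k x) (fun i => by simpa [rhoPoint] using hs i)
  have h3 : ((x.cfg k).rev).rev = x.cfg k := by
    ext <;> simp
  rw [h1, h3] at h2
  refine Point.eq_of_cfg_equiv (k := rhoParam (rhoParam k)) (k' := k) hL ?_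
    (by rw [h2]; exact Cfg.Equiv.refl _)
  funext i
  simp [rhoPoint]

/-- Shift, reversal, shift, reversal compose to the identity, so ρπρ gives a rational inverse of π.
-/
theorem rhoPoint_piPoint [NeZero L] (hL : 2 ≤ L) (k : Params L N) {x : Point L N F}
    (hs : ∀ i, x.s i ≠ 0) (hq : piRegular x) :
    rhoPoint (piParam (rhoParam (piParam k))) (piPoint (rhoParam (piParam k))
      (rhoPoint (piParam k) (piPoint k x))) = x := by
  have h1 := piPoint_cfg_equiv hL k hs hq
  have h2 := rhoPoint_cfg hL (piParam k) (x := piPoint k x) hs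
  have hs2 : ∀ i, (rhoPoint (piParam k) (piPoint k x)).s i ≠ 0 := fun i => by
    simpa [rhoPoint, piPoint] using hs i
  have hq2 : piRegular (rhoPoint (piParam k) (piPoint k x)) := by
    intro i
    have e : (rhoPoint (piParam k) (piPoint k x)).qx i.succ 1 = _ :=
      congrArg (fun C : Cfg N F => C.q i.succ 1) h2
    have e2 : (piPoint k x).qx i.succ (-1) = _ :=
      congrArg (fun C : Cfg N F => C.q i.succ (-1)) (piPoint_cfg hL k hs hq)
    rw [e, Cfg.rev_q, Point.cfg_q, e2]
    simpa using hq i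
  have h3 := piPoint_cfg_equiv hL (rhoParam (piParam k)) hs2 hq2
  have h4 := rhoPoint_cfg hL (piParam (rhoParam (piParam k))) (x := piPoint (rhoParam (piParam k))
      (rhoPoint (piParam k) (piPoint k x))) hs2
  have h5 := (h1.rev.shift.rev).trans ((h2 ▸ h3).rev)
  rw [← h4] at h5
  have h6 : (x.cfg k).shift.rev.shift.rev = x.cfg k := by
    ext <;> simp
  rw [h6] at h5
  refine (Point.eq_of_cfg_equiv hL ?_ h5).symm
  funext i
  simp [rhoPoint, piPoint]

end Inverse

end HLN
end

noncomputable section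
namespace HLN
variable {L N : ℕ}

/-! ### The birational transformations -/

theorem gen_eq_pt : pt (AlgHom.id ℂ (RatField L N)) = gen L N :=
  Point.ext_coord fun c => by rw [pt, Point.map_coord]; rfl

theorem gen_s_ne_zero (i : Fin N) : (gen L N).s i ≠ 0 := var_ne_zero _

theorem gen_rRegular (hL : 2 ≤ L) (hN : 1 ≤ N) (k : Params L N) {n : ℕ} (hn : n < L) :
    rRegular n k (gen L N) := by
  rw [← gen_eq_pt]
  exact pt_rRegular hL hN _ k hn

theorem gen_piRegular (hL : 2 ≤ L) : piRegular (gen L N) := by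
  rw [← gen_eq_pt]
  exact pt_piRegular hL _

/-- The point of new variables of a birational transformation. -/
def ParamBirational.pt (T : ParamBirational L N) (k : Params L N) : Point L N (RatField L N) :=
  HLN.pt (T.field k : RatField L N →ₐ[ℂ] RatField L N)

theorem ParamBirational.pt_coord (T : ParamBirational L N) (k : Params L N) (c : Coord L N) :
    (T.pt k).coord c = T.field k (var c) := by
  rw [ParamBirational.pt, HLN.pt, Point.map_coord, gen_coord]
  rfl

theorem ParamBirational.actsBy_of_pt {T : ParamBirational L N}
    {τ : Params L N → Point L N (RatField L N) → Point L N (RatField L N)}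
    (h : ∀ k, T.pt k = τ k (gen L N)) : T.ActsBy τ := fun k => by
  rw [← h]
  exact ⟨fun i => (T.pt_coord k (.s i)).symm, fun i n => (T.pt_coord k (.q i n)).symm,
    fun i n => (T.pt_coord k (.p i n)).symm⟩

theorem exists_r [NeZero L] (hL : 2 ≤ L) (hN : 1 ≤ N) (n : ZMod L) (k : Params L N) :
    ∃ φ : RatField L N ≃ₐ[ℂ] RatField L N,
      pt (φ : RatField L N →ₐ[ℂ] RatField L N) = rPoint n.val k (gen L N) :=
  exists_algEquiv _ (adjoin_eq_top_of_inverse _ (fun x => rPoint n.val (rParam n k) x)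
    (fun φ x => rPoint_map φ _ _ x)
    (rPoint_rPoint hL n k gen_s_ne_zero (gen_rRegular hL hN k (ZMod.val_lt n))))

theorem exists_rho [NeZero L] (hL : 2 ≤ L) (k : Params L N) :
    ∃ φ : RatField L N ≃ₐ[ℂ] RatField L N,
      pt (φ : RatField L N →ₐ[ℂ] RatField L N) = rhoPoint k (gen L N) :=
  exists_algEquiv _ (adjoin_eq_top_of_inverse _ (fun x => rhoPoint (rhoParam k) x)
    (fun φ x => rhoPoint_map φ _ x) (rhoPoint_rhoPoint hL k gen_s_ne_zero))

theorem exists_pi [NeZero L] (hL : 2 ≤ L) (k : Params L N) :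
    ∃ φ : RatField L N ≃ₐ[ℂ] RatField L N,
      pt (φ : RatField L N →ₐ[ℂ] RatField L N) = piPoint k (gen L N) :=
  exists_algEquiv _ (adjoin_eq_top_of_inverse _
    (fun x => rhoPoint (piParam (rhoParam (piParam k))) (piPoint (rhoParam (piParam k))
      (rhoPoint (piParam k) x)))
    (fun φ x => by rw [rhoPoint_map, piPoint_map, rhoPoint_map])
    (rhoPoint_piPoint hL k gen_s_ne_zero (gen_piRegular hL)))

/-- The transformation `r_n`. -/
def rB [NeZero L] (hL : 2 ≤ L) (hN : 1 ≤ N) (n : ZMod L) : ParamBirational L N where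
  param := ⟨rParam n, rParam n, fun k => rParam_rParam hL k n, fun k => rParam_rParam hL k n⟩
  field k := (exists_r hL hN n k).choose

/-- The transformation `ρ`. -/
def rhoB (N : ℕ) [NeZero L] (hL : 2 ≤ L) : ParamBirational L N where
  param := ⟨rhoParam, rhoParam, rhoParam_rhoParam, rhoParam_rhoParam⟩
  field k := (exists_rho hL k).choose

/-- The transformation `π`. -/
def piB (N : ℕ) [NeZero L] (hL : 2 ≤ L) : ParamBirational L N where
  param := ⟨piParam, fun k => rhoParam (piParam (rhoParam k)), rhoParam_piParam, fun k => by
    rw [piParam_rhoParam, rhoParam_rhoParam]⟩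
  field k := (exists_pi hL k).choose

/-- The transformation `r_n'`. -/
def rB' [NeZero L] (hL : 2 ≤ L) (hN : 1 ≤ N) (n : ZMod L) : ParamBirational L N :=
  rhoB N hL * rB hL hN n * rhoB N hL

section

variable [NeZero L] (hL : 2 ≤ L) (hN : 1 ≤ N)

theorem rB_pt (n : ZMod L) (k : Params L N) :
    (rB hL hN n).pt k = rPoint n.val k (gen L N) := (exists_r hL hN n k).choose_spec

theorem rhoB_pt (k : Params L N) : (rhoB N hL).pt k = rhoPoint k (gen L N) :=
  (exists_rho hL k).choose_spec

theorem piB_pt (k : Params L N) : (piB N hL).pt k = piPoint k (gen L N) :=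
  (exists_pi hL k).choose_spec

end

namespace ParamBirational

theorem mul_param (T S : ParamBirational L N) (k : Params L N) :
    (T * S).param k = S.param (T.param k) := rfl

theorem mul_field (T S : ParamBirational L N) (k : Params L N) (f : RatField L N) :
    (T * S).field k f = T.field k (S.field (T.param k) f) := rfl

theorem mul_pt (T S : ParamBirational L N) (k : Params L N) : (T * S).pt k =
    (S.pt (T.param k)).map ((T.field k : RatField L N →ₐ[ℂ] RatField L N) :
      RatField L N →+* RatField L N) :=
  Point.ext_coord fun c => by
    rw [Point.map_coord, pt_coord, pt_coord]
    rfl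

theorem pt_one (k : Params L N) : (1 : ParamBirational L N).pt k = gen L N := gen_eq_pt

theorem pt_eq_map (T : ParamBirational L N) (k : Params L N) : T.pt k =
    (gen L N).map ((T.field k : RatField L N →ₐ[ℂ] RatField L N) :
      RatField L N →+* RatField L N) := rfl

theorem pt_s_ne_zero (T : ParamBirational L N) (k : Params L N) (i : Fin N) : (T.pt k).s i ≠ 0 :=
  HLN.pt_s_ne_zero _ i

theorem ext_pt {T S : ParamBirational L N} (h1 : ∀ k, T.param k = S.param k)
    (h2 : ∀ k, T.pt k = S.pt k) : T = S := by
  apply ParamBirational.ext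
  · exact _root_.Equiv.ext h1
  · funext k
    apply AlgEquiv.coe_toAlgHom_injective
    exact algHom_ext_pt (h2 k)

/-- The homogeneous coordinates of the new variables. -/
def cf (T : ParamBirational L N) (k : Params L N) : Cfg N (RatField L N) :=
  (T.pt k).cfg (T.param k)

/-- All relations are checked through this criterion: agreement on the parameters, on s, and on
homogeneous coordinates up to the torus. -/
theorem ext_cf (hL : 2 ≤ L) {T S : ParamBirational L N} (h1 : ∀ k, T.param k = S.param k)
    (h2 : ∀ k, (T.pt k).s = (S.pt k).s) (h3 : ∀ k, (T.cf k).Equiv (S.cf k)) : T = S :=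
  ext_pt h1 fun k => Point.eq_of_cfg_equiv hL (h2 k) (h3 k)

theorem cf_one (k : Params L N) : (1 : ParamBirational L N).cf k = (gen L N).cfg k := by
  rw [cf, pt_one]
  rfl

theorem cf_admissible (hL : 2 ≤ L) (T : ParamBirational L N) (k : Params L N) :
    (T.cf k).Admissible (T.param k) (T.pt k).sx :=
  Point.cfg_admissible hL _ (T.pt_s_ne_zero k)

theorem cf_D_ne_zero (hL : 2 ≤ L) (hN : 1 ≤ N) (T : ParamBirational L N) (k : Params L N) (m : ℤ) :
    (T.cf k).D m ≠ 0 := by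
  have : NeZero L := ⟨by omega⟩
  have h := (pt_rRegular hL hN (T.field k : RatField L N →ₐ[ℂ] RatField L N) (T.param k)
    (ZMod.val_lt (m : ZMod L))).1
  rw [(T.cf_admissible hL k).pairing_eq (Point.sx_ne_zero (T.pt_s_ne_zero k))
    (n := ((m : ZMod L).val : ℤ)) (by simp)]
  exact h

section

variable [NeZero L] (hL : 2 ≤ L) (hN : 1 ≤ N) (T : ParamBirational L N) (k : Params L N)

/-- Multiplying by a generator on the right applies its formula to the point already reached, with
the parameters already reached. Products are thus computed from left to right. -/
theorem mul_rB_pt (n : ZMod L) :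
    (T * rB hL hN n).pt k = rPoint n.val (T.param k) (T.pt k) := by
  rw [mul_pt, rB_pt, ← rPoint_map]
  rfl

theorem mul_rhoB_pt : (T * rhoB N hL).pt k = rhoPoint (T.param k) (T.pt k) := by
  rw [mul_pt, rhoB_pt, ← rhoPoint_map]
  rfl

theorem mul_piB_pt : (T * piB N hL).pt k = piPoint (T.param k) (T.pt k) := by
  rw [mul_pt, piB_pt, ← piPoint_map]
  rfl

theorem mul_rB_cf (n : ZMod L) :
    ((T.cf k).r n (algebraMap ℂ _ ((T.param k).a n.val))).Equiv ((T * rB hL hN n).cf k) := by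
  rw [cf, cf, mul_rB_pt]
  exact rPoint_cfg_equiv hL n (T.param k) (T.pt_s_ne_zero k)
    (pt_rRegular hL hN _ _ (ZMod.val_lt n))

theorem mul_rhoB_cf : (T * rhoB N hL).cf k = (T.cf k).rev := by
  rw [cf, cf, mul_rhoB_pt]
  exact rhoPoint_cfg hL (T.param k) (T.pt_s_ne_zero k)

theorem mul_piB_cf : (T.cf k).shift.Equiv ((T * piB N hL).cf k) := by
  rw [cf, cf, mul_piB_pt]
  exact piPoint_cfg_equiv hL (T.param k) (T.pt_s_ne_zero k) (pt_piRegular hL _)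

theorem mul_rB_s (n : ZMod L) : ((T * rB hL hN n).pt k).s = (T.pt k).s := by
  rw [mul_rB_pt, rPoint_s]

theorem mul_piB_s : ((T * piB N hL).pt k).s = (T.pt k).s := by
  rw [mul_piB_pt]
  rfl

theorem mul_rhoB_s : ((T * rhoB N hL).pt k).s = fun i => 1 / (T.pt k).s i := by
  rw [mul_rhoB_pt]
  rfl

end

end ParamBirational

/-! ### The relations in the group of parameter-dependent birational transformations. -/

section Relations

open ParamBirational

variable [NeZero L] (hL : 2 ≤ L) (hN : 1 ≤ N)

theorem rB_sq (n : ZMod L) : rB hL hN n * rB hL hN n = 1 := by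
  refine ext_pt (fun k => rParam_rParam hL k n) fun k => ?_
  rw [mul_rB_pt, rB_pt, pt_one]
  exact rPoint_rPoint hL n k gen_s_ne_zero (gen_rRegular hL hN k (ZMod.val_lt n))

theorem rhoB_sq : rhoB N hL * rhoB N hL = 1 := by
  refine ext_pt (fun k => rhoParam_rhoParam k) fun k => ?_
  rw [mul_rhoB_pt, rhoB_pt, pt_one]
  exact rhoPoint_rhoPoint hL k gen_s_ne_zero

theorem cf_rB (n : ZMod L) (k : Params L N) :
    (((gen L N).cfg k).r n (algebraMap ℂ _ (k.a n.val))).Equiv ((rB hL hN n).cf k) := by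
  have h := mul_rB_cf hL hN 1 k n
  rwa [one_mul, cf_one] at h

theorem cf_piB (k : Params L N) : ((gen L N).cfg k).shift.Equiv ((piB N hL).cf k) := by
  have h := mul_piB_cf hL 1 k
  rwa [one_mul, cf_one] at h

theorem cf_rhoB (k : Params L N) : (rhoB N hL).cf k = ((gen L N).cfg k).rev := by
  have h := mul_rhoB_cf hL 1 k
  rwa [one_mul, cf_one] at h

theorem rB_s (n : ZMod L) (k : Params L N) : ((rB hL hN n).pt k).s = (gen L N).s := by
  rw [rB_pt, rPoint_s]

theorem piB_s (k : Params L N) : ((piB N hL).pt k).s = (gen L N).s := by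
  rw [piB_pt]
  rfl

theorem rhoB_s (k : Params L N) : ((rhoB N hL).pt k).s = fun i => 1 / (gen L N).s i := by
  rw [rhoB_pt]
  rfl

theorem piB_rB (n : ZMod L) : piB N hL * rB hL hN n = rB hL hN (n + 1) * piB N hL := by
  refine ext_cf hL (fun k => piParam_rParam k n) (fun k => ?_) (fun k => ?_)
  · rw [mul_rB_s, mul_piB_s, rB_s, piB_s]
  · have h1 := ((cf_piB hL k).r n _).trans (mul_rB_cf hL hN (piB N hL) k n)
    have h2 := ((cf_rB hL hN (n + 1) k).shift).trans (mul_piB_cf hL (rB hL hN (n + 1)) k)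
    have h3 : ((piB N hL).param k).a n.val = k.a (n + 1).val := by
      change (piParam k).a n.val = _
      rw [piParam_a, k.a_eq]
      simp
    rw [Cfg.shift_r, h3] at h1
    exact h1.symm.trans h2

theorem piB_rhoB_piB : piB N hL * rhoB N hL * piB N hL = rhoB N hL := by
  refine ext_cf hL (fun k => piParam_rhoParam k) (fun k => ?_) (fun k => ?_)
  · rw [mul_piB_s, mul_rhoB_s, rhoB_s, piB_s]
  · have h1 := mul_piB_cf hL (piB N hL * rhoB N hL) k
    rw [mul_rhoB_cf] at h1
    have h2 := (cf_piB hL k).rev.shift.trans h1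
    rw [cf_rhoB]
    have h3 : ((gen L N).cfg k).shift.rev.shift = ((gen L N).cfg k).rev := by
      ext <;> simp
    rw [h3] at h2
    exact h2.symm

theorem rB_braid (h3 : 3 ≤ L) (n : ZMod L) :
    rB hL hN n * rB hL hN (n + 1) * rB hL hN n =
      rB hL hN (n + 1) * rB hL hN n * rB hL hN (n + 1) := by
  refine ext_cf hL (fun k => (rParam_braid h3 k n).2.2.2.2) (fun k => ?_) (fun k => ?_)
  · simp only [mul_rB_s, rB_s]
  · obtain ⟨e1, e2, e3, e4, -⟩ := rParam_braid h3 k n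
    have h1 := ((((cf_rB hL hN n k).r (n + 1) _).trans (mul_rB_cf hL hN _ k (n + 1))).r n _).trans
      (mul_rB_cf hL hN _ k n)
    have h2 := ((((cf_rB hL hN (n + 1) k).r n _).trans (mul_rB_cf hL hN _ k n)).r (n + 1) _).trans
      (mul_rB_cf hL hN _ k (n + 1))
    change Cfg.Equiv ((Cfg.r (Cfg.r _ _ _) _ (algebraMap ℂ _ ((rParam n k).a (n + 1).val))).r n
      (algebraMap ℂ _ ((rParam (n + 1) (rParam n k)).a n.val))) _ at h1
    change Cfg.Equiv ((Cfg.r (Cfg.r _ _ _) _ (algebraMap ℂ _ ((rParam (n + 1) k).a n.val))).r (n + 1)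
      (algebraMap ℂ _ ((rParam n (rParam (n + 1) k)).a (n + 1).val))) _ at h2
    rw [e1, e2, map_add] at h1
    rw [e3, e4, map_add] at h2
    -- Nonvanishing of a pairing passes between equivalent configurations because D_m is only
    -- rescaled; it is known at generic points.
    have hD : ∀ (C C' : Cfg N (RatField L N)), C.Equiv C' → ∀ m, C'.D m ≠ 0 → C.D m ≠ 0 := by
      rintro C C' ⟨l, u, hl, hu, rfl⟩ m hm h0
      rw [Cfg.gauge_D hu, h0, mul_zero] at hm
      exact hm rfl
    have hb := Cfg.r_braid h3 ((gen L N).cfg k) n (algebraMap ℂ _ (k.a n.val))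
      (algebraMap ℂ _ (k.a (n + 1).val))
      (fun m _ => by rw [← cf_one]; exact cf_D_ne_zero hL hN _ _ _)
      (fun m _ => by rw [← cf_one]; exact cf_D_ne_zero hL hN _ _ _)
      (fun m _ => hD _ _ (cf_rB hL hN n k) m (cf_D_ne_zero hL hN _ _ _))
      (fun m _ => hD _ _ (cf_rB hL hN (n + 1) k) m (cf_D_ne_zero hL hN _ _ _))
    rw [hb] at h1
    exact h1.symm.trans h2

theorem rB_comm_far {l n : ZMod L} (h0 : l ≠ n) (h1 : n ≠ l + 1) (h2 : l ≠ n + 1) :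
    rB hL hN n * rB hL hN l = rB hL hN l * rB hL hN n := by
  refine ext_cf hL (fun k => rParam_comm_far k h0 h1 h2) (fun k => ?_) (fun k => ?_)
  · simp only [mul_rB_s, rB_s]
  · have e1 := ((cf_rB hL hN n k).r l _).trans (mul_rB_cf hL hN _ k l)
    have e2 := ((cf_rB hL hN l k).r n _).trans (mul_rB_cf hL hN _ k n)
    change Cfg.Equiv (Cfg.r (Cfg.r _ _ _) _ (algebraMap ℂ _ ((rParam n k).a l.val))) _ at e1
    change Cfg.Equiv (Cfg.r (Cfg.r _ _ _) _ (algebraMap ℂ _ ((rParam l k).a n.val))) _ at e2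
    rw [rParam_a_far k h0 h1 h2, Cfg.r_comm_far hL _ _ _ h0 h1 h2] at e1
    rw [rParam_a_far k h0.symm h2 h1] at e2
    exact e1.symm.trans e2

theorem mul_rB'_cf (T : ParamBirational L N) (n : ZMod L) (k : Params L N) :
    ((T.cf k).r' (-n) (algebraMap ℂ _ ((T.param k).b n.val))).Equiv ((T * rB' hL hN n).cf k) := by
  rw [rB', ← mul_assoc, ← mul_assoc, mul_rhoB_cf]
  have h := (mul_rB_cf hL hN (T * rhoB N hL) k n).rev
  change Cfg.Equiv (Cfg.rev (Cfg.r _ _ (algebraMap ℂ _ ((rhoParam (T.param k)).a n.val)))) _ at h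
  rwa [rhoParam_a, mul_rhoB_cf, Cfg.rev_r_rev] at h

theorem mul_rB'_s (T : ParamBirational L N) (n : ZMod L) (k : Params L N) :
    ((T * rB' hL hN n).pt k).s = (T.pt k).s := by
  rw [rB', ← mul_assoc, ← mul_assoc, mul_rhoB_s, mul_rB_s, mul_rhoB_s]
  simp

theorem rB_rB'_comm (m n : ZMod L) : rB hL hN m * rB' hL hN n = rB' hL hN n * rB hL hN m := by
  have hs1 : ∀ k, ((rB' hL hN n).pt k).s = (gen L N).s := fun k => by
    have h := mul_rB'_s hL hN 1 n k
    rwa [one_mul, pt_one] at h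
  have hc1 : ∀ k : Params L N, (((gen L N).cfg k).r' (-n) (algebraMap ℂ _ (k.b n.val))).Equiv
      ((rB' hL hN n).cf k) := fun k => by
    have h := mul_rB'_cf hL hN 1 n k
    rwa [one_mul, cf_one] at h
  refine ext_cf hL (fun k => rParam_rParam'_comm k m n) (fun k => ?_) (fun k => ?_)
  · rw [mul_rB'_s, mul_rB_s, hs1, rB_s]
  · have hr' : ∀ (C C' : Cfg N (RatField L N)), C.Equiv C' → ∀ b,
        (C.r' (-n) b).Equiv (C'.r' (-n) b) := fun C C' h b => by
      rw [← Cfg.rev_r_rev, ← Cfg.rev_r_rev]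
      exact (h.rev.r n b).rev
    have e1 := (hr' _ _ (cf_rB hL hN m k) _).trans (mul_rB'_cf hL hN _ n k)
    have e2 := ((hc1 k).r m _).trans (mul_rB_cf hL hN _ k m)
    change Cfg.Equiv (Cfg.r' _ _ (algebraMap ℂ _ ((rParam m k).b n.val))) _ at e1
    change Cfg.Equiv (Cfg.r _ _ (algebraMap ℂ _ ((rParam' n k).a m.val))) _ at e2
    rw [rParam_b] at e1
    rw [rParam'_a] at e2
    refine e1.symm.trans (Cfg.Equiv.trans ?_ e2)
    by_cases h : -n = m + 1
    · rw [h]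
      rw [h] at hc1
      have hD : ∀ (C C' : Cfg N (RatField L N)), C.Equiv C' → ∀ m, C'.D m ≠ 0 → C.D m ≠ 0 := by
        rintro C C' ⟨l, u, hl, hu, rfl⟩ m hm h0
        rw [Cfg.gauge_D hu, h0, mul_zero] at hm
        exact hm rfl
      have hadm := Point.cfg_admissible hL k (x := gen L N) gen_s_ne_zero
      refine Cfg.r_r'_comm_equiv hL _ m _ _
        (fun l _ => by rw [← cf_one]; exact cf_D_ne_zero hL hN _ _ _)
        (fun l _ => ?_)
        (fun l _ => hD _ _ (hc1 k) l (cf_D_ne_zero hL hN _ _ _)) (fun l hl => ?_)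
      · have h5 := cf_D_ne_zero hL hN (rhoB N hL) k (-l)
        rw [cf_rhoB] at h5
        have h6 : ((gen L N).cfg k).rev.D (-l) = ((gen L N).cfg k).D' l := by
          simp [Cfg.D, Cfg.D', show -(-l + 1) = l - 1 by ring]
        rwa [h6] at h5
      -- In the case −n = m + 1 the roots 𝔟_n and 𝔞_m have the same e-part, so 𝔟_n − 𝔞_m = κ_m −
      -- κ_{m+1}: the hypothesis of `Cfg.r_r'_comm_equiv`.
      · rw [hadm.sum_left, hadm.sum_left, ← map_sub, ← map_sub]
        congr 1
        have hn : ((-(l + 1) : ℤ) : ZMod L) = n := by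
          push_cast
          rw [hl, ← h, neg_neg]
        rw [k.a_eq hl, k.b_eq hn]
        have h7 := k.b_add (-(l + 1) - L)
        rw [sub_add_cancel] at h7
        have h8 := k.e_add (l + 1)
        have h9 := k.e_add l
        have h10 := k.κ_add (l + 1)
        have h11 := k.κ_add l
        rw [Params.b, Params.a, show (L : ℤ) - -(l + 1) = l + 1 + L by ring,
          show l + 1 + (L : ℤ) - 1 = l + L by ring, h8, h9, h10, h11]
        ring
    · rw [Cfg.r_r'_comm_of_ne hL _ _ _ h]
      exact Cfg.Equiv.refl _

/-- Purely group-theoretic: πρπ = ρ says that conjugation by ρ inverts π, so conjugating the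
relation between π and r_n reverses the direction of the index shift. -/
theorem piB_rB' (n : ZMod L) : piB N hL * rB' hL hN n = rB' hL hN (n - 1) * piB N hL := by
  have h1 := piB_rhoB_piB (N := N) hL
  have h2 := piB_rB hL hN (n - 1)
  rw [sub_add_cancel] at h2
  have h3 : piB N hL * rhoB N hL = rhoB N hL * (piB N hL)⁻¹ := eq_mul_inv_of_mul_eq h1
  have h4 : (piB N hL)⁻¹ * rB hL hN n = rB hL hN (n - 1) * (piB N hL)⁻¹ := by
    rw [inv_mul_eq_iff_eq_mul, ← mul_assoc, h2, mul_inv_cancel_right]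
  have h5 : (piB N hL)⁻¹ * rhoB N hL = rhoB N hL * piB N hL := by
    rw [inv_mul_eq_iff_eq_mul, ← mul_assoc, h1]
  calc piB N hL * rB' hL hN n = (piB N hL * rhoB N hL) * rB hL hN n * rhoB N hL := by
        simp only [rB', mul_assoc]
    _ = rhoB N hL * ((piB N hL)⁻¹ * rB hL hN n) * rhoB N hL := by rw [h3]; simp only [mul_assoc]
    _ = rhoB N hL * rB hL hN (n - 1) * ((piB N hL)⁻¹ * rhoB N hL) := by
        rw [h4]; simp only [mul_assoc]
    _ = rB' hL hN (n - 1) * piB N hL := by rw [h5]; simp only [rB', mul_assoc]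

theorem rhoB_rB (n : ZMod L) : rhoB N hL * rB hL hN n = rB' hL hN n * rhoB N hL := by
  rw [rB', mul_assoc _ (rhoB N hL), rhoB_sq, mul_one]

/-- Iterated shift of the indices. -/
@[simps]
def Cfg.shiftBy {F : Type*} (C : Cfg N F) (c : ℕ) : Cfg N F where
  q j m := C.q j (m + c)
  p j m := C.p j (m + c)

theorem piB_pow_aux (c : ℕ) (k : Params L N) :
    (((gen L N).cfg k).shiftBy c).Equiv ((piB N hL ^ c).cf k) ∧
      ((piB N hL ^ c).pt k).s = (gen L N).s ∧
      (∀ m, ((piB N hL ^ c).param k).e m = k.e (m + c) - c / (L : ℂ)) ∧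
      (∀ m, ((piB N hL ^ c).param k).κ m = k.κ (m + c)) ∧
      ((piB N hL ^ c).param k).θ = k.θ := by
  induction c with
  | zero =>
    rw [pow_zero, cf_one, pt_one]
    refine ⟨?_, rfl, fun m => ?_, fun m => ?_, rfl⟩
    · have : ((gen L N).cfg k).shiftBy 0 = (gen L N).cfg k := by ext <;> simp
      rw [this]
      exact Cfg.Equiv.refl _
    · change k.e m = _
      simp
    · change k.κ m = _
      simp
  | succ c ih =>
    obtain ⟨h1, h2, h3, h4, h5⟩ := ih
    rw [pow_succ]
    refine ⟨?_, by rw [mul_piB_s, h2], fun m => ?_, fun m => ?_, h5⟩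
    · have h6 := h1.shift.trans (mul_piB_cf hL _ k)
      have : (((gen L N).cfg k).shiftBy c).shift = ((gen L N).cfg k).shiftBy (c + 1) := by
        ext <;> simp <;> ring_nf
      rwa [this] at h6
    · change ((piB N hL ^ c).param k).e (m + 1) - 1 / (L : ℂ) = _
      rw [h3]
      push_cast
      ring_nf
    · change ((piB N hL ^ c).param k).κ (m + 1) = _
      rw [h4]
      push_cast
      ring_nf

/-- Shifting by L multiplies row j by s_j, which is a torus element. On the parameters, e_{n+L} =
e_n + 1 compensates the L subtractions of 1/L. -/
theorem piB_pow : piB N hL ^ L = 1 := by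
  have hL0 : (L : ℂ) ≠ 0 := Nat.cast_ne_zero.2 (NeZero.ne L)
  refine ext_cf hL (fun k => ?_) (fun k => ?_) (fun k => ?_) <;>
    obtain ⟨h1, h2, h3, h4, h5⟩ := piB_pow_aux (N := N) hL L k
  · refine Params.ext' (fun m => ?_) (fun m => ?_) h5
    · rw [h3, k.e_add, div_self hL0, add_sub_cancel_right]
      rfl
    · rw [h4, k.κ_add]
      rfl
  · rw [h2, pt_one]
  · refine h1.symm.trans ?_
    rw [cf_one]
    have hadm := Point.cfg_admissible hL k (x := gen L N) gen_s_ne_zero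
    have hs := Point.sx_ne_zero (x := gen L N) gen_s_ne_zero
    refine Cfg.Equiv.symm ⟨1, (gen L N).sx, by simp, hs, ?_⟩
    ext j m
    · simp only [Cfg.shiftBy_q, hadm.q_add, Cfg.gauge_q, Pi.one_apply, one_mul]
    · simp only [Cfg.shiftBy_p, hadm.p_add, Cfg.gauge_p, Pi.one_apply, one_mul]

theorem rB'_pt (n : ZMod L) (k : Params L N) :
    (rB' hL hN n).pt k = rPoint' n.val k (gen L N) := by
  rw [rB', mul_rhoB_pt, mul_rB_pt, rhoB_pt, rPoint'_eq hL _ (ZMod.val_lt n) k gen_s_ne_zero]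
  simp only [ZMod.natCast_val, ZMod.cast_id', id]
  rfl

theorem rB'_param_apply (n : ZMod L) (k : Params L N) : (rB' hL hN n).param k = rParam' n k := rfl

end Relations

end HLN
end

noncomputable section
namespace HLN
variable {L N : ℕ}

/-! ### The symplectic form on the extended phase space -/

/-- When the window moves, the pairs whose smaller index is w disappear, and pairs whose larger
index is w + M appear. -/
theorem sum_triangle_shift {R : Type*} [CommRing R] (f g : ℤ → R) (w : ℤ) (M : ℕ) :
    ∑ n ∈ Finset.range M, ∑ m ∈ Finset.range n, f (w + 1 + m) * g (w + 1 + n) =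
      ∑ n ∈ Finset.range M, ∑ m ∈ Finset.range n, f (w + m) * g (w + n)
        - f w * (∑ n ∈ Finset.range M, g (w + n) - g w)
        + (∑ n ∈ Finset.range M, f (w + n) - f w) * g (w + M) := by
  induction M with
  | zero => simp
  | succ M ih =>
    rw [Finset.sum_range_succ, ih, Finset.sum_range_succ _ M, Finset.sum_range_succ _ M,
      Finset.sum_range_succ _ M, ← Finset.sum_mul, ← Finset.sum_mul, sum_range_shift]
    rw [show w + ((M + 1 : ℕ) : ℤ) = w + 1 + M by push_cast; ring]
    ring

theorem sum_triangle_eq {R : Type*} [AddCommMonoid R] (F : ℕ → ℕ → R) (M : ℕ) :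
    ∑ n ∈ Finset.range M, ∑ m ∈ Finset.range n, F m n =
      ∑ n ∈ Finset.range M, ∑ m ∈ Finset.range M, if m < n then F m n else 0 := by
  refine Finset.sum_congr rfl fun n hn => ?_
  rw [← Finset.sum_filter]
  refine Finset.sum_congr ?_ fun _ _ => rfl
  ext m
  have := Finset.mem_range.1 hn
  simp only [Finset.mem_range, Finset.mem_filter]
  omega

/-- Reflection exchanges m < n with m > n; the two triangles and the diagonal fill the square. -/
theorem sum_triangle_reflect {R : Type*} [CommRing R] (f g : ℤ → R) (M : ℕ) :
    ∑ n ∈ Finset.range M, ∑ m ∈ Finset.range n, f (-m) * g (-n) +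
      ∑ n ∈ Finset.range M, ∑ m ∈ Finset.range n, f (1 - M + m) * g (1 - M + n) +
      ∑ n ∈ Finset.range M, f (1 - M + n) * g (1 - M + n) =
    (∑ n ∈ Finset.range M, f (1 - M + n)) * ∑ n ∈ Finset.range M, g (1 - M + n) := by
  rw [sum_triangle_eq, sum_triangle_eq, ← Finset.sum_range_reflect]
  have h1 : ∀ n ∈ Finset.range M, (∑ m ∈ Finset.range M, if m < M - 1 - n then
      f (-m) * g (-((M - 1 - n : ℕ) : ℤ)) else 0) =
      ∑ m ∈ Finset.range M, if n < m then f (1 - M + m) * g (1 - M + n) else 0 := by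
    intro n hn
    rw [← Finset.sum_range_reflect]
    refine Finset.sum_congr rfl fun m hm => ?_
    have := Finset.mem_range.1 hm
    have := Finset.mem_range.1 hn
    have e1 : -((M - 1 - m : ℕ) : ℤ) = 1 - M + m := by omega
    have e2 : -((M - 1 - n : ℕ) : ℤ) = 1 - M + n := by omega
    have e3 : M - 1 - m < M - 1 - n ↔ n < m := by omega
    simp only [e1, e2, e3]
  rw [Finset.sum_congr rfl h1, ← Finset.sum_add_distrib, ← Finset.sum_add_distrib, mul_comm,
    Finset.sum_mul]
  refine Finset.sum_congr rfl fun n hn => ?_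
  have h2 : f (1 - M + n) * g (1 - M + n) =
      ∑ m ∈ Finset.range M, if m = n then f (1 - M + m) * g (1 - M + n) else 0 := by
    rw [Finset.sum_ite_eq', if_pos hn]
  rw [h2, ← Finset.sum_add_distrib, ← Finset.sum_add_distrib, Finset.mul_sum]
  refine Finset.sum_congr rfl fun m hm => ?_
  rcases lt_trichotomy m n with h | h | h
  · simp [h, h.ne, h.not_gt]
    ring
  · simp [h]
    ring
  · simp [h, h.ne', h.not_gt]
    ring

section Form

variable {F : Type*} [Field F] [Algebra ℂ F]

/-- The value of `du ∧ dv` on two derivations. -/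
def wedge (X Y : Derivation ℂ F F) (u v : F) : F := X u * Y v - Y u * X v

/-- The function `s_i H_i` in homogeneous coordinates, with sums over the indices
`w, …, w + L - 1`. -/
def Cfg.ham (L : ℕ) (w : ℤ) (e : ℤ → ℂ) (s : Fin (N + 1) → F) (C : Cfg N F) (i : Fin (N + 1)) : F :=
  ∑ n ∈ Finset.range L, algebraMap ℂ F (e (w + n)) * (C.q i (w + n) * C.p i (w + n))
    + ∑ j, ∑ n ∈ Finset.range L, ∑ m ∈ Finset.range n,
        (C.q i (w + m) * C.p j (w + m)) * (C.q j (w + n) * C.p i (w + n))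
    + ∑ j ∈ Finset.univ.erase i, s j / (s i - s j) *
        ((∑ m ∈ Finset.range L, C.q i (w + m) * C.p j (w + m)) *
          ∑ n ∈ Finset.range L, C.q j (w + n) * C.p i (w + n))

/-- The symplectic form of the extended phase space in homogeneous coordinates. -/
def Cfg.form (L : ℕ) (w : ℤ) (e : ℤ → ℂ) (s : Fin (N + 1) → F) (C : Cfg N F)
    (X Y : Derivation ℂ F F) : F :=
  ∑ j, ∑ n ∈ Finset.range L, wedge X Y (C.p j (w + n)) (C.q j (w + n))
    - ∑ i, wedge X Y (C.ham L w e s i) (s i) / s i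

/-- The symplectic form of the extended phase space. -/
def stdForm (k : Params L N) (x : Point L N F) (X Y : Derivation ℂ F F) : F :=
  ∑ i, ∑ n, wedge X Y (x.p i n) (x.q i n) - ∑ i, wedge X Y (HLN.ham k x i) (x.s i)

/-- This is d(p/(lu)) ∧ d(luq) = dp ∧ dq + d(qp) ∧ (dl/l + du/u). -/
theorem wedge_gauge (X Y : Derivation ℂ F F) (p q : F) {l u : F} (hl : l ≠ 0) (hu : u ≠ 0) :
    wedge X Y (p / (l * u)) (l * u * q) = wedge X Y p q
      + (X (q * p) * (Y l / l) - Y (q * p) * (X l / l))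
      + (X (q * p) * (Y u / u) - Y (q * p) * (X u / u)) := by
  simp only [wedge, Derivation.leibniz, Derivation.leibniz_div, smul_eq_mul]
  field_simp
  ring

theorem Cfg.ham_gauge (w : ℤ) (e : ℤ → ℂ) (s : Fin (N + 1) → F) (C : Cfg N F) (i : Fin (N + 1))
    {l : ℤ → F} {u : Fin (N + 1) → F} (hl : ∀ n, l n ≠ 0) (hu : ∀ j, u j ≠ 0) :
    (C.gauge l u).ham L w e s i = C.ham L w e s i := by
  have h1 : ∀ i j n, (C.gauge l u).q i n * (C.gauge l u).p j n =
      u i / u j * (C.q i n * C.p j n) := fun i j n => by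
    have := hl n
    have := hu j
    simp only [Cfg.gauge_q, Cfg.gauge_p]
    field_simp
  have h2 : ∀ i j, u i / u j * (u j / u i) = 1 := fun i j => by
    have := hu i
    have := hu j
    field_simp
  simp only [Cfg.ham, h1, div_self (hu _), one_mul, ← Finset.mul_sum]
  simp only [mul_mul_mul_comm _ _ (u _ / u i), h2, one_mul]

theorem Cfg.Admissible.sum_right_window {C : Cfg N F} {k : Params L N} {s : Fin (N + 1) → F}
    (hC : C.Admissible k s) (hs : ∀ j, s j ≠ 0) (w : ℤ) (j : Fin (N + 1)) :
    ∑ n ∈ Finset.range L, C.q j (w + n) * C.p j (w + n) = algebraMap ℂ F (k.θ j) := by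
  have hper : ∀ n, C.q j (n + L) * C.p j (n + L) = C.q j n * C.p j n := fun n => by
    have := hs j
    rw [hC.q_add, hC.p_add]
    field_simp
  rw [← hC.sum_right j]
  induction w with
  | zero => simp
  | succ w ih =>
    have := sum_range_shift (L := L) (fun n => C.q j n * C.p j n) w
    rw [this, hper, ih]
    ring
  | pred w ih =>
    have := sum_range_shift (L := L) (fun n => C.q j n * C.p j n) (-w - 1)
    rw [hper, sub_add_cancel, ih] at this
    rw [this]
    ring

/-- After summation the extra terms of `wedge_gauge` are dκ_n ∧ dl_n/l_n and dθ_j ∧ du_j/u_j, which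
vanish because the moments are constants. -/
theorem Cfg.form_gauge {C : Cfg N F} {k : Params L N} {s : Fin (N + 1) → F}
    (hC : C.Admissible k s) (w : ℤ) (hs : ∀ j, s j ≠ 0) (e : ℤ → ℂ)
    {l : ℤ → F} {u : Fin (N + 1) → F} (hl : ∀ n, l n ≠ 0) (hu : ∀ j, u j ≠ 0)
    (X Y : Derivation ℂ F F) : (C.gauge l u).form L w e s X Y = C.form L w e s X Y := by
  have hR := hC.sum_right_window hs w
  have e1 : ∑ j, ∑ n ∈ Finset.range L, (X (C.q j (w + n) * C.p j (w + n)) * (Y (l (w + n)) / l (w + n))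
      - Y (C.q j (w + n) * C.p j (w + n)) * (X (l (w + n)) / l (w + n))) = 0 := by
    rw [Finset.sum_comm]
    refine Finset.sum_eq_zero fun n _ => ?_
    rw [Finset.sum_sub_distrib, ← Finset.sum_mul, ← Finset.sum_mul, ← map_sum, ← map_sum,
      hC.sum_left, Derivation.map_algebraMap, Derivation.map_algebraMap]
    ring
  have e2 : ∑ j, ∑ n ∈ Finset.range L, (X (C.q j (w + n) * C.p j (w + n)) * (Y (u j) / u j)
      - Y (C.q j (w + n) * C.p j (w + n)) * (X (u j) / u j)) = 0 := by
    refine Finset.sum_eq_zero fun j _ => ?_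
    rw [Finset.sum_sub_distrib, ← Finset.sum_mul, ← Finset.sum_mul, ← map_sum, ← map_sum,
      hR, Derivation.map_algebraMap, Derivation.map_algebraMap]
    ring
  simp only [Cfg.form, Cfg.ham_gauge w e s C _ hl hu, Cfg.gauge_q, Cfg.gauge_p,
    wedge_gauge X Y _ _ (hl _) (hu _), Finset.sum_add_distrib]
  rw [e1, e2, add_zero, add_zero]

/-- The gain q_w p_w comes from e_{w+L} = e_w + 1. In the quadratic part the term j = i is
unchanged, and for j ≠ i the change of the ordered sum cancels that of the coupling term; this is
where the coefficient s_j/(s_i − s_j) matters. -/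
theorem Cfg.ham_shift {C : Cfg N F} {k : Params L N} {s : Fin (N + 1) → F}
    (hC : C.Admissible k s) (hs : ∀ j, s j ≠ 0) (hs' : ∀ i j, i ≠ j → s i ≠ s j) (w : ℤ)
    (i : Fin (N + 1)) :
    C.ham L (w + 1) k.e s i = C.ham L w k.e s i + C.q i w * C.p i w := by
  have hper : ∀ i j n, C.q i (n + L) * C.p j (n + L) = s i / s j * (C.q i n * C.p j n) :=
    fun i j n => by
      have := hs j
      rw [hC.q_add, hC.p_add]
      field_simp
  have hA : ∀ i j, ∑ m ∈ Finset.range L, C.q i (w + 1 + m) * C.p j (w + 1 + m) =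
      ∑ m ∈ Finset.range L, C.q i (w + m) * C.p j (w + m)
        + (s i / s j - 1) * (C.q i w * C.p j w) := fun i j => by
    have h := sum_range_shift (L := L) (fun n => C.q i n * C.p j n) w
    rw [h, hper]
    ring
  have hT : ∀ j, ∑ n ∈ Finset.range L, ∑ m ∈ Finset.range n,
        (C.q i (w + 1 + m) * C.p j (w + 1 + m)) * (C.q j (w + 1 + n) * C.p i (w + 1 + n)) = _ :=
    fun j => sum_triangle_shift (fun n => C.q i n * C.p j n) (fun n => C.q j n * C.p i n) w L
  have hE : ∑ n ∈ Finset.range L, algebraMap ℂ F (k.e (w + 1 + n)) *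
      (C.q i (w + 1 + n) * C.p i (w + 1 + n)) =
      ∑ n ∈ Finset.range L, algebraMap ℂ F (k.e (w + n)) * (C.q i (w + n) * C.p i (w + n))
        + C.q i w * C.p i w := by
    have h := sum_range_shift (L := L) (fun n => algebraMap ℂ F (k.e n) * (C.q i n * C.p i n)) w
    have := hs i
    rw [h, hper, k.e_add, map_add, map_one, div_self this]
    ring
  have key : ∑ j, ∑ n ∈ Finset.range L, ∑ m ∈ Finset.range n,
        (C.q i (w + 1 + m) * C.p j (w + 1 + m)) * (C.q j (w + 1 + n) * C.p i (w + 1 + n))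
      + ∑ j ∈ Finset.univ.erase i, s j / (s i - s j) *
        ((∑ m ∈ Finset.range L, C.q i (w + 1 + m) * C.p j (w + 1 + m)) *
          ∑ n ∈ Finset.range L, C.q j (w + 1 + n) * C.p i (w + 1 + n)) =
      ∑ j, ∑ n ∈ Finset.range L, ∑ m ∈ Finset.range n,
        (C.q i (w + m) * C.p j (w + m)) * (C.q j (w + n) * C.p i (w + n))
      + ∑ j ∈ Finset.univ.erase i, s j / (s i - s j) *
        ((∑ m ∈ Finset.range L, C.q i (w + m) * C.p j (w + m)) *
          ∑ n ∈ Finset.range L, C.q j (w + n) * C.p i (w + n)) := by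
    rw [← Finset.add_sum_erase _ _ (Finset.mem_univ i), ← Finset.add_sum_erase Finset.univ
      (fun j => ∑ n ∈ Finset.range L, ∑ m ∈ Finset.range n,
        (C.q i (w + m) * C.p j (w + m)) * (C.q j (w + n) * C.p i (w + n))) (Finset.mem_univ i),
      add_assoc, add_assoc, ← Finset.sum_add_distrib, ← Finset.sum_add_distrib]
    congr 1
    · have := hs i
      rw [hT, hper, div_self this]
      ring
    · refine Finset.sum_congr rfl fun j hj => ?_
      have h1 := hs i
      have h2 := hs j
      have h3 : s i - s j ≠ 0 := sub_ne_zero.2 (hs' i j (Finset.ne_of_mem_erase hj).symm)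
      rw [hT, hA, hA, hper]
      generalize (∑ m ∈ Finset.range L, C.q i (w + m) * C.p j (w + m)) = A
      generalize (∑ m ∈ Finset.range L, C.q j (w + m) * C.p i (w + m)) = B
      field_simp
      ring
  rw [Cfg.ham, hE, add_assoc, key, Cfg.ham]
  ring

/-- Replacing the index w by w + L adds d(qp) ∧ ds_j/s_j to dp ∧ dq, exactly the contribution of the
extra term in `Cfg.ham_shift`. -/
theorem Cfg.form_shift {C : Cfg N F} {k : Params L N} {s : Fin (N + 1) → F}
    (hC : C.Admissible k s) (hs : ∀ j, s j ≠ 0) (hs' : ∀ i j, i ≠ j → s i ≠ s j) (w : ℤ)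
    (X Y : Derivation ℂ F F) : C.form L (w + 1) k.e s X Y = C.form L w k.e s X Y := by
  have h1 : ∀ j, ∑ n ∈ Finset.range L, wedge X Y (C.p j (w + 1 + n)) (C.q j (w + 1 + n)) =
      ∑ n ∈ Finset.range L, wedge X Y (C.p j (w + n)) (C.q j (w + n)) +
        wedge X Y (C.q j w * C.p j w) (s j) / s j := fun j => by
    have h := sum_range_shift (L := L) (fun n => wedge X Y (C.p j n) (C.q j n)) w
    have h2 := wedge_gauge X Y (C.p j w) (C.q j w) (hs j) one_ne_zero
    rw [mul_one] at h2
    have := hs j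
    rw [h, hC.q_add, hC.p_add, h2]
    simp only [wedge, Derivation.map_one_eq_zero]
    field_simp
    ring
  have h2 : ∀ j, wedge X Y (C.ham L (w + 1) k.e s j) (s j) / s j =
      wedge X Y (C.ham L w k.e s j) (s j) / s j +
        wedge X Y (C.q j w * C.p j w) (s j) / s j := fun j => by
    rw [Cfg.ham_shift hC hs hs']
    simp only [wedge, map_add]
    ring
  simp only [Cfg.form, h1, h2, Finset.sum_add_distrib]
  ring

theorem Cfg.form_window {C : Cfg N F} {k : Params L N} {s : Fin (N + 1) → F}
    (hC : C.Admissible k s) (hs : ∀ j, s j ≠ 0) (hs' : ∀ i j, i ≠ j → s i ≠ s j) (w : ℤ)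
    (X Y : Derivation ℂ F F) : C.form L w k.e s X Y = C.form L 0 k.e s X Y := by
  induction w with
  | zero => rfl
  | succ w ih => rw [Cfg.form_shift hC hs hs', ih]
  | pred w ih =>
    have h := Cfg.form_shift hC hs hs' (-w - 1) X Y
    rw [sub_add_cancel] at h
    rw [← h, ih]

/-! ### Invariance of the Hamiltonians and of the form under the reflections. -/

theorem sum_range_add_two {R : Type*} [AddCommMonoid R] (f : ℤ → R) (w : ℤ) (M : ℕ) :
    ∑ n ∈ Finset.range (M + 2), f (w + n) =
      f w + f (w + 1) + ∑ n ∈ Finset.range M, f (w + (n + 2)) := by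
  rw [Finset.sum_range_succ', Finset.sum_range_succ']
  push_cast
  simp only [add_assoc, zero_add, add_zero, one_add_one_eq_two]
  abel

theorem sum_range_of_eq_add_two {R : Type*} [AddCommMonoid R] (f : ℤ → R) (w : ℤ) {L M : ℕ}
    (h : L = M + 2) : ∑ n ∈ Finset.range L, f (w + n) =
      f w + f (w + 1) + ∑ n ∈ Finset.range M, f (w + (n + 2)) := by
  rw [h, sum_range_add_two]

theorem sum_triangle_add_two {R : Type*} [CommRing R] (f g : ℤ → R) (w : ℤ) (M : ℕ) :
    ∑ n ∈ Finset.range (M + 2), ∑ m ∈ Finset.range n, f (w + m) * g (w + n) =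
      f w * g (w + 1) + ∑ n ∈ Finset.range M, (f w + f (w + 1)) * g (w + (n + 2)) +
      ∑ n ∈ Finset.range M, ∑ m ∈ Finset.range n, f (w + (m + 2)) * g (w + (n + 2)) := by
  rw [Finset.sum_range_succ', Finset.sum_range_succ']
  have h : ∀ n : ℕ, ∑ m ∈ Finset.range (n + 1 + 1), f (w + m) * g (w + ((n + 1 + 1 : ℕ) : ℤ)) =
      (f w + f (w + 1)) * g (w + (n + 2)) +
        ∑ m ∈ Finset.range n, f (w + (m + 2)) * g (w + (n + 2)) := fun n => by
    rw [← Finset.sum_mul, sum_range_add_two, add_mul, Finset.sum_mul]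
    push_cast
    simp only [add_assoc, one_add_one_eq_two]
  simp only [h, Finset.sum_add_distrib]
  simp
  ring

theorem intCast_add_two_ne (hL : 2 ≤ L) (w : ℤ) {n : ℕ} (hn : n + 2 < L) :
    ((w + (n + 2) : ℤ) : ZMod L) ≠ w ∧ ((w + (n + 2) : ℤ) : ZMod L) ≠ w + 1 := by
  constructor
  · intro h
    have h1 : (((n + 2 : ℕ) : ℤ) : ZMod L) = ((0 : ℕ) : ℤ) := by
      push_cast at h ⊢
      simpa using h
    rw [Int.cast_natCast, Int.cast_natCast, ZMod.natCast_eq_natCast_iff', Nat.mod_eq_of_lt hn] at h1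
    simp at h1
  · intro h
    have h1 : (((n + 2 : ℕ) : ℤ) : ZMod L) = ((1 : ℕ) : ℤ) := by
      push_cast at h ⊢
      simpa using h
    rw [Int.cast_natCast, Int.cast_natCast, ZMod.natCast_eq_natCast_iff', Nat.mod_eq_of_lt hn,
      Nat.mod_eq_of_lt (by omega)] at h1
    omega

section

variable (hL : 2 ≤ L) (C : Cfg N F) (w : ℤ) (a : F) (j : Fin (N + 1))

theorem Cfg.r_q_window : (C.r (w : ZMod L) a).q j w = C.q j w + a / C.D w * C.q j (w + 1) := by
  simp

include hL in
theorem Cfg.r_q_window_one : (C.r (w : ZMod L) a).q j (w + 1) = C.q j (w + 1) := by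
  have : Fact (1 < L) := ⟨by omega⟩
  simp

include hL in
theorem Cfg.r_p_window : (C.r (w : ZMod L) a).p j w = C.p j w := by
  have : Fact (1 < L) := ⟨by omega⟩
  simp

theorem Cfg.r_p_window_one :
    (C.r (w : ZMod L) a).p j (w + 1) = C.p j (w + 1) - a / C.D w * C.p j w := by
  simp

include hL in
theorem Cfg.r_q_window_add_two {n : ℕ} (hn : n + 2 < L) :
    (C.r (w : ZMod L) a).q j (w + (n + 2)) = C.q j (w + (n + 2)) := by
  rw [Cfg.r_q, if_neg (intCast_add_two_ne hL w hn).1, add_zero]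

include hL in
theorem Cfg.r_p_window_add_two {n : ℕ} (hn : n + 2 < L) :
    (C.r (w : ZMod L) a).p j (w + (n + 2)) = C.p j (w + (n + 2)) := by
  rw [Cfg.r_p, if_neg (intCast_add_two_ne hL w hn).2, sub_zero]

end

/-- The window is started at w ≡ n, so that only its first two indices are affected. Let Δ be the
difference of the new values of q_{w+1}p_{w+1} and the old ones of q_wp_w, in row i. The ordered sum
for j changes by (a/D)·Δ·q_{w+1}^{(j)}p_w^{(j)}, in total by aΔ, and exchanging e_w with e_{w+1}
contributes −aΔ. -/
theorem Cfg.ham_r (hL : 2 ≤ L) (C : Cfg N F) (k : Params L N) (s : Fin (N + 1) → F) (w : ℤ)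
    {e' : ℤ → ℂ} (he0 : e' w = k.e (w + 1)) (he1 : e' (w + 1) = k.e w)
    (he : ∀ n : ℕ, n + 2 < L → e' (w + (n + 2)) = k.e (w + (n + 2)))
    (hD : C.D w ≠ 0) (i : Fin (N + 1)) :
    (C.r (w : ZMod L) (algebraMap ℂ F (k.a w))).ham L w e' s i = C.ham L w k.e s i := by
  have ha : algebraMap ℂ F (k.a w) = algebraMap ℂ F (k.e (w + 1)) - algebraMap ℂ F (k.e w) := by
    rw [Params.a, map_sub]
  set a := algebraMap ℂ F (k.a w) with ha'
  set B : Cfg N F := C.r (w : ZMod L) a with hB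
  have hlt : ∀ {M : ℕ}, L = M + 2 → ∀ n ∈ Finset.range M, n + 2 < L := fun h n hn => by
    have := Finset.mem_range.1 hn
    omega
  obtain ⟨M, hM⟩ : ∃ M, L = M + 2 := ⟨L - 2, by omega⟩
  have q0 := C.r_q_window (L := L) w a
  have q1 := C.r_q_window_one hL w a
  have q2 := fun j n hn => C.r_q_window_add_two hL w a j (hlt hM n hn)
  have p0 := C.r_p_window hL w a
  have p1 := C.r_p_window_one (L := L) w a
  have p2 := fun j n hn => C.r_p_window_add_two hL w a j (hlt hM n hn)
  rw [← hB] at q0 q1 q2 p0 p1 p2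
  have hS : ∀ i j, ∑ n ∈ Finset.range L, B.q i (w + n) * B.p j (w + n) =
      ∑ n ∈ Finset.range L, C.q i (w + n) * C.p j (w + n) := fun i j => by
    rw [hM, sum_range_add_two (fun n => B.q i n * B.p j n),
      sum_range_add_two (fun n => C.q i n * C.p j n),
      Finset.sum_congr rfl fun n hn => by rw [q2 i n hn, p2 j n hn], q0, q1, p0, p1]
    ring
  have hT : ∀ j, ∑ n ∈ Finset.range L, ∑ m ∈ Finset.range n,
      (B.q i (w + m) * B.p j (w + m)) * (B.q j (w + n) * B.p i (w + n)) =
      ∑ n ∈ Finset.range L, ∑ m ∈ Finset.range n,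
      (C.q i (w + m) * C.p j (w + m)) * (C.q j (w + n) * C.p i (w + n)) +
      a / C.D w * (C.q i (w + 1) * C.p i (w + 1) - C.q i w * C.p i w
        - a / C.D w * (C.q i (w + 1) * C.p i w)) * (C.q j (w + 1) * C.p j w) := fun j => by
    rw [hM, sum_triangle_add_two (fun n => B.q i n * B.p j n) (fun n => B.q j n * B.p i n),
      sum_triangle_add_two (fun n => C.q i n * C.p j n) (fun n => C.q j n * C.p i n)]
    have e1 : ∑ n ∈ Finset.range M, (B.q i w * B.p j w + B.q i (w + 1) * B.p j (w + 1)) *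
        (B.q j (w + (n + 2)) * B.p i (w + (n + 2))) =
        ∑ n ∈ Finset.range M, (C.q i w * C.p j w + C.q i (w + 1) * C.p j (w + 1)) *
        (C.q j (w + (n + 2)) * C.p i (w + (n + 2))) := by
      refine Finset.sum_congr rfl fun n hn => ?_
      rw [q2 j n hn, p2 i n hn, q0, q1, p0, p1]
      ring
    have e2 : ∑ n ∈ Finset.range M, ∑ m ∈ Finset.range n,
        (B.q i (w + (m + 2)) * B.p j (w + (m + 2))) * (B.q j (w + (n + 2)) * B.p i (w + (n + 2))) =
        ∑ n ∈ Finset.range M, ∑ m ∈ Finset.range n,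
        (C.q i (w + (m + 2)) * C.p j (w + (m + 2))) *
          (C.q j (w + (n + 2)) * C.p i (w + (n + 2))) := by
      refine Finset.sum_congr rfl fun n hn => Finset.sum_congr rfl fun m hm => ?_
      have hm' : m ∈ Finset.range M :=
        Finset.mem_range.2 ((Finset.mem_range.1 hm).trans (Finset.mem_range.1 hn))
      rw [q2 j n hn, p2 i n hn, q2 i m hm', p2 j m hm']
    rw [e1, e2, q0, q1, p0, p1]
    ring
  have hE : ∑ n ∈ Finset.range L, algebraMap ℂ F (e' (w + n)) * (B.q i (w + n) * B.p i (w + n)) =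
      ∑ n ∈ Finset.range L, algebraMap ℂ F (k.e (w + n)) * (C.q i (w + n) * C.p i (w + n)) -
      a * (C.q i (w + 1) * C.p i (w + 1) - C.q i w * C.p i w
        - a / C.D w * (C.q i (w + 1) * C.p i w)) := by
    rw [sum_range_of_eq_add_two (fun n => algebraMap ℂ F (e' n) * (B.q i n * B.p i n)) w hM,
      sum_range_of_eq_add_two (fun n => algebraMap ℂ F (k.e n) * (C.q i n * C.p i n)) w hM,
      Finset.sum_congr rfl fun n hn => by rw [q2 i n hn, p2 i n hn, he n (hlt hM n hn)],
      q0, q1, p0, p1, he0, he1, ha]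
    ring
  have hD' : ∑ j, a / C.D w * (C.q i (w + 1) * C.p i (w + 1) - C.q i w * C.p i w
        - a / C.D w * (C.q i (w + 1) * C.p i w)) * (C.q j (w + 1) * C.p j w) =
      a * (C.q i (w + 1) * C.p i (w + 1) - C.q i w * C.p i w
        - a / C.D w * (C.q i (w + 1) * C.p i w)) := by
    rw [← Finset.mul_sum]
    change _ * C.D w = _
    field_simp
  simp only [Cfg.ham, hS, hT, hE, Finset.sum_add_distrib, hD']
  ring

theorem wedge_algebraMap_div_self (X Y : Derivation ℂ F F) (a : ℂ) {D : F} (hD : D ≠ 0) :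
    wedge X Y D (algebraMap ℂ F a / D) = 0 := by
  simp only [wedge, Derivation.leibniz_div, Derivation.map_algebraMap, smul_eq_mul]
  ring

/-- The Hamiltonians are unchanged, and ∑ dp ∧ dq changes by ∑_j d(q_{w+1}p_w) ∧ d(a/D) = dD ∧
d(a/D) = 0. -/
theorem Cfg.form_r (hL : 2 ≤ L) (C : Cfg N F) (k : Params L N) (s : Fin (N + 1) → F) (w : ℤ)
    {e' : ℤ → ℂ} (he0 : e' w = k.e (w + 1)) (he1 : e' (w + 1) = k.e w)
    (he : ∀ n : ℕ, n + 2 < L → e' (w + (n + 2)) = k.e (w + (n + 2)))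
    (hD : C.D w ≠ 0) (X Y : Derivation ℂ F F) :
    (C.r (w : ZMod L) (algebraMap ℂ F (k.a w))).form L w e' s X Y = C.form L w k.e s X Y := by
  have h1 : ∀ j, ∑ n ∈ Finset.range L, wedge X Y
      ((C.r (w : ZMod L) (algebraMap ℂ F (k.a w))).p j (w + n))
      ((C.r (w : ZMod L) (algebraMap ℂ F (k.a w))).q j (w + n)) =
      ∑ n ∈ Finset.range L, wedge X Y (C.p j (w + n)) (C.q j (w + n)) +
        wedge X Y (C.q j (w + 1) * C.p j w) (algebraMap ℂ F (k.a w) / C.D w) := fun j => by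
    have hlt : ∀ {M : ℕ}, L = M + 2 → ∀ n ∈ Finset.range M, n + 2 < L := fun h n hn => by
      have := Finset.mem_range.1 hn
      omega
    obtain ⟨M, hM⟩ : ∃ M, L = M + 2 := ⟨L - 2, by omega⟩
    rw [sum_range_of_eq_add_two (fun n => wedge X Y
        ((C.r (w : ZMod L) (algebraMap ℂ F (k.a w))).p j n)
        ((C.r (w : ZMod L) (algebraMap ℂ F (k.a w))).q j n)) w hM,
      sum_range_of_eq_add_two (fun n => wedge X Y (C.p j n) (C.q j n)) w hM,
      Finset.sum_congr rfl fun n hn => by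
      rw [C.r_q_window_add_two hL w _ j (hlt hM n hn), C.r_p_window_add_two hL w _ j (hlt hM n hn)],
      C.r_q_window, C.r_q_window_one hL, C.r_p_window hL, C.r_p_window_one]
    generalize algebraMap ℂ F (k.a w) / C.D w = c
    simp only [wedge, map_add, map_sub, Derivation.leibniz, smul_eq_mul]
    ring
  have h2 : ∑ j, wedge X Y (C.q j (w + 1) * C.p j w) (algebraMap ℂ F (k.a w) / C.D w) = 0 := by
    rw [← wedge_algebraMap_div_self X Y (k.a w) hD]
    simp only [wedge, Cfg.D, map_sum, Finset.sum_mul, Finset.sum_sub_distrib]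
  simp only [Cfg.form, h1, Finset.sum_add_distrib, h2, add_zero, Cfg.ham_r hL C k s w he0 he1 he hD]

theorem wedge_algebraMap_left (X Y : Derivation ℂ F F) (c : ℂ) (v : F) :
    wedge X Y (algebraMap ℂ F c) v = 0 := by
  simp [wedge]

theorem wedge_add_left (X Y : Derivation ℂ F F) (u u' v : F) :
    wedge X Y (u + u') v = wedge X Y u v + wedge X Y u' v := by
  simp only [wedge, map_add]
  ring

/-! ### Invariance of the form under shift and reversal. -/

theorem Cfg.form_shift_index {C : Cfg N F} {k : Params L N} {s : Fin (N + 1) → F}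
    (hC : C.Admissible k s) (hs : ∀ j, s j ≠ 0) {e' : ℤ → ℂ} (t : ℂ)
    (he : ∀ m, e' m = k.e (m + 1) + t) (X Y : Derivation ℂ F F) :
    C.shift.form L 0 e' s X Y = C.form L 1 k.e s X Y := by
  -- Adding a constant t to every e_n changes the Hamiltonian by the constant tθ_i, which the form
  -- does not see.
  have h : ∀ i, C.shift.ham L 0 e' s i = C.ham L 1 k.e s i + algebraMap ℂ F (t * k.θ i) := by
    intro i
    rw [map_mul, ← hC.sum_right_window hs 1 i, Finset.mul_sum]
    simp only [Cfg.ham, Cfg.shift_q, Cfg.shift_p, zero_add, he, map_add, add_mul,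
      Finset.sum_add_distrib, add_comm (1 : ℤ)]
    ring
  simp only [Cfg.form, h, wedge_add_left, wedge_algebraMap_left, add_zero, Cfg.shift_q,
    Cfg.shift_p, zero_add, add_comm (1 : ℤ)]

/-- Reversal replaces each ordered sum by the square minus the ordered sum minus the diagonal. The
diagonals add up to κ-terms, absorbed by e' = κ − e + t. The squares with j ≠ i cancel because
s_j⁻¹/(s_i⁻¹ − s_j⁻¹) = −1 − s_j/(s_i − s_j); the square with j = i leaves θ_i². -/
theorem Cfg.ham_rev {C : Cfg N F} {k : Params L N} {s : Fin (N + 1) → F}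
    (hC : C.Admissible k s) (hs : ∀ j, s j ≠ 0) (hs' : ∀ i j, i ≠ j → s i ≠ s j) {e' : ℤ → ℂ}
    (t : ℂ) (he : ∀ m, e' (-m) = k.κ m - k.e m + t) (i : Fin (N + 1)) :
    C.rev.ham L 0 e' (fun j => (s j)⁻¹) i =
      -C.ham L (1 - L) k.e s i + algebraMap ℂ F (t * k.θ i + k.θ i * k.θ i) := by
  have hw : ∀ f : ℤ → F, ∑ n ∈ Finset.range L, f (-n) = ∑ n ∈ Finset.range L, f (1 - L + n) :=
    fun f => by simpa using sum_range_reflect_int (L := L) f 0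
  have hT : ∀ j, ∑ n ∈ Finset.range L, ∑ m ∈ Finset.range n,
      (C.q i (-m) * C.p j (-m)) * (C.q j (-n) * C.p i (-n)) =
      (∑ n ∈ Finset.range L, C.q i (1 - L + n) * C.p j (1 - L + n)) *
        (∑ n ∈ Finset.range L, C.q j (1 - L + n) * C.p i (1 - L + n)) -
      ∑ n ∈ Finset.range L, ∑ m ∈ Finset.range n, (C.q i (1 - L + m) * C.p j (1 - L + m)) *
        (C.q j (1 - L + n) * C.p i (1 - L + n)) -
      ∑ n ∈ Finset.range L, (C.q i (1 - L + n) * C.p i (1 - L + n)) *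
        (C.q j (1 - L + n) * C.p j (1 - L + n)) := fun j => by
    rw [← sum_triangle_reflect (fun n => C.q i n * C.p j n) (fun n => C.q j n * C.p i n) L]
    simp only [mul_mul_mul_comm (C.q i _) (C.p j _), mul_comm (C.p j _) (C.p i _)]
    simp only [mul_mul_mul_comm (C.q i _) (C.q j _)]
    ring
  have hκ : ∑ j, ∑ n ∈ Finset.range L, (C.q i (1 - L + n) * C.p i (1 - L + n)) *
        (C.q j (1 - L + n) * C.p j (1 - L + n)) = ∑ n ∈ Finset.range L,
        algebraMap ℂ F (k.κ (1 - L + n)) * (C.q i (1 - L + n) * C.p i (1 - L + n)) := by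
    rw [Finset.sum_comm]
    refine Finset.sum_congr rfl fun n _ => ?_
    rw [← Finset.mul_sum, hC.sum_left, mul_comm]
  have hE : ∑ n ∈ Finset.range L, algebraMap ℂ F (e' (-(-n))) * (C.q i (-n) * C.p i (-n)) =
      ∑ n ∈ Finset.range L,
        algebraMap ℂ F (k.κ (1 - L + n)) * (C.q i (1 - L + n) * C.p i (1 - L + n)) -
      ∑ n ∈ Finset.range L,
        algebraMap ℂ F (k.e (1 - L + n)) * (C.q i (1 - L + n) * C.p i (1 - L + n)) +
      algebraMap ℂ F (t * k.θ i) := by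
    rw [hw (fun n => algebraMap ℂ F (e' (-n)) * (C.q i n * C.p i n)), map_mul,
      ← hC.sum_right_window hs (1 - L) i, Finset.mul_sum, ← Finset.sum_sub_distrib,
      ← Finset.sum_add_distrib]
    refine Finset.sum_congr rfl fun n _ => ?_
    rw [he, map_add, map_sub]
    ring
  have hV : ∑ j ∈ Finset.univ.erase i, (s j)⁻¹ / ((s i)⁻¹ - (s j)⁻¹) *
      ((∑ n ∈ Finset.range L, C.q i (-n) * C.p j (-n)) *
        (∑ n ∈ Finset.range L, C.q j (-n) * C.p i (-n))) =
      -∑ j ∈ Finset.univ.erase i, ((∑ n ∈ Finset.range L, C.q i (1 - L + n) * C.p j (1 - L + n)) *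
        (∑ n ∈ Finset.range L, C.q j (1 - L + n) * C.p i (1 - L + n))) -
      ∑ j ∈ Finset.univ.erase i, s j / (s i - s j) *
        ((∑ n ∈ Finset.range L, C.q i (1 - L + n) * C.p j (1 - L + n)) *
        (∑ n ∈ Finset.range L, C.q j (1 - L + n) * C.p i (1 - L + n))) := by
    rw [← Finset.sum_neg_distrib, ← Finset.sum_sub_distrib]
    refine Finset.sum_congr rfl fun j hj => ?_
    have h1 := hs i
    have h2 := hs j
    have h3 : s i - s j ≠ 0 := sub_ne_zero.2 (hs' i j (Finset.ne_of_mem_erase hj).symm)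
    have h4 : (s i)⁻¹ - (s j)⁻¹ = -(s i - s j) / (s i * s j) := by
      field_simp
      ring
    rw [h4, hw (fun n => C.q i n * C.p j n), hw (fun n => C.q j n * C.p i n)]
    field_simp
    ring
  simp only [Cfg.ham, Cfg.rev_q, Cfg.rev_p, zero_add, hT, Finset.sum_sub_distrib, hκ, hV]
  simp only [neg_neg] at hE
  rw [hE, ← Finset.add_sum_erase _ (fun j => (∑ n ∈ Finset.range L,
    C.q i (1 - L + n) * C.p j (1 - L + n)) * (∑ n ∈ Finset.range L,
      C.q j (1 - L + n) * C.p i (1 - L + n))) (Finset.mem_univ i), hC.sum_right_window hs]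
  simp only [map_add, map_mul]
  ring

/-- The sign in `Cfg.ham_rev` is compensated by d(s⁻¹)/s⁻¹ = −ds/s, and the additive constants drop
out. -/
theorem Cfg.form_rev {C : Cfg N F} {k : Params L N} {s : Fin (N + 1) → F}
    (hC : C.Admissible k s) (hs : ∀ j, s j ≠ 0) (hs' : ∀ i j, i ≠ j → s i ≠ s j) {e' : ℤ → ℂ}
    (t : ℂ) (he : ∀ m, e' (-m) = k.κ m - k.e m + t) (X Y : Derivation ℂ F F) :
    C.rev.form L 0 e' (fun j => (s j)⁻¹) X Y = C.form L (1 - L) k.e s X Y := by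
  have h1 : ∀ j, ∑ n ∈ Finset.range L, wedge X Y (C.p j (-n)) (C.q j (-n)) =
      ∑ n ∈ Finset.range L, wedge X Y (C.p j (1 - L + n)) (C.q j (1 - L + n)) := fun j => by
    simpa using sum_range_reflect_int (L := L) (fun n => wedge X Y (C.p j n) (C.q j n)) 0
  have h2 : ∀ i, wedge X Y (-C.ham L (1 - L) k.e s i) (s i)⁻¹ / (s i)⁻¹ =
      wedge X Y (C.ham L (1 - L) k.e s i) (s i) / s i := fun i => by
    have := hs i
    simp only [wedge, map_neg, Derivation.leibniz_inv, smul_eq_mul]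
    field_simp
  simp only [Cfg.form, Cfg.ham_rev hC hs hs' t he, wedge_add_left, wedge_algebraMap_left,
    add_zero, h2, Cfg.rev_q, Cfg.rev_p, zero_add, h1]

theorem ham_eq_cfg_ham (k : Params L N) (x : Point L N F) (i : Fin N) :
    HLN.ham k x i = (x.s i)⁻¹ * (x.cfg k).ham L 0 k.e x.sx i.succ := by
  have h : ∀ j, ∑ m ∈ Finset.range L, ∑ n ∈ Finset.range L,
      x.qx i.succ m * x.px k j m * x.qx j n * x.px k i.succ n =
      (∑ m ∈ Finset.range L, x.qx i.succ m * x.px k j m) *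
        ∑ n ∈ Finset.range L, x.qx j n * x.px k i.succ n := fun j => by
    rw [Finset.sum_mul_sum]
    simp only [mul_assoc]
  simp only [HLN.ham, Cfg.ham, Point.cfg_q, Point.cfg_p, zero_add, h, Point.sx_succ]
  simp only [mul_assoc]

/-- The row j = 0 and the index n = 0 contribute nothing, their q being constant; the factor s_i⁻¹
in H_i may be taken out because it is killed by the wedge with ds_i. -/
theorem stdForm_eq (hL : 2 ≤ L) (k : Params L N) {x : Point L N F} (hs : ∀ i, x.s i ≠ 0)
    (X Y : Derivation ℂ F F) :
    stdForm k x X Y = (x.cfg k).form L 0 k.e x.sx X Y := by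
  have h1 : ∀ i : Fin N, wedge X Y (HLN.ham k x i) (x.s i) =
      wedge X Y ((x.cfg k).ham L 0 k.e x.sx i.succ) (x.s i) / x.s i := fun i => by
    have := hs i
    rw [ham_eq_cfg_ham]
    simp only [wedge, Derivation.leibniz, Derivation.leibniz_inv, smul_eq_mul]
    field_simp
    ring
  have h2 : ∀ u, wedge X Y u 1 = 0 := fun u => by simp [wedge]
  have h3 : ∀ i : Fin N, ∑ n ∈ Finset.range L, wedge X Y (x.px k i.succ n) (x.qx i.succ n) =
      ∑ n, wedge X Y (x.p i n) (x.q i n) := fun i => by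
    obtain ⟨M, rfl⟩ : ∃ M, L = M + 1 := ⟨L - 1, by omega⟩
    rw [Finset.sum_range_succ']
    simp only [Nat.cast_zero, Point.qx_zero, h2, add_zero]
    rw [← Fin.sum_univ_eq_sum_range
      (fun n => wedge X Y (x.px k i.succ (n + 1 : ℕ)) (x.qx i.succ (n + 1 : ℕ)))]
    refine Finset.sum_congr rfl fun n _ => ?_
    have e1 := Point.qx_fin hL x i n
    have e2 := Point.px_fin hL k x i n
    push_cast
    rw [← e1, ← e2]
  rw [stdForm, Cfg.form, Fin.sum_univ_succ, Fin.sum_univ_succ]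
  simp only [Point.cfg_q, Point.cfg_p, zero_add, Point.qx_zero_left, h2, Point.sx_zero,
    Point.sx_succ, zero_div, Finset.sum_const_zero, h1, h3]

end Form

end HLN
end

noncomputable section
namespace HLN
variable {L N : ℕ}

/-! ### Canonical transformations and invariance of the system -/

section Conj

variable {F : Type*} [Field F] [Algebra ℂ F]

/-- The conjugate of a derivation by an automorphism. -/
def conjDerivation (φ : F ≃ₐ[ℂ] F) (X : Derivation ℂ F F) : Derivation ℂ F F :=
  Derivation.mk' (φ.toLinearMap ∘ₗ X.toLinearMap ∘ₗ φ.symm.toLinearMap) fun f g => by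
    simp

@[simp]
theorem conjDerivation_apply (φ : F ≃ₐ[ℂ] F) (X : Derivation ℂ F F) (f : F) :
    conjDerivation φ X f = φ (X (φ.symm f)) := rfl

theorem conjDerivation_symm (φ : F ≃ₐ[ℂ] F) (X : Derivation ℂ F F) :
    conjDerivation φ (conjDerivation φ.symm X) = X := by
  ext f
  simp

theorem wedge_conj (φ : F ≃ₐ[ℂ] F) (X Y : Derivation ℂ F F) (u v : F) :
    wedge (conjDerivation φ X) (conjDerivation φ Y) (φ u) (φ v) = φ (wedge X Y u v) := by
  simp [wedge]

theorem stdForm_conj (φ : F ≃ₐ[ℂ] F) (k : Params L N) (x : Point L N F) (X Y : Derivation ℂ F F) :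
    stdForm k (x.map ((φ : F →ₐ[ℂ] F) : F →+* F)) (conjDerivation φ X) (conjDerivation φ Y) =
      φ (stdForm k x X Y) := by
  have h : ∀ i, HLN.ham k (x.map ((φ : F →ₐ[ℂ] F) : F →+* F)) i = φ (HLN.ham k x i) := fun i => by
    simp only [HLN.ham, Point.qx_map, Point.px_map, Point.sx_map, Point.map_s]
    simp
  simp only [stdForm, h, Point.map_s, Point.map_q, Point.map_p, map_sub, map_sum, ← wedge_conj]
  rfl

theorem stdForm_sub_left (k : Params L N) (x : Point L N F) (X X' Y : Derivation ℂ F F) :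
    stdForm k x (X - X') Y = stdForm k x X Y - stdForm k x X' Y := by
  have h : ∀ u v, wedge (X - X') Y u v = wedge X Y u v - wedge X' Y u v := fun u v => by
    simp only [wedge, Derivation.sub_apply]
    ring
  simp only [stdForm, h, Finset.sum_sub_distrib]
  ring

theorem stdForm_add_left (k : Params L N) (x : Point L N F) (X X' Y : Derivation ℂ F F) :
    stdForm k x (X + X') Y = stdForm k x X Y + stdForm k x X' Y := by
  have h : ∀ u v, wedge (X + X') Y u v = wedge X Y u v + wedge X' Y u v := fun u v => by
    simp only [wedge, Derivation.add_apply]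
    ring
  simp only [stdForm, h, Finset.sum_add_distrib]
  ring

theorem stdForm_smul_left (k : Params L N) (x : Point L N F) (c : F) (X Y : Derivation ℂ F F) :
    stdForm k x (c • X) Y = c * stdForm k x X Y := by
  have h : ∀ u v, wedge (c • X) Y u v = c * wedge X Y u v := fun u v => by
    simp only [wedge, Derivation.smul_apply, smul_eq_mul]
    ring
  simp only [stdForm, h, ← Finset.mul_sum, mul_sub]

theorem stdForm_sum_left {ι : Type*} (s : Finset ι) (k : Params L N) (x : Point L N F)
    (X : ι → Derivation ℂ F F) (Y : Derivation ℂ F F) :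
    stdForm k x (∑ l ∈ s, X l) Y = ∑ l ∈ s, stdForm k x (X l) Y := by
  classical
  induction s using Finset.induction_on with
  | empty => simp [stdForm, wedge]
  | insert l s hl ih => rw [Finset.sum_insert hl, Finset.sum_insert hl, stdForm_add_left, ih]

end Conj

open Classical in
theorem pd_var (c c' : Coord L N) : pd c (var c') = if c' = c then 1 else 0 := by
  split_ifs with h
  · rw [h, pd_var_self]
  · exact pd_var_of_ne h

theorem derivation_apply_eq (Y : Derivation ℂ (RatField L N) (RatField L N)) (f : RatField L N) :
    Y f = ∑ i, Y (var (.s i)) * pd (.s i) f + ∑ i, ∑ n,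
      (Y (var (.q i n)) * pd (.q i n) f + Y (var (.p i n)) * pd (.p i n) f) := by
  classical
  have h : Y = ∑ i, Y (var (.s i)) • pd (.s i) + ∑ i, ∑ n,
      (Y (var (.q i n)) • pd (.q i n) + Y (var (.p i n)) • pd (.p i n)) := by
    refine derivation_ext fun c => ?_
    cases c <;>
      simp [derivation_sum_apply, pd_var, ite_and]
  conv_lhs => rw [h]
  simp [derivation_sum_apply]

/-- The Hamiltonian vector field of `f`. -/
def hamField (f : RatField L N) : Derivation ℂ (RatField L N) (RatField L N) :=
  ∑ i, ∑ n, (pd (.p i n) f • pd (.q i n) - pd (.q i n) f • pd (.p i n))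

theorem hamField_apply (f g : RatField L N) : hamField f g = poisson f g := by
  simp [hamField, poisson, derivation_sum_apply]

theorem hamField_s (f : RatField L N) (i : Fin N) : hamField f (var (.s i)) = 0 := by
  rw [hamField_apply, poisson]
  simp [pd_var_of_ne]

theorem hamField_q (f : RatField L N) (i : Fin N) (n : Fin (L - 1)) :
    hamField f (var (.q i n)) = pd (.p i n) f := by
  classical
  rw [hamField_apply, poisson]
  simp [pd_var, ite_and]

theorem hamField_p (f : RatField L N) (i : Fin N) (n : Fin (L - 1)) :
    hamField f (var (.p i n)) = -pd (.q i n) f := by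
  classical
  rw [hamField_apply, poisson]
  simp [pd_var, ite_and]

theorem hamField_zero : hamField (0 : RatField L N) = 0 := by
  simp [hamField]

theorem flow_eq (k : Params L N) (j : Fin N) :
    flow k j = pd (.s j) + hamField (HLN.ham k (gen L N) j) := rfl

theorem stdForm_hamField (k : Params L N) (f : RatField L N)
    {Y : Derivation ℂ (RatField L N) (RatField L N)} (hY : ∀ i, Y (var (.s i)) = 0) :
    stdForm k (gen L N) (hamField f) Y = -Y f := by
  rw [derivation_apply_eq Y f]
  simp only [stdForm, wedge, gen_s, gen_q, gen_p, hamField_s, hamField_q, hamField_p, hY]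
  simp only [mul_zero, zero_mul, sub_zero, Finset.sum_const_zero, zero_add,
    ← Finset.sum_neg_distrib]
  refine Finset.sum_congr rfl fun i _ => Finset.sum_congr rfl fun n _ => ?_
  ring

/-- Nondegeneracy along the fibres: testing against ∂/∂p and ∂/∂q recovers all components of X. -/
theorem eq_hamField {k : Params L N} {f : RatField L N}
    {X : Derivation ℂ (RatField L N) (RatField L N)} (hX : ∀ i, X (var (.s i)) = 0)
    (h : ∀ Y : Derivation ℂ (RatField L N) (RatField L N), (∀ i, Y (var (.s i)) = 0) →
      stdForm k (gen L N) X Y = -Y f) : X = hamField f := by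
  classical
  refine derivation_ext fun c => ?_
  cases c with
  | s i => rw [hX, hamField_s]
  | q i n =>
    have h1 := h (pd (.p i n)) fun i => pd_var_of_ne (by simp)
    simp only [stdForm, wedge, gen_s, gen_q, gen_p, hX, pd_var] at h1
    rw [hamField_q]
    simpa [ite_and] using h1
  | p i n =>
    have h1 := h (pd (.q i n)) fun i => pd_var_of_ne (by simp)
    simp only [stdForm, wedge, gen_s, gen_q, gen_p, hX, pd_var] at h1
    rw [hamField_p]
    simpa [ite_and] using h1

theorem flow_s (k : Params L N) (j i : Fin N) : flow k j (var (.s i)) = if i = j then 1 else 0 := by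
  classical
  rw [flow_eq, Derivation.add_apply, hamField_s, pd_var]
  simp

/-- The term dH_j ∧ ds_j contributes YH_j for ∂/∂s_j, and the Hamiltonian field contributes −YH_j.
This orthogonality to the fibres, together with the images of the s_i, characterizes the flow. -/
theorem stdForm_flow (k : Params L N) (j : Fin N)
    {Y : Derivation ℂ (RatField L N) (RatField L N)} (hY : ∀ i, Y (var (.s i)) = 0) :
    stdForm k (gen L N) (flow k j) Y = 0 := by
  classical
  rw [flow_eq, stdForm_add_left, stdForm_hamField k _ hY]
  simp [stdForm, wedge, gen_s, gen_q, gen_p, pd_var, hY]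

namespace ParamBirational

/-- The transformation preserves the symplectic forms of the extended phase space. -/
def PreservesForm (T : ParamBirational L N) : Prop :=
  ∀ k X Y, stdForm (T.param k) (T.pt k) X Y = stdForm k (gen L N) X Y

/-- The transformation maps fibres over the space of independent variables to fibres. -/
def PreservesFibres (T : ParamBirational L N) : Prop :=
  ∀ k (X : Derivation ℂ (RatField L N) (RatField L N)) i,
    X (T.field k (var (.s i))) = 0 ↔ X (var (.s i)) = 0

theorem PreservesFibres.conj {T : ParamBirational L N} (h : T.PreservesFibres) (k : Params L N)
    {X : Derivation ℂ (RatField L N) (RatField L N)} (hX : ∀ i, X (var (.s i)) = 0) (i : Fin N) :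
    conjDerivation (T.field k) X (var (.s i)) = 0 := by
  rw [← h k]
  simp [hX]

theorem PreservesFibres.conj_symm {T : ParamBirational L N} (h : T.PreservesFibres)
    (k : Params L N) {X : Derivation ℂ (RatField L N) (RatField L N)}
    (hX : ∀ i, X (var (.s i)) = 0) (i : Fin N) :
    conjDerivation (T.field k).symm X (var (.s i)) = 0 := by
  have h1 := (h k X i).2 (hX i)
  simp [h1]

theorem PreservesForm.stdForm_conj {T : ParamBirational L N} (h : T.PreservesForm) (k : Params L N)
    (X Y : Derivation ℂ (RatField L N) (RatField L N)) :
    stdForm k (gen L N) (conjDerivation (T.field k) X) Y =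
      T.field k (stdForm (T.param k) (gen L N) X (conjDerivation (T.field k).symm Y)) := by
  rw [← h k, pt_eq_map, ← HLN.stdForm_conj, conjDerivation_symm]

/-- The conjugate of the Hamiltonian field of f satisfies the equations characterizing the
Hamiltonian field of the image of f. -/
theorem PreservesForm.isCanonical {T : ParamBirational L N} (h : T.PreservesForm)
    (hT : T.PreservesFibres) : T.IsCanonical := by
  intro k f g
  have h1 : conjDerivation (T.field k) (hamField f) = hamField (T.field k f) := by
    refine eq_hamField (k := k) (hT.conj k (hamField_s f)) fun Y hY => ?_
    rw [h.stdForm_conj, stdForm_hamField _ _ (hT.conj_symm k hY)]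
    simp
  rw [← hamField_apply, ← h1, conjDerivation_apply, AlgEquiv.symm_apply_apply, hamField_apply]

/-- The difference of the old flow and the combination of transported new flows is tangent to the
fibres and orthogonal to them for the form; by `eq_hamField` it is the Hamiltonian field of 0. -/
theorem PreservesForm.isInvariant {T : ParamBirational L N} (h : T.PreservesForm)
    (hT : T.PreservesFibres) : T.IsInvariant := by
  intro k j f
  have h1 : flow k j - ∑ l, flow k j (T.field k (var (.s l))) •
      conjDerivation (T.field k) (flow (T.param k) l) = hamField (0 : RatField L N) := by
    refine eq_hamField (k := k) (fun i => ?_) fun Y hY => ?_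
    · rw [← hT k, Derivation.sub_apply, derivation_sum_apply]
      simp [flow_s]
    · rw [stdForm_sub_left, stdForm_flow k j hY, stdForm_sum_left]
      simp only [stdForm_smul_left, h.stdForm_conj, stdForm_flow _ _ (hT.conj_symm k hY)]
      simp
  rw [hamField_zero, sub_eq_zero] at h1
  refine (congrArg (fun X : Derivation ℂ (RatField L N) (RatField L N) => X (T.field k f))
    h1).trans ((derivation_sum_apply _ _ _).trans (Finset.sum_congr rfl fun l _ => ?_))
  rw [Derivation.smul_apply, conjDerivation_apply, AlgEquiv.symm_apply_apply, smul_eq_mul]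

theorem IsCanonical.mul {T S : ParamBirational L N} (hT : T.IsCanonical) (hS : S.IsCanonical) :
    (T * S).IsCanonical := fun k f g => by
  simp only [mul_field, hT k, hS (T.param k)]

theorem IsInvariant.mul {T S : ParamBirational L N} (hT : T.IsInvariant) (hS : S.IsInvariant) :
    (T * S).IsInvariant := fun k j f => by
  simp only [mul_field, mul_param]
  rw [hT k j]
  simp only [fun l => hS (T.param k) l f, map_sum, map_mul, Finset.mul_sum]
  rw [Finset.sum_comm]
  refine Finset.sum_congr rfl fun m _ => ?_
  rw [hT k j (S.field (T.param k) (var (.s m))), Finset.sum_mul]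
  exact Finset.sum_congr rfl fun l _ => (mul_assoc _ _ _).symm

theorem PreservesFibres.of_pt {T : ParamBirational L N} (h : ∀ k, (T.pt k).s = (gen L N).s) :
    T.PreservesFibres := fun k X i => by
  have h1 := T.pt_coord k (.s i)
  rw [← h1]
  change X ((T.pt k).s i) = 0 ↔ _
  rw [h k]
  rfl

theorem PreservesFibres.of_pt_inv {T : ParamBirational L N}
    (h : ∀ k, (T.pt k).s = fun i => 1 / (gen L N).s i) : T.PreservesFibres := fun k X i => by
  have h1 := T.pt_coord k (.s i)
  rw [← h1]
  change X ((T.pt k).s i) = 0 ↔ _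
  have h2 : var (.s i) ≠ (0 : RatField L N) := var_ne_zero _
  rw [h k]
  change X (1 / var (.s i)) = 0 ↔ _
  rw [one_div, Derivation.leibniz_inv]
  simp [h2]

end ParamBirational

theorem gen_sx_injective {i j : Fin (N + 1)} (h : i ≠ j) : (gen L N).sx i ≠ (gen L N).sx j := by
  refine Fin.cases (fun h => ?_) (fun i h => ?_) i h
  · refine Fin.cases (fun h => absurd rfl h) (fun j _ => ?_) j h
    rw [Point.sx_zero, Point.sx_succ]
    exact (var_ne_one _).symm
  · refine Fin.cases (fun _ => ?_) (fun j h => ?_) j h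
    · rw [Point.sx_zero, Point.sx_succ]
      exact var_ne_one _
    · rw [Point.sx_succ, Point.sx_succ, gen_s, gen_s, Ne, var_injective.eq_iff]
      simpa using h

section

variable [NeZero L] (hL : 2 ≤ L) (hN : 1 ≤ N)

include hL in
theorem rParam_e_swap (k : Params L N) (n : ZMod L) :
    (rParam n k).e n.val = k.e (n.val + 1) ∧ (rParam n k).e (n.val + 1) = k.e n.val ∧
      ∀ m : ℕ, m + 2 < L → (rParam n k).e (n.val + (m + 2)) = k.e (n.val + (m + 2)) := by
  have : Fact (1 < L) := ⟨by omega⟩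
  refine ⟨?_, ?_, fun m hm => ?_⟩
  · simp [rParam, Params.a]
  · simp [rParam, Params.a]
  · obtain ⟨h1, h2⟩ := intCast_add_two_ne hL n.val hm
    rw [Int.cast_natCast, ZMod.natCast_zmod_val] at h1 h2
    simp only [rParam, if_neg h1, if_neg h2, add_zero, sub_zero]

theorem rB_preservesForm (n : ZMod L) : (rB hL hN n).PreservesForm := by
  intro k X Y
  have hs0 := gen_s_ne_zero (L := L) (N := N)
  have hs := Point.sx_ne_zero hs0
  have hC := Point.cfg_admissible hL k hs0
  have hr := gen_rRegular hL hN k (ZMod.val_lt n)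
  have hD : ((gen L N).cfg k).D n.val ≠ 0 := hr.1
  have hCr := hC.r hL hs n hD
  obtain ⟨l, u, hl, hu, hlu⟩ := rPoint_cfg_equiv hL n k hs0 hr
  obtain ⟨e0, e1, e2⟩ := rParam_e_swap hL k n
  -- `Cfg.form_r` needs the window to start at n, whereas the standard form uses the window at 0;
  -- `Cfg.form_window` is applied before and after.
  have h3 := Cfg.form_r hL ((gen L N).cfg k) k (gen L N).sx n.val e0 e1 e2 hD X Y
  rw [Int.cast_natCast, ZMod.natCast_zmod_val] at h3
  change stdForm (rParam n k) _ X Y = _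
  rw [rB_pt, stdForm_eq hL _ (by rw [rPoint_s]; exact hs0), rPoint_sx, hlu,
    Cfg.form_gauge hCr 0 hs _ hl hu, ← Cfg.form_window hCr hs (fun i j => gen_sx_injective) n.val,
    h3, Cfg.form_window hC hs (fun i j => gen_sx_injective), stdForm_eq hL _ hs0]

theorem piB_preservesForm : (piB N hL).PreservesForm := by
  intro k X Y
  have hs0 := gen_s_ne_zero (L := L) (N := N)
  have hs := Point.sx_ne_zero hs0
  have hC := Point.cfg_admissible hL k hs0
  obtain ⟨l, u, hl, hu, hlu⟩ := piPoint_cfg_equiv hL k hs0 (gen_piRegular hL)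
  change stdForm (piParam k) _ X Y = _
  rw [piB_pt, stdForm_eq hL (piParam k) (x := piPoint k (gen L N)) hs0, hlu]
  change Cfg.form L 0 _ (gen L N).sx _ X Y = _
  rw [Cfg.form_gauge (hC.shift hs) 0 hs _ hl hu, Cfg.form_shift_index (e' := (piParam k).e) hC hs (-(1 / (L : ℂ))) (fun m => sub_eq_add_neg _ _),
    Cfg.form_window hC hs (fun i j => gen_sx_injective), stdForm_eq hL _ hs0]

theorem rhoB_preservesForm : (rhoB N hL).PreservesForm := by
  intro k X Y
  have hs0 := gen_s_ne_zero (L := L) (N := N)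
  have hs := Point.sx_ne_zero hs0
  have hC := Point.cfg_admissible hL k hs0
  change stdForm (rhoParam k) _ X Y = _
  rw [rhoB_pt, stdForm_eq hL _ (fun i => by simpa [rhoPoint] using hs0 i), rhoPoint_cfg hL k hs0,
    rhoPoint_sx, Cfg.form_rev hC hs (fun i j => gen_sx_injective)
      (-(∑ i, k.θ i) / (L : ℂ)) (fun m => ?_),
    Cfg.form_window hC hs (fun i j => gen_sx_injective), stdForm_eq hL _ hs0]
  have h1 := k.e_add m
  have h2 := k.κ_add m
  simp only [rhoParam, sub_neg_eq_add, add_comm (L : ℤ), h1, h2]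
  ring

open ParamBirational

theorem rB_isCanonical (n : ZMod L) : (rB hL hN n).IsCanonical :=
  (rB_preservesForm hL hN n).isCanonical (.of_pt (rB_s hL hN n))

theorem rB_isInvariant (n : ZMod L) : (rB hL hN n).IsInvariant :=
  (rB_preservesForm hL hN n).isInvariant (.of_pt (rB_s hL hN n))

theorem piB_isCanonical : (piB N hL).IsCanonical :=
  (piB_preservesForm hL).isCanonical (.of_pt (piB_s hL))

theorem piB_isInvariant : (piB N hL).IsInvariant :=
  (piB_preservesForm hL).isInvariant (.of_pt (piB_s hL))

theorem rhoB_isCanonical : (rhoB N hL).IsCanonical :=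
  (rhoB_preservesForm hL).isCanonical (.of_pt_inv (rhoB_s hL))

theorem rhoB_isInvariant : (rhoB N hL).IsInvariant :=
  (rhoB_preservesForm hL).isInvariant (.of_pt_inv (rhoB_s hL))

theorem rB'_isCanonical (n : ZMod L) : (rB' hL hN n).IsCanonical :=
  ((rhoB_isCanonical hL).mul (rB_isCanonical hL hN n)).mul (rhoB_isCanonical hL)

theorem rB'_isInvariant (n : ZMod L) : (rB' hL hN n).IsInvariant :=
  ((rhoB_isInvariant hL).mul (rB_isInvariant hL hN n)).mul (rhoB_isInvariant hL)

end

end HLN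
end

noncomputable section
namespace HLN
variable {L N : ℕ}

/-! ### Values of rational functions -/

/-- The rational function `f` is regular at `v` with value `c`. -/
def Ev (v : Coord L N → ℂ) (f : RatField L N) (c : ℂ) : Prop :=
  ∃ a b : MvPolynomial (Coord L N) ℂ, MvPolynomial.eval v b ≠ 0 ∧
    f * algebraMap _ _ b = algebraMap _ _ a ∧ c * MvPolynomial.eval v b = MvPolynomial.eval v a

namespace Ev

variable {v : Coord L N → ℂ} {f g : RatField L N} {c d : ℂ}

theorem var (v : Coord L N → ℂ) (i : Coord L N) : Ev v (HLN.var i) (v i) :=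
  ⟨MvPolynomial.X i, 1, by simp, by simp [HLN.var], by simp⟩

theorem const (v : Coord L N → ℂ) (c : ℂ) : Ev v (algebraMap ℂ _ c) c :=
  ⟨MvPolynomial.C c, 1, by simp, by
    rw [map_one, mul_one, IsScalarTower.algebraMap_apply ℂ (MvPolynomial (Coord L N) ℂ)]
    rfl, by simp⟩

theorem one (v : Coord L N → ℂ) : Ev v (1 : RatField L N) 1 := by
  simpa using const v 1

theorem zero (v : Coord L N → ℂ) : Ev v (0 : RatField L N) 0 := by
  simpa using const v 0

theorem add (hf : Ev v f c) (hg : Ev v g d) : Ev v (f + g) (c + d) := by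
  obtain ⟨a, b, hb, h1, h2⟩ := hf
  obtain ⟨a', b', hb', h1', h2'⟩ := hg
  refine ⟨a * b' + a' * b, b * b', by simp [hb, hb'], ?_, ?_⟩
  · simp only [map_add, map_mul, ← h1, ← h1']
    ring
  · simp only [map_add, map_mul, ← h2, ← h2']
    ring

theorem mul (hf : Ev v f c) (hg : Ev v g d) : Ev v (f * g) (c * d) := by
  obtain ⟨a, b, hb, h1, h2⟩ := hf
  obtain ⟨a', b', hb', h1', h2'⟩ := hg
  refine ⟨a * a', b * b', by simp [hb, hb'], ?_, ?_⟩
  · simp only [map_mul, ← h1, ← h1']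
    ring
  · simp only [map_mul, ← h2, ← h2']
    ring

theorem neg (hf : Ev v f c) : Ev v (-f) (-c) := by
  simpa using (const v (-1)).mul hf

theorem sub (hf : Ev v f c) (hg : Ev v g d) : Ev v (f - g) (c - d) := by
  simpa only [sub_eq_add_neg] using hf.add hg.neg

theorem inv (hf : Ev v f c) (hc : c ≠ 0) : Ev v f⁻¹ c⁻¹ := by
  obtain ⟨a, b, hb, h1, h2⟩ := hf
  have ha : MvPolynomial.eval v a ≠ 0 := by
    rw [← h2]
    exact mul_ne_zero hc hb
  refine ⟨b, a, ha, ?_, ?_⟩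
  · have hf : f ≠ 0 := by
      rintro rfl
      rw [zero_mul, eq_comm, FaithfulSMul.algebraMap_eq_zero_iff] at h1
      rw [h1, map_zero] at ha
      exact ha rfl
    rw [← h1, inv_mul_cancel_left₀ hf]
  · rw [← h2, inv_mul_cancel_left₀ hc]

theorem div (hf : Ev v f c) (hg : Ev v g d) (hd : d ≠ 0) : Ev v (f / g) (c / d) := by
  simpa only [div_eq_mul_inv] using hf.mul (hg.inv hd)

theorem pow (hf : Ev v f c) (n : ℕ) : Ev v (f ^ n) (c ^ n) := by
  induction n with
  | zero => simpa using one v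
  | succ n ih => simpa only [pow_succ] using ih.mul hf

theorem zpow (hf : Ev v f c) (hc : c ≠ 0) (n : ℤ) : Ev v (f ^ n) (c ^ n) := by
  cases n with
  | ofNat n => simpa using hf.pow n
  | negSucc n => simpa [zpow_negSucc] using (hf.pow (n + 1)).inv (pow_ne_zero _ hc)

theorem sum {ι : Type*} {s : Finset ι} {f : ι → RatField L N} {c : ι → ℂ}
    (h : ∀ i ∈ s, Ev v (f i) (c i)) : Ev v (∑ i ∈ s, f i) (∑ i ∈ s, c i) := by
  classical
  induction s using Finset.induction_on with
  | empty => simpa using zero v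
  | insert i s hi ih =>
    rw [Finset.sum_insert hi, Finset.sum_insert hi]
    exact (h i (Finset.mem_insert_self i s)).add
      (ih fun j hj => h j (Finset.mem_insert_of_mem hj))

theorem unique (hf : Ev v f c) (hg : Ev v f d) : c = d := by
  obtain ⟨a, b, hb, h1, h2⟩ := hf
  obtain ⟨a', b', hb', h1', h2'⟩ := hg
  have h3 : a * b' = a' * b := by
    apply IsFractionRing.injective (MvPolynomial (Coord L N) ℂ) (RatField L N)
    simp only [map_mul, ← h1, ← h1']
    ring
  have h4 := congrArg (MvPolynomial.eval v) h3
  simp only [map_mul, ← h2, ← h2'] at h4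
  have h5 : (c - d) * (MvPolynomial.eval v b * MvPolynomial.eval v b') = 0 := by linear_combination h4
  rcases mul_eq_zero.1 h5 with h6 | h6
  · exact sub_eq_zero.1 h6
  · exact absurd h6 (mul_ne_zero hb hb')

theorem aeval {w : Coord L N → ℂ} {X : Coord L N → RatField L N} (h : ∀ i, Ev v (X i) (w i))
    (a : MvPolynomial (Coord L N) ℂ) : Ev v (MvPolynomial.aeval X a) (MvPolynomial.eval w a) := by
  induction a using MvPolynomial.induction_on with
  | C c => simpa using const v c
  | add a b ha hb => simpa using ha.add hb
  | mul_X a i ha => simpa using ha.mul (h i)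

/-- Evaluation commutes with substitution. The denominator of f stays nonzero after substitution
because its value at v is that of the original denominator at w. -/
theorem map {w : Coord L N → ℂ} (φ : RatField L N →ₐ[ℂ] RatField L N)
    (h : ∀ i, Ev v (φ (HLN.var i)) (w i)) (hf : Ev w f c) : Ev v (φ f) c := by
  obtain ⟨a, b, hb, h1, h2⟩ := hf
  have e : ∀ a : MvPolynomial (Coord L N) ℂ,
      φ (algebraMap _ _ a) = MvPolynomial.aeval (fun i => φ (HLN.var i)) a := fun a => by
    induction a using MvPolynomial.induction_on with
    | C c =>
      rw [MvPolynomial.algHom_C]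
      have : (algebraMap (MvPolynomial (Coord L N) ℂ) (RatField L N)) (MvPolynomial.C c) =
          algebraMap ℂ _ c := by
        rw [IsScalarTower.algebraMap_apply ℂ (MvPolynomial (Coord L N) ℂ)]
        rfl
      rw [this, AlgHom.commutes]
    | add a b ha hb => simp only [map_add, ha, hb]
    | mul_X a i ha =>
      simp only [map_mul, ha, MvPolynomial.aeval_X]
      rfl
  have h3 : φ f * φ (algebraMap _ _ b) = φ (algebraMap _ _ a) := by rw [← map_mul, h1]
  have h4 := aeval h a
  have h5 := aeval h b
  rw [← e] at h4 h5
  have hb' : φ (algebraMap _ _ b) ≠ 0 := by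
    intro h0
    rw [h0] at h5
    exact hb (h5.unique (zero v))
  have h6 := h4.div h5 hb
  rwa [← h3, mul_div_assoc, div_self hb', mul_one, ← h2, mul_div_assoc, div_self hb,
    mul_one] at h6

theorem ofPoly (v : Coord L N → ℂ) (a : MvPolynomial (Coord L N) ℂ) :
    Ev v (algebraMap _ _ a) (MvPolynomial.eval v a) :=
  ⟨a, 1, by simp, by simp, by simp⟩

end Ev

theorem hasFDerivAt_eval [Fintype (Coord L N)] {E : Type*} [NormedAddCommGroup E] [NormedSpace ℂ E]
    {γ : E → Coord L N → ℂ} {γ' : Coord L N → E →L[ℂ] ℂ} {x : E}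
    (hγ : ∀ i, HasFDerivAt (fun s => γ s i) (γ' i) x) (a : MvPolynomial (Coord L N) ℂ) :
    HasFDerivAt (fun s => MvPolynomial.eval (γ s) a)
      (∑ i, MvPolynomial.eval (γ x) (MvPolynomial.pderiv i a) • γ' i) x := by
  classical
  induction a using MvPolynomial.induction_on with
  | C c =>
    refine (hasFDerivAt_const (𝕜 := ℂ) c x).congr_fderiv ?_ |>.congr_of_eventuallyEq (by simp)
    ext; simp
  | add a b ha hb =>
    simp only [map_add]
    refine (ha.fun_add hb).congr_fderiv ?_
    rw [← Finset.sum_add_distrib]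
    exact Finset.sum_congr rfl fun i _ => (add_smul _ _ _).symm
  | mul_X a i ha =>
    have h := ha.fun_mul (hγ i)
    simp only [map_mul, MvPolynomial.eval_X]
    refine h.congr_fderiv ?_
    have e : ∀ j, MvPolynomial.eval (γ x) (MvPolynomial.pderiv j (a * MvPolynomial.X i)) • γ' j =
        (if i = j then MvPolynomial.eval (γ x) a • γ' j else 0) +
          γ x i • MvPolynomial.eval (γ x) (MvPolynomial.pderiv j a) • γ' j := fun j => by
      rw [Derivation.leibniz, MvPolynomial.pderiv_X, smul_smul]
      rcases eq_or_ne i j with h | h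
      · subst h
        simp only [smul_eq_mul, Pi.single_eq_same, mul_one, map_add, map_mul,
          MvPolynomial.eval_X, if_true]
        exact add_smul (MvPolynomial.eval (γ x) a)
          (γ x i * MvPolynomial.eval (γ x) (MvPolynomial.pderiv i a)) (γ' i)
      · simp [h, h.symm]
    rw [Finset.sum_congr rfl fun j _ => e j, Finset.sum_add_distrib, Finset.sum_ite_eq,
      if_pos (Finset.mem_univ i), Finset.smul_sum]

/-- The fraction representing f may vary with the point. One fraction is fixed at x; its denominator
is nonzero nearby, where `Ev.unique` identifies its values with φ, so the quotient rule applies. -/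
theorem Ev.hasFDerivAt [Fintype (Coord L N)] {E : Type*} [NormedAddCommGroup E] [NormedSpace ℂ E]
    {γ : E → Coord L N → ℂ} {γ' : Coord L N → E →L[ℂ] ℂ} {x : E}
    (hγ : ∀ i, HasFDerivAt (fun s => γ s i) (γ' i) x) {f : RatField L N} {φ : E → ℂ}
    (h : ∀ᶠ s in nhds x, Ev (γ s) f (φ s)) :
    ∃ d : Coord L N → ℂ, (∀ i, Ev (γ x) (pd i f) (d i)) ∧ HasFDerivAt φ (∑ i, d i • γ' i) x := by
  obtain ⟨a, b, hb, h1, h2⟩ := h.self_of_nhds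
  have hA := hasFDerivAt_eval hγ a
  have hB := hasFDerivAt_eval hγ b
  have hbf : (algebraMap (MvPolynomial (Coord L N) ℂ) (RatField L N)) b ≠ 0 := by
    intro h0
    rw [FaithfulSMul.algebraMap_eq_zero_iff] at h0
    exact hb (by rw [h0, map_zero])
  have hf : f = algebraMap _ _ a / algebraMap _ _ b := by rw [← h1, mul_div_cancel_right₀ _ hbf]
  have hval : ∀ c : Coord L N, pd c f =
      (algebraMap _ _ (MvPolynomial.pderiv c a) * algebraMap _ _ b
        - algebraMap _ _ a * algebraMap _ _ (MvPolynomial.pderiv c b)) / algebraMap _ _ b ^ 2 := by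
    intro c
    rw [hf, Derivation.leibniz_div, pd, fracDerivation_algebraMap, fracDerivation_algebraMap]
    simp only [smul_eq_mul, Derivation.restrictScalars_apply]
    field_simp
  refine ⟨fun c => (MvPolynomial.eval (γ x) (MvPolynomial.pderiv c a) * MvPolynomial.eval (γ x) b
    - MvPolynomial.eval (γ x) a * MvPolynomial.eval (γ x) (MvPolynomial.pderiv c b)) /
      MvPolynomial.eval (γ x) b ^ 2, fun c => ?_, ?_⟩
  · rw [hval]
    exact (((Ev.ofPoly _ _).mul (Ev.ofPoly _ _)).sub
      ((Ev.ofPoly _ _).mul (Ev.ofPoly _ _))).div ((Ev.ofPoly _ _).pow 2)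
      (pow_ne_zero 2 hb)
  · have hφ : (fun s => MvPolynomial.eval (γ s) a / MvPolynomial.eval (γ s) b) =ᶠ[nhds x] φ := by
      filter_upwards [h, hB.continuousAt.eventually_ne hb] with s hs hbs
      refine Ev.unique ?_ hs
      rw [hf]
      exact (Ev.ofPoly _ _).div (Ev.ofPoly _ _) hbs
    refine HasFDerivAt.congr_of_eventuallyEq ?_ hφ.symm
    have h3 := hA.fun_mul ((hasDerivAt_inv hb).comp_hasFDerivAt x hB)
    simp only [div_eq_mul_inv]
    refine h3.congr_fderiv ?_
    rw [Finset.smul_sum, Finset.smul_sum, Finset.smul_sum, ← Finset.sum_add_distrib]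
    refine Finset.sum_congr rfl fun c _ => ?_
    rw [smul_smul, smul_smul, smul_smul]
    refine (add_smul _ _ _).symm.trans (congrArg (· • γ' c) ?_)
    simp only [Function.comp]
    field_simp
    ring

end HLN
end

noncomputable section
namespace HLN
variable {L N : ℕ}

/-! ### Values of the formulas -/

/-- The coordinates of `X` are regular at `v`, with values the coordinates of `x`. -/
def EvPoint (v : Coord L N → ℂ) (X : Point L N (RatField L N)) (x : Point L N ℂ) : Prop :=
  ∀ c, Ev v (X.coord c) (x.coord c)

namespace EvPoint

variable {v : Coord L N → ℂ} {X : Point L N (RatField L N)} {x : Point L N ℂ}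

theorem gen (x : Point L N ℂ) : EvPoint x.coord (HLN.gen L N) x := fun c => by
  rw [gen_coord]
  exact Ev.var _ c

theorem s (h : EvPoint v X x) (i : Fin N) : Ev v (X.s i) (x.s i) := h (.s i)
theorem q (h : EvPoint v X x) (i : Fin N) (n : Fin (L - 1)) : Ev v (X.q i n) (x.q i n) := h (.q i n)
theorem p (h : EvPoint v X x) (i : Fin N) (n : Fin (L - 1)) : Ev v (X.p i n) (x.p i n) := h (.p i n)

theorem sx (h : EvPoint v X x) (j : Fin (N + 1)) : Ev v (X.sx j) (x.sx j) := by
  refine Fin.cases ?_ (fun i => ?_) j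
  · simpa using Ev.one v
  · simpa using h.s i

theorem qBase (h : EvPoint v X x) (j : Fin (N + 1)) (m : ℕ) :
    Ev v (X.qBase j m) (x.qBase j m) := by
  refine Fin.cases (Ev.one v) (fun i => ?_) j
  simp only [Point.qBase, Fin.cases_succ]
  split_ifs
  · exact h.q i _
  · exact Ev.one v

theorem pBasePos (h : EvPoint v X x) (k : Params L N) (i : Fin N) (m : ℕ) :
    Ev v (X.pBasePos k i m) (x.pBasePos k i m) := by
  simp only [Point.pBasePos]
  split_ifs
  · exact h.p i _
  · exact (Ev.const v _).sub (Ev.sum fun n _ => (h.q i n).mul (h.p i n))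

theorem pBase (h : EvPoint v X x) (k : Params L N) (j : Fin (N + 1)) (m : ℕ) :
    Ev v (X.pBase k j m) (x.pBase k j m) := by
  refine Fin.cases ?_ (fun i => h.pBasePos k i m) j
  exact (Ev.const v _).sub (Ev.sum fun i _ => (h.qBase _ m).mul (h.pBasePos k i m))

section

variable (h : EvPoint v X x) (hs : ∀ i, x.s i ≠ 0)
include h hs

theorem qx (j : Fin (N + 1)) (m : ℤ) : Ev v (X.qx j m) (x.qx j m) :=
  ((h.sx j).zpow (Point.sx_ne_zero hs j) _).mul (h.qBase j _)

theorem px (k : Params L N) (j : Fin (N + 1)) (m : ℤ) : Ev v (X.px k j m) (x.px k j m) :=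
  ((h.sx j).zpow (Point.sx_ne_zero hs j) _).mul (h.pBase k j _)

theorem pairing (k : Params L N) (m n : ℤ) : Ev v (X.pairing k m n) (x.pairing k m n) :=
  Ev.sum fun j _ => (h.qx hs j m).mul (h.px hs k j n)

theorem ham (k : Params L N) (hs' : ∀ i j, i ≠ j → x.sx i ≠ x.sx j) (i : Fin N) :
    Ev v (HLN.ham k X i) (HLN.ham k x i) := by
  refine ((h.s i).inv (hs i)).mul (((Ev.sum fun n _ => ?_).add (Ev.sum fun j _ => Ev.sum fun n _ =>
    Ev.sum fun m _ => ?_)).add (Ev.sum fun j hj => Ev.mul ?_ (Ev.sum fun n _ => Ev.sum fun m _ => ?_)))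
  · exact ((Ev.const v _).mul (h.qx hs _ _)).mul (h.px hs k _ _)
  · exact (((h.qx hs _ _).mul (h.px hs k _ _)).mul (h.qx hs _ _)).mul (h.px hs k _ _)
  · refine (h.sx j).div ((h.s i).sub (h.sx j)) (sub_ne_zero.2 ?_)
    have := hs' i.succ j (Finset.ne_of_mem_erase hj).symm
    rwa [Point.sx_succ] at this
  · exact (((h.qx hs _ _).mul (h.px hs k _ _)).mul (h.qx hs _ _)).mul (h.px hs k _ _)

theorem rPoint (n : ℕ) (k : Params L N) (hr : rRegular n k x) :
    EvPoint v (HLN.rPoint n k X) (HLN.rPoint n k x) := by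
  obtain ⟨hD, haD, h0⟩ := hr
  have ea := Ev.const v (k.a n)
  have eD := h.pairing hs k (n + 1) n
  have e1 : ∀ i, Ev v (X.qx i 1) (x.qx i 1) := fun i => h.qx hs i 1
  intro c
  rw [HLN.rPoint, HLN.rPoint]
  by_cases hn : n = 0
  · simp only [if_pos hn]
    have hf : ∀ i : Fin N, Ev v (1 + algebraMap ℂ _ (k.a n) * (X.qx i.succ 1 - 1) /
        (algebraMap ℂ _ (k.a n) + X.pairing k (n + 1) n)) (1 + algebraMap ℂ _ (k.a n) *
        (x.qx i.succ 1 - 1) / (algebraMap ℂ _ (k.a n) + x.pairing k (n + 1) n)) := fun i =>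
      (Ev.one v).add ((ea.mul ((e1 _).sub (Ev.one v))).div (ea.add eD) haD)
    cases c with
    | s i => exact h.s i
    | q i m =>
      exact (h.q i m).mul ((Ev.one v).sub ((ea.mul ((e1 _).sub (Ev.one v))).div
        ((ea.mul (e1 _)).add eD) (h0 hn i)))
    | p i m =>
      simp only [Point.coord]
      split_ifs
      · exact ((h.p i m).sub ((ea.mul (h.px hs k _ 0)).div eD hD)).mul (hf i)
      · exact (h.p i m).mul (hf i)
  · simp only [if_neg hn]
    cases c with
    | s i => exact h.s i
    | q i m =>
      simp only [Point.coord]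
      split_ifs
      · exact (h.q i m).add ((ea.mul ((h.qx hs _ _).sub (h.q i m))).div (ea.add eD) haD)
      · exact h.q i m
    | p i m =>
      simp only [Point.coord]
      split_ifs
      · exact (h.p i m).mul ((Ev.one v).add (ea.div eD hD))
      · exact (h.p i m).sub ((ea.mul (h.px hs k _ _)).div eD hD)
      · exact h.p i m

theorem rPoint' (n : ℕ) (k : Params L N) (hr : rRegular' n k x) :
    EvPoint v (HLN.rPoint' n k X) (HLN.rPoint' n k x) := by
  obtain ⟨hD, haD, h0⟩ := hr
  have ea := Ev.const v (k.b n)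
  have e1 : ∀ i, Ev v (X.qx i (-1)) (x.qx i (-1)) := fun i => h.qx hs i (-1)
  intro c
  rw [HLN.rPoint', HLN.rPoint']
  by_cases hn : n = 0
  · simp only [if_pos hn] at hD haD ⊢
    have h0 := h0 hn
    simp only [if_pos hn] at h0
    have eD := h.pairing hs k (-1) 0
    have hf : ∀ i : Fin N, Ev v (1 + algebraMap ℂ _ (k.b n) * (X.qx i.succ (-1) - 1) /
        (algebraMap ℂ _ (k.b n) + X.pairing k (-1) 0)) (1 + algebraMap ℂ _ (k.b n) *
        (x.qx i.succ (-1) - 1) / (algebraMap ℂ _ (k.b n) + x.pairing k (-1) 0)) := fun i =>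
      (Ev.one v).add ((ea.mul ((e1 _).sub (Ev.one v))).div (ea.add eD) haD)
    cases c with
    | s i => exact h.s i
    | q i m =>
      exact (h.q i m).mul ((Ev.one v).sub ((ea.mul ((e1 _).sub (Ev.one v))).div
        ((ea.mul (e1 _)).add eD) (h0 i)))
    | p i m =>
      simp only [Point.coord]
      split_ifs
      · exact (((Ev.one v).div (h.s i) (hs i)).mul ((h.px hs k _ (-1)).sub
          ((ea.mul (h.px hs k _ 0)).div eD hD))).mul (hf i)
      · exact (h.p i m).mul (hf i)
  · simp only [if_neg hn] at hD haD ⊢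
    have eD := h.pairing hs k (L - n - 1) (L - n)
    cases c with
    | s i => exact h.s i
    | q i m =>
      simp only [Point.coord]
      split_ifs
      · exact (h.q i m).add ((ea.mul ((h.qx hs _ _).sub (h.q i m))).div (ea.add eD) haD)
      · exact h.q i m
    | p i m =>
      simp only [Point.coord]
      split_ifs
      · exact (h.p i m).mul ((Ev.one v).add (ea.div eD hD))
      · exact (h.p i m).sub ((ea.mul (h.px hs k _ _)).div eD hD)
      · exact h.p i m

theorem piPoint (k : Params L N) (hq : piRegular x) :
    EvPoint v (HLN.piPoint k X) (HLN.piPoint k x) := by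
  intro c
  cases c with
  | s i => exact h.s i
  | q i m => exact (h.qx hs _ _).div (h.qx hs _ 1) (hq i)
  | p i m => exact (h.px hs k _ _).mul (h.qx hs _ 1)

theorem rhoPoint (k : Params L N) : EvPoint v (HLN.rhoPoint k X) (HLN.rhoPoint k x) := by
  intro c
  cases c with
  | s i => exact (Ev.one v).div (h.s i) (hs i)
  | q i m => exact (h.qx hs _ _).div (h.s i) (hs i)
  | p i m => exact (h.s i).mul (h.px hs k _ _)

end

end EvPoint

/-! ### Holomorphic solutions -/

/-- The point avoids the fixed singularities. -/
structure SRegular (s : Fin N → ℂ) : Prop where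
  ne_zero : ∀ i, s i ≠ 0
  ne_one : ∀ i, s i ≠ 1
  ne : ∀ i j, i ≠ j → s i ≠ s j

theorem SRegular.sx_ne {x : Point L N ℂ} (h : SRegular x.s) (i j : Fin (N + 1)) (hij : i ≠ j) :
    x.sx i ≠ x.sx j := by
  revert hij
  refine Fin.cases ?_ (fun i => ?_) i <;> refine Fin.cases ?_ (fun j => ?_) j <;> intro hij
  · exact absurd rfl hij
  · simpa using (h.ne_one j).symm
  · simpa using h.ne_one i
  · simpa using h.ne i j (by simpa using hij)

open Classical in
-- Links the analytic partial derivative in the differential system with the algebraic derivation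
-- `pd`. Since c is not one of the s_i, varying it keeps the point away from the fixed
-- singularities.
theorem hasDerivAt_ham (k : Params L N) {x : Point L N ℂ} (h : SRegular x.s) (j : Fin N)
    (c : Coord L N) {γ : ℂ → Point L N ℂ} (hγ : ∀ y c', (γ y).coord c' = if c' = c then y else x.coord c')
    (hc : ∀ i, c ≠ .s i) :
    Ev x.coord (pd c (ham k (gen L N) j)) (deriv (fun y => ham k (γ y) j) (x.coord c)) := by
  have : Fintype (Coord L N) := Fintype.ofFinite _
  have hs : ∀ y, (γ y).s = x.s := fun y => funext fun i => by
    have := hγ y (.s i)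
    rwa [if_neg (hc i).symm] at this
  have hx : (γ (x.coord c)).coord = x.coord := funext fun c' => by
    rw [hγ]
    split_ifs with h1
    · rw [h1]
    · rfl
  have hev : ∀ y, Ev (γ y).coord (ham k (gen L N) j) (ham k (γ y) j) := fun y => by
    have h2 : SRegular (γ y).s := by rwa [hs]
    exact (EvPoint.gen (γ y)).ham h2.ne_zero k h2.sx_ne j
  obtain ⟨d, hd, hd'⟩ := Ev.hasFDerivAt (E := ℂ) (γ := fun y => (γ y).coord) (x := x.coord c)
    (γ' := fun c' => if c' = c then ContinuousLinearMap.id ℂ ℂ else 0) (fun c' => by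
      simp only [hγ]
      split_ifs
      · exact hasFDerivAt_id _
      · exact hasFDerivAt_const _ _) (Filter.Eventually.of_forall hev)
  rw [hx] at hd
  rw [hd'.hasDerivAt.deriv]
  convert hd c
  simp

theorem ev_hamDp (k : Params L N) {x : Point L N ℂ} (h : SRegular x.s) (j i : Fin N)
    (n : Fin (L - 1)) : Ev x.coord (pd (.p i n) (ham k (gen L N) j)) (hamDp k x j i n) := by
  classical
  refine hasDerivAt_ham k h j (.p i n) (fun y c' => ?_) (by simp)
  cases c' with
  | s _ => simp [Point.coord]
  | q _ _ => simp [Point.coord]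
  | p i' n' =>
    simp only [Point.coord, Function.update_apply, Coord.p.injEq]
    split_ifs <;> simp_all

theorem ev_hamDq (k : Params L N) {x : Point L N ℂ} (h : SRegular x.s) (j i : Fin N)
    (n : Fin (L - 1)) : Ev x.coord (pd (.q i n) (ham k (gen L N) j)) (hamDq k x j i n) := by
  classical
  refine hasDerivAt_ham k h j (.q i n) (fun y c' => ?_) (by simp)
  cases c' with
  | s _ => simp [Point.coord]
  | p _ _ => simp [Point.coord]
  | q i' n' =>
    simp only [Point.coord, Function.update_apply, Coord.q.injEq]
    split_ifs <;> simp_all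

/-- The components of the vector field of the Hamiltonian system. -/
def flowValue (k : Params L N) (x : Point L N ℂ) (j : Fin N) : Coord L N → ℂ
  | .s i => if i = j then 1 else 0
  | .q i n => hamDp k x j i n
  | .p i n => -hamDq k x j i n

theorem ev_flow (k : Params L N) {x : Point L N ℂ} (h : SRegular x.s) (j : Fin N) (c : Coord L N) :
    Ev x.coord (flow k j (var c)) (flowValue k x j c) := by
  classical
  cases c with
  | s i =>
    rw [flow_s, flowValue]
    split_ifs
    · exact Ev.one _
    · exact Ev.zero _
  | q i n =>
    rw [flow_eq, Derivation.add_apply, hamField_q, pd_var_of_ne (by simp), zero_add]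
    exact ev_hamDp k h j i n
  | p i n =>
    rw [flow_eq, Derivation.add_apply, hamField_p, pd_var_of_ne (by simp), zero_add]
    exact (ev_hamDq k h j i n).neg

theorem IsSolution.hasFDerivAt_coord {k : Params L N} {U : Set (Fin N → ℂ)}
    {q p : (Fin N → ℂ) → Fin N → Fin (L - 1) → ℂ} (h : IsSolution k U q p) {s : Fin N → ℂ}
    (hs : s ∈ U) (c : Coord L N) : HasFDerivAt (fun s => Point.coord ⟨s, q s, p s⟩ c)
      (∑ j, flowValue k ⟨s, q s, p s⟩ j c •
        ContinuousLinearMap.proj (R := ℂ) (φ := fun _ => ℂ) j) s := by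
  cases c with
  | s i =>
    have h1 : ∑ j, flowValue k ⟨s, q s, p s⟩ j (.s i) •
        ContinuousLinearMap.proj (R := ℂ) (φ := fun _ : Fin N => ℂ) j =
        ContinuousLinearMap.proj (R := ℂ) (φ := fun _ : Fin N => ℂ) i := by
      rw [Finset.sum_eq_single i]
      · simp [flowValue]
      · intro j _ hj
        rw [flowValue, if_neg hj.symm]
        exact zero_smul ℂ (ContinuousLinearMap.proj (R := ℂ) (φ := fun _ : Fin N => ℂ) j)
      · simp
    rw [h1]
    exact hasFDerivAt_apply i s
  | q i n => exact h.deriv_q s hs i n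
  | p i n => exact h.deriv_p s hs i n

theorem IsSolution.sRegular {k : Params L N} {U : Set (Fin N → ℂ)}
    {q p : (Fin N → ℂ) → Fin N → Fin (L - 1) → ℂ} (h : IsSolution k U q p) {s : Fin N → ℂ}
    (hs : s ∈ U) : SRegular s := ⟨h.ne_zero s hs, h.ne_one s hs, h.ne s hs⟩

/-- The derivative along a solution. -/
theorem IsSolution.hasFDerivAt_of_ev {k : Params L N} {U : Set (Fin N → ℂ)}
    {q p : (Fin N → ℂ) → Fin N → Fin (L - 1) → ℂ} (h : IsSolution k U q p) {f : RatField L N}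
    {φ : (Fin N → ℂ) → ℂ} (hφ : ∀ s ∈ U, Ev (Point.coord ⟨s, q s, p s⟩) f (φ s)) {s : Fin N → ℂ}
    (hs : s ∈ U) : ∃ w : Fin N → ℂ, (∀ j, Ev (Point.coord ⟨s, q s, p s⟩) (flow k j f) (w j)) ∧
      HasFDerivAt φ (∑ j, w j • ContinuousLinearMap.proj (R := ℂ) (φ := fun _ => ℂ) j) s := by
  have : Fintype (Coord L N) := Fintype.ofFinite _
  obtain ⟨d, hd, hd'⟩ := Ev.hasFDerivAt (γ := fun s => Point.coord ⟨s, q s, p s⟩) (x := s)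
    (fun c => h.hasFDerivAt_coord hs c) (f := f) (φ := φ)
    (Filter.mem_of_superset (h.isOpen.mem_nhds hs) hφ)
  refine ⟨fun j => ∑ c, flowValue k ⟨s, q s, p s⟩ j c * d c, fun j => ?_, ?_⟩
  · rw [derivation_eq_sum_pd]
    exact Ev.sum fun c _ => (ev_flow k (x := ⟨s, q s, p s⟩) (h.sRegular hs) j c).mul (hd c)
  · refine hd'.congr_fderiv ?_
    ext w
    simp only [sum_apply, smul_apply, smul_eq_mul,
      ContinuousLinearMap.proj_apply, Finset.mul_sum, Finset.sum_mul]
    rw [Finset.sum_comm]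
    exact Finset.sum_congr rfl fun _ _ => Finset.sum_congr rfl fun _ _ => by ring

/-- Along a solution, the differential of a regular rational function f has as components the values
of `flow k j f`. Evaluating the invariance identity expresses these through the new vector field and
the derivatives of the new s_l, and composition with σ removes the latter by the chain rule. -/
theorem ParamBirational.IsInvariant.mapsSolutions {T : ParamBirational L N} (hT : T.IsInvariant)
    {σ : (Fin N → ℂ) → Fin N → ℂ} {τ : Params L N → Point L N ℂ → Point L N ℂ}
    {reg : Params L N → Point L N ℂ → Prop}
    (hτ : ∀ k x, (∀ i, x.s i ≠ 0) → reg k x → EvPoint x.coord (T.pt k) (τ k x))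
    (hσ : ∀ k x, (τ k x).s = σ x.s) (hinv : ∀ s, σ (σ s) = s)
    (hdiff : ∀ s, (∀ i, s i ≠ 0) → DifferentiableAt ℂ σ s)
    (hreg : ∀ s, SRegular s → SRegular (σ s)) : T.MapsSolutions σ τ reg := by
  intro k U q p h hU
  have hR : ∀ t ∈ σ ⁻¹' U, SRegular t := fun t ht => by
    have := hreg _ (h.sRegular ht)
    rwa [hinv] at this
  have key : ∀ t ∈ σ ⁻¹' U, ∀ c, HasFDerivAt
      (fun t => (τ k ⟨σ t, q (σ t), p (σ t)⟩).coord c)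
      (∑ j, flowValue (T.param k) (τ k ⟨σ t, q (σ t), p (σ t)⟩) j c •
        ContinuousLinearMap.proj (R := ℂ) (φ := fun _ => ℂ) j) t := by
    intro t ht c
    have hev : ∀ c, ∀ s ∈ U, Ev (Point.coord ⟨s, q s, p s⟩) (T.field k (var c))
        ((τ k ⟨s, q s, p s⟩).coord c) := fun c s hs => by
      rw [← T.pt_coord]
      exact hτ k _ (h.ne_zero s hs) (hU s hs) c
    have hD := fun c => h.hasFDerivAt_of_ev (hev c) ht
    choose w hw hw' using hD
    have hσt : HasFDerivAt σ (fderiv ℂ σ t) t := (hdiff t (hR t ht).ne_zero).hasFDerivAt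
    have hs' : SRegular (τ k ⟨σ t, q (σ t), p (σ t)⟩).s := by
      rw [hσ]
      exact hreg _ (h.sRegular ht)
    have hval : ∀ j, w c j = ∑ l, w (.s l) j *
        flowValue (T.param k) (τ k ⟨σ t, q (σ t), p (σ t)⟩) l c := fun j => by
      refine (hw c j).unique ?_
      rw [hT k j (var c)]
      refine Ev.sum fun l _ => (hw (.s l) j).mul ?_
      exact (ev_flow (T.param k) hs' l c).map (T.field k : RatField L N →ₐ[ℂ] RatField L N)
        fun c' => hev c' _ ht
    -- The matrix of the w(s_l)_j is the Jacobian of σ at σ(t). Differentiating σ(σ(t)) = t shows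
    -- that composition with the derivative of σ at t gives the coordinate projections.
    have hproj : ∀ l, (∑ j, w (.s l) j •
        ContinuousLinearMap.proj (R := ℂ) (φ := fun _ : Fin N => ℂ) j).comp (fderiv ℂ σ t) =
        ContinuousLinearMap.proj (R := ℂ) (φ := fun _ : Fin N => ℂ) l := fun l => by
      have h1 := (hw' (.s l)).comp t hσt
      have h2 : ((fun s => (τ k ⟨s, q s, p s⟩).coord (.s l)) ∘ σ) = fun t => t l := by
        funext t
        change (τ k _).s l = _
        rw [hσ]
        change σ (σ t) l = _
        rw [hinv]
      rw [h2] at h1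
      exact h1.unique (hasFDerivAt_apply l t)
    refine ((hw' c).comp t hσt).congr_fderiv ?_
    rw [← Finset.sum_congr rfl fun l _ => congrArg (flowValue (T.param k)
      (τ k ⟨σ t, q (σ t), p (σ t)⟩) l c • ·) (hproj l)]
    simp only [hval]
    ext z
    simp only [sum_apply, smul_apply, smul_eq_mul,
      ContinuousLinearMap.proj_apply, ContinuousLinearMap.comp_apply, Finset.mul_sum,
      Finset.sum_mul]
    rw [Finset.sum_comm]
    exact Finset.sum_congr rfl fun _ _ => Finset.sum_congr rfl fun _ _ => by ring
  have hpt : ∀ t, τ k ⟨σ t, q (σ t), p (σ t)⟩ =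
      ⟨t, (τ k ⟨σ t, q (σ t), p (σ t)⟩).q, (τ k ⟨σ t, q (σ t), p (σ t)⟩).p⟩ := fun t => by
    have h1 := hσ k ⟨σ t, q (σ t), p (σ t)⟩
    change _ = σ (σ t) at h1
    rw [hinv] at h1
    exact Point.ext' (fun i => congrFun h1 i) (fun _ _ => rfl) fun _ _ => rfl
  refine ⟨?_, fun t ht => (hR t ht).ne_zero, fun t ht => (hR t ht).ne_one,
    fun t ht => (hR t ht).ne, fun t ht i n => ?_, fun t ht i n => ?_⟩
  · rw [isOpen_iff_mem_nhds]
    intro t ht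
    exact (hdiff t (hR t ht).ne_zero).continuousAt.preimage_mem_nhds (h.isOpen.mem_nhds ht)
  · have h1 := key t ht (.q i n)
    simp only [flowValue] at h1
    rw [hpt t] at h1
    exact h1
  · have h1 := key t ht (.p i n)
    simp only [flowValue] at h1
    rw [hpt t] at h1
    exact h1

section

variable [NeZero L] (hL : 2 ≤ L) (hN : 1 ≤ N)

theorem rB_mapsSolutions (n : ZMod L) :
    (rB hL hN n).MapsSolutions id (rPoint n.val) (rRegular n.val) :=
  (rB_isInvariant hL hN n).mapsSolutions
    (fun k x hs hr => by
      rw [rB_pt]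
      exact (EvPoint.gen x).rPoint hs _ _ hr)
    (fun k x => rPoint_s _ _ _) (fun _ => rfl) (fun _ _ => differentiableAt_id) fun _ h => h

theorem rPoint'_s {F : Type*} [Field F] [Algebra ℂ F] (n : ℕ) (k : Params L N) (x : Point L N F) :
    (rPoint' n k x).s = x.s := by
  rw [rPoint']
  split_ifs <;> rfl

theorem rB'_mapsSolutions (n : ZMod L) :
    (rB' hL hN n).MapsSolutions id (rPoint' n.val) (rRegular' n.val) :=
  (rB'_isInvariant hL hN n).mapsSolutions
    (fun k x hs hr => by
      rw [rB'_pt]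
      exact (EvPoint.gen x).rPoint' hs _ _ hr)
    (fun k x => rPoint'_s _ _ _) (fun _ => rfl) (fun _ _ => differentiableAt_id) fun _ h => h

theorem piB_mapsSolutions : (piB N hL).MapsSolutions id piPoint fun _ => piRegular :=
  (piB_isInvariant hL).mapsSolutions
    (fun k x hs hr => by
      rw [piB_pt]
      exact (EvPoint.gen x).piPoint hs _ hr)
    (fun k x => rfl) (fun _ => rfl) (fun _ _ => differentiableAt_id) fun _ h => h

theorem rhoB_mapsSolutions :
    (rhoB N hL).MapsSolutions (fun s i => 1 / s i) rhoPoint fun _ _ => True :=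
  (rhoB_isInvariant hL).mapsSolutions
    (fun k x hs _ => by
      rw [rhoB_pt]
      exact (EvPoint.gen x).rhoPoint hs _)
    (fun k x => rfl) (fun _ => by simp)
    (fun s hs => differentiableAt_pi.2 fun i => by
      simp only [one_div]
      exact (differentiableAt_apply i s).inv (hs i))
    fun s h => ⟨fun i => one_div_ne_zero (h.ne_zero i), fun i => by simpa using h.ne_one i,
      fun i j hij => by simpa using h.ne i j hij⟩

end

end HLN
end

noncomputable section
namespace HLN
variable {L N : ℕ}

/-! ### The affine Weyl group -/

theorem affineA_self (L : ℕ) (m : ZMod L) : (affineA L).M m m = 1 := by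
  simp [affineA]

theorem affineA_adj {m n : ZMod L} (hL : 3 ≤ L) (h : m ≠ n) (h' : m = n + 1 ∨ n = m + 1) :
    (affineA L).M m n = 3 := by
  simp only [affineA, Matrix.of_apply, if_neg h, if_pos h', if_neg (by omega : L ≠ 2)]

theorem affineA_far {m n : ZMod L} (h : m ≠ n) (h' : ¬(m = n + 1 ∨ n = m + 1)) :
    (affineA L).M m n = 2 := by
  simp only [affineA, Matrix.of_apply, if_neg h, if_neg h']

theorem zmod_two_add_one (hL : L = 2) {m n : ZMod L} (h : m ≠ n) : m = n + 1 ∧ m + 1 = n := by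
  subst hL
  revert m n
  decide

theorem affineA_two {m n : ZMod L} (hL : L = 2) (h : m ≠ n) : (affineA L).M m n = 0 := by
  have h' : m = n + 1 ∨ n = m + 1 := .inl (zmod_two_add_one hL h).1
  subst hL
  simp only [affineA, Matrix.of_apply, if_neg h, if_pos h', if_true]

theorem pow_three_eq_one_of_braid {G : Type*} [Group G] {x y : G} (hx : x * x = 1) (hy : y * y = 1)
    (h : x * y * x = y * x * y) : (x * y) ^ 3 = 1 := by
  calc (x * y) ^ 3 = (x * y * x) * (y * x * y) := by simp only [pow_succ, pow_zero, one_mul, mul_assoc]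
    _ = y * x * (y * y) * x * y := by rw [h]; simp only [mul_assoc]
    _ = 1 := by rw [hy, mul_one, mul_assoc y, hx, mul_one, hy]

/-! ### Positivity of roots for the affine Coxeter group. -/

section Positivity

variable {W : Type*} [Group W] (cs : CoxeterSystem (affineA L) W)

theorem affineA_braid (hL : 3 ≤ L) {s t : ZMod L} (h : s ≠ t) (h' : s = t + 1 ∨ t = s + 1) :
    cs.simple s * cs.simple t * cs.simple s = cs.simple t * cs.simple s * cs.simple t := by
  have h1 := cs.simple_mul_simple_pow s t
  rw [affineA_adj hL h h'] at h1
  have h2 : (cs.simple s * cs.simple t * cs.simple s) * (cs.simple t * cs.simple s * cs.simple t) =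
      1 := by
    rw [← h1]
    simp only [pow_succ, pow_zero, one_mul, mul_assoc]
  rw [eq_inv_of_mul_eq_one_left h2]
  simp only [mul_inv_rev, cs.inv_simple, mul_assoc]

theorem affineA_comm {s t : ZMod L} (h : s ≠ t) (h' : ¬(s = t + 1 ∨ t = s + 1)) :
    cs.simple s * cs.simple t = cs.simple t * cs.simple s := by
  have h1 := cs.simple_mul_simple_pow s t
  rw [affineA_far h h', pow_two] at h1
  rw [eq_inv_of_mul_eq_one_left h1]
  simp only [mul_inv_rev, cs.inv_simple]

/-- Positivity of roots: if the functions `A w` transform as the simple roots under `w` and are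
positive for `w = 1`, then `A w s` is positive whenever `ℓ (w s) > ℓ w`. -/
theorem root_pos (hL : 2 ≤ L) {A : W → ZMod L → ℝ} (h1 : ∀ m, 0 < A 1 m)
    (hA : ∀ w s m, A (w * cs.simple s) m = A w m + (if m + 1 = s then A w s else 0)
      - (if m = s then A w s else 0) - (if m = s then A w s else 0)
      + (if m = s + 1 then A w s else 0))
    (h2 : L = 2 → ∀ w m n, m ≠ n → 0 < A w m + A w n) (w : W) (s : ZMod L)
    (hs : ¬cs.IsRightDescent w s) : 0 < A w s := by
  induction hn : cs.length w using Nat.strong_induction_on generalizing w s with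
  | _ n ih =>
    by_cases hw : w = 1
    · rw [hw]
      exact h1 s
    obtain ⟨t, ht⟩ := cs.exists_rightDescent_of_ne_one hw
    have hst : s ≠ t := fun h => hs (h ▸ ht)
    have hts := hst.symm
    obtain ⟨w₁, hw₁⟩ : ∃ w₁, w₁ = w * cs.simple t := ⟨_, rfl⟩
    have hlt : cs.length w₁ + 1 = cs.length w := hw₁ ▸ cs.isRightDescent_iff.1 ht
    have hw₁' : w = w₁ * cs.simple t := by rw [hw₁, cs.simple_mul_simple_cancel_right]
    have hls : cs.length (w * cs.simple s) = cs.length w + 1 := cs.not_isRightDescent_iff.1 hs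
    have ht₁ : ¬cs.IsRightDescent w₁ t := by
      rwa [hw₁, ← cs.isRightDescent_iff_not_isRightDescent_mul]
    have hpt := ih _ (by omega) w₁ t ht₁ rfl
    rw [hw₁', hA, if_neg hst]
    rcases hL.eq_or_lt with hL2 | hL3
    -- For L = 2 the new value is A w₁ s + 2·A w₁ t. There is no braid relation to use; instead A w₁
    -- s + A w₁ t > 0 by `h2`.
    · have h3 := zmod_two_add_one hL2.symm hst
      rw [if_pos h3.1, if_pos h3.2]
      have := h2 hL2.symm w₁ s t hst
      linarith
    have hnn : s = t + 1 → s + 1 ≠ t := by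
      rintro rfl h
      rw [add_assoc, add_eq_left, one_add_one_eq_two] at h
      exact ZMod.two_ne_zero' hL3 h
    by_cases hadj : s = t + 1 ∨ t = s + 1
    · have hval : ∀ v : W, A (v * cs.simple t) s = A v s + A v t := fun v => by
        rw [hA, if_neg hst]
        rcases hadj with h | h
        · rw [if_neg (hnn h), if_pos h]
          ring
        · rw [if_pos h.symm, if_neg fun h' => hnn h' h.symm]
          ring
      have hval' : ∀ v : W, A (v * cs.simple s) t = A v t + A v s := fun v => by
        rw [hA, if_neg hts]
        rcases hadj with h | h
        · rw [if_pos h.symm, if_neg fun h' => hnn h h'.symm]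
          ring
        · rw [if_neg fun h' => hnn h'.symm h.symm, if_pos h]
          ring
      have hself : ∀ v : W, A (v * cs.simple s) s = -A v s := fun v => by
        have z1 := ZMod.one_ne_zero' hL
        rw [hA, if_pos rfl, if_neg (by simpa using z1), if_neg (by simpa using z1)]
        ring
      -- If s is not a descent of w₁, both summands are positive by induction. Otherwise w₁ = w₂ s,
      -- and the sum equals A w₂ t.
      have goal' : 0 < A w₁ s + A w₁ t := by
        by_cases hs₁ : cs.IsRightDescent w₁ s
        · obtain ⟨w₂, hw₂⟩ : ∃ w₂, w₂ = w₁ * cs.simple s := ⟨_, rfl⟩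
          have hlt₂ : cs.length w₂ + 1 = cs.length w₁ := hw₂ ▸ cs.isRightDescent_iff.1 hs₁
          have hw₂' : w₁ = w₂ * cs.simple s := by rw [hw₂, cs.simple_mul_simple_cancel_right]
          have ht₂ : ¬cs.IsRightDescent w₂ t := by
            intro h
            have hlt₃ := cs.isRightDescent_iff.1 h
            -- If t were a descent of w₂, the braid relation would give ws = (w₂t)st, of length at
            -- most ℓ(w₂) + 1 = ℓ(w) − 1, against ℓ(ws) = ℓ(w) + 1.
            have e : w * cs.simple s = w₂ * cs.simple t * (cs.simple s * cs.simple t) := by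
              rw [hw₁', hw₂']
              have hb := affineA_braid cs hL3 hst hadj
              calc w₂ * cs.simple s * cs.simple t * cs.simple s
                  = w₂ * (cs.simple s * cs.simple t * cs.simple s) := by simp only [mul_assoc]
                _ = _ := by rw [hb]; simp only [mul_assoc]
            have l1 := cs.length_mul_le (w₂ * cs.simple t) (cs.simple s * cs.simple t)
            have l2 := cs.length_mul_le (cs.simple s) (cs.simple t)
            rw [cs.length_simple, cs.length_simple] at l2
            rw [← e] at l1
            omega
          have := ih _ (by omega) w₂ t ht₂ rfl
          rw [hw₂', hself, hval']
          linarith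
        · exact add_pos (ih _ (by omega) w₁ s hs₁ rfl) hpt
      have := hval w₁
      rw [hA, if_neg hst] at this
      linarith
    · rw [if_neg fun h => hadj (.inr h.symm), if_neg fun h => hadj (.inl h)]
      have hs₁ : ¬cs.IsRightDescent w₁ s := by
        intro h
        have hlt₂ := cs.isRightDescent_iff.1 h
        have e : w * cs.simple s = w₁ * cs.simple s * cs.simple t := by
          rw [hw₁', mul_assoc, mul_assoc, affineA_comm cs hst hadj]
        have l1 := cs.length_mul_le (w₁ * cs.simple s) (cs.simple t)
        rw [cs.length_simple, ← e] at l1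
        omega
      have := ih _ (by omega) w₁ s hs₁ rfl
      linarith

/-- If w ≠ 1 has the right descent s, positivity for ws gives A(ws) s > 0; but this value is −A w s.
-/
theorem eq_one_of_root_pos (hL : 2 ≤ L) {A : W → ZMod L → ℝ} (h1 : ∀ m, 0 < A 1 m)
    (hA : ∀ w s m, A (w * cs.simple s) m = A w m + (if m + 1 = s then A w s else 0)
      - (if m = s then A w s else 0) - (if m = s then A w s else 0)
      + (if m = s + 1 then A w s else 0))
    (h2 : L = 2 → ∀ w m n, m ≠ n → 0 < A w m + A w n) {w : W} (hw : ∀ s, 0 < A w s) : w = 1 := by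
  by_contra hne
  obtain ⟨s, hs⟩ := cs.exists_rightDescent_of_ne_one hne
  have h3 := root_pos cs hL h1 hA h2 (w * cs.simple s) s
    (cs.isRightDescent_iff_not_isRightDescent_mul.1 hs)
  have z1 := ZMod.one_ne_zero' hL
  rw [hA, if_pos rfl, if_neg (by simpa using z1), if_neg (by simpa using z1)] at h3
  have := hw s
  linarith

end Positivity

/-- Parameters at which all the root variables `𝔞_n` are equal. -/
def regularParams (L N : ℕ) [NeZero L] : Params L N where
  e n := n / (L : ℂ)
  κ _ := 0
  θ _ := 0
  e_add n := by
    have hL : (L : ℂ) ≠ 0 := Nat.cast_ne_zero.2 (NeZero.ne L)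
    push_cast
    field_simp
  κ_add _ := rfl
  sum_e := by
    have hL : (L : ℂ) ≠ 0 := Nat.cast_ne_zero.2 (NeZero.ne L)
    have h := Finset.sum_range_id_mul_two L
    have h2 : ((∑ i ∈ Finset.range L, i : ℕ) : ℂ) * 2 = L * ((L - 1 : ℕ) : ℂ) := by
      exact_mod_cast h
    rw [Nat.cast_sub (Nat.one_le_iff_ne_zero.2 (NeZero.ne L))] at h2
    push_cast at h2
    rw [← Finset.sum_div]
    simp only [Int.cast_natCast]
    field_simp
    linear_combination h2
  sum_κ := by simp

theorem regularParams_a [NeZero L] (n : ℤ) : (regularParams L N).a n = ((L : ℝ)⁻¹ : ℝ) := by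
  simp only [Params.a, regularParams]
  push_cast
  ring

/-! ### The two faithful realizations of the affine Weyl group. -/

section

variable [NeZero L] (hL : 2 ≤ L) (hN : 1 ≤ N)

theorem rB_braid' (h3 : 3 ≤ L) {m n : ZMod L} (h : m = n + 1 ∨ n = m + 1) :
    (rB hL hN m * rB hL hN n) ^ 3 = 1 := by
  refine pow_three_eq_one_of_braid (rB_sq hL hN m) (rB_sq hL hN n) ?_
  rcases h with rfl | rfl
  · exact (rB_braid hL hN h3 n).symm
  · exact rB_braid hL hN h3 m

theorem isLiftable_rB : (affineA L).IsLiftable (rB hL hN) := by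
  intro m n
  by_cases h : m = n
  · rw [h]
    rw [affineA_self, pow_one, rB_sq]
  rcases hL.eq_or_lt with hL2 | hL3
  · rw [affineA_two hL2.symm h, pow_zero]
  · by_cases h' : m = n + 1 ∨ n = m + 1
    · rw [affineA_adj hL3 h h', rB_braid' hL hN hL3 h']
    · push Not at h'
      have hc : Commute (rB hL hN m) (rB hL hN n) :=
        rB_comm_far hL hN (Ne.symm h) h'.1 h'.2
      rw [affineA_far h (by tauto), hc.mul_pow, pow_two, pow_two, rB_sq, rB_sq, one_mul]

theorem exists_realization : ∃ R : (affineA L).Group →* ParamBirational L N,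
    Function.Injective R ∧ ∀ n, R ((affineA L).simple n) = rB hL hN n := by
  set cs := (affineA L).toCoxeterSystem with hcs
  set R := cs.lift ⟨rB hL hN, isLiftable_rB hL hN⟩ with hR
  have hs : ∀ n, R (cs.simple n) = rB hL hN n := fun n => cs.lift_apply_simple _ n
  refine ⟨R, (injective_iff_map_eq_one R).2 fun w hw => ?_, hs⟩
  have hre : ∀ (c : Prop) [Decidable c] (z : ℂ), (if c then z else 0).re = if c then z.re else 0 :=
    fun c _ z => by split_ifs <;> simp
  have hpos : (0 : ℝ) < (L : ℝ)⁻¹ := inv_pos.2 (Nat.cast_pos.2 (by omega))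
  -- A w m is the root 𝔞_m after w has acted on the parameters with all 𝔞_m = 1/L. If R w = 1 these
  -- values are unchanged, so triviality on the parameters already forces w = 1.
  refine eq_one_of_root_pos cs hL
    (A := fun w m => (((R w).param (regularParams L N)).a m.val).re) (fun m => ?_)
    (fun w s m => ?_) (fun h2 w m n hmn => ?_) fun s => ?_
  · rw [map_one]
    change 0 < ((regularParams L N).a m.val).re
    rw [regularParams_a, Complex.ofReal_re]
    exact hpos
  · simp only [map_mul, hs, ParamBirational.mul_param]
    change ((rParam s _).a _).re = _
    rw [rParam_a]
    simp [hre]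
  · set k := (R w).param (regularParams L N)
    -- For L = 2 the two roots sum to e_{m+2} − e_m = 1, whatever the parameters.
    have h3 : k.a m.val + k.a n.val = 1 := by
      have h4 : k.a n.val = k.a (m.val + 1) := by
        refine k.a_eq ?_
        simpa using (zmod_two_add_one h2 hmn).2
      have h5 := k.e_add m.val
      rw [show (L : ℤ) = 2 by exact_mod_cast h2] at h5
      rw [h4, Params.a, Params.a, add_assoc (m.val : ℤ), one_add_one_eq_two, h5]
      ring
    have h4 := congrArg Complex.re h3
    rw [Complex.add_re, Complex.one_re] at h4
    linarith
  · rw [hw]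
    change 0 < ((regularParams L N).a s.val).re
    rw [regularParams_a, Complex.ofReal_re]
    exact hpos

theorem exists_realization' : ∃ R : (affineA L).Group →* ParamBirational L N,
    Function.Injective R ∧ ∀ n, R ((affineA L).simple n) = rB' hL hN n := by
  obtain ⟨R, hR, hs⟩ := exists_realization (N := N) hL hN
  refine ⟨(MulAut.conj (rhoB N hL)).toMonoidHom.comp R,
    (MulAut.conj (rhoB N hL)).injective.comp hR, fun n => ?_⟩
  have : (rhoB N hL)⁻¹ = rhoB N hL := inv_eq_of_mul_eq_one_left (rhoB_sq hL)
  simp only [MonoidHom.comp_apply, hs, MulEquiv.coe_toMonoidHom, MulAut.conj_apply, this, rB']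

end

end HLN
end

noncomputable section
namespace HLN
variable {L N : ℕ}

/-! ### The formulas with extended indices -/

theorem ParamBirational.field_qx (T : ParamBirational L N) (k : Params L N) (j : Fin (N + 1))
    (m : ℤ) : T.field k ((gen L N).qx j m) = (T.pt k).qx j m := by
  rw [pt_eq_map, Point.qx_map]
  rfl

theorem ParamBirational.field_px (T : ParamBirational L N) (k k' : Params L N) (j : Fin (N + 1))
    (m : ℤ) : T.field k ((gen L N).px k' j m) = (T.pt k).px k' j m := by
  rw [pt_eq_map, Point.px_map]
  rfl

section

variable [NeZero L] (hL : 2 ≤ L) (hN : 1 ≤ N)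

/-- The case beyond the definition is n = L − 1, where p_{n+1} = p_L is not a coordinate. The
normalizing torus factor differs from 1 only in the class of n, so both formulas can be read off
from the shear. -/
theorem rB_px {n : ZMod L} (hn : n ≠ 0) (k : Params L N) (j : Fin (N + 1)) :
    (rB hL hN n).field k ((gen L N).px ((rB hL hN n).param k) j n.val) = (gen L N).px k j n.val *
      (1 + algebraMap ℂ _ (k.a n.val) / (gen L N).pairing k (n.val + 1) n.val) ∧
    (rB hL hN n).field k ((gen L N).px ((rB hL hN n).param k) j (n.val + 1)) =
      (gen L N).px k j (n.val + 1) - algebraMap ℂ _ (k.a n.val) * (gen L N).px k j n.val /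
        (gen L N).pairing k (n.val + 1) n.val := by
  have : Fact (1 < L) := ⟨by omega⟩
  have h := rPoint_cfg_of_ne_zero hL hn k gen_s_ne_zero (gen_rRegular hL hN k (ZMod.val_lt n))
  rw [ParamBirational.field_px, ParamBirational.field_px, rB_pt]
  have h1 : ∀ m, (rPoint n.val k (gen L N)).px ((rB hL hN n).param k) j m = _ := fun m =>
    congrArg (fun C : Cfg N (RatField L N) => C.p j m) h
  have hD : ∀ m : ℤ, ((gen L N).cfg k).D m = (gen L N).pairing k (m + 1) m := fun _ => rfl
  rw [h1, h1]
  constructor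
  · simp
  · simp [hD]
    ring

theorem rB'_cf {n : ZMod L} (hn : n ≠ 0) (k : Params L N) :
    ((rB' hL hN n).cf k) = (((gen L N).cfg k).r' (-n) (algebraMap ℂ _ (k.b n.val))).gauge
      (fun m => if (m : ZMod L) = -n then (1 + algebraMap ℂ _ (k.b n.val) /
        (gen L N).pairing k (L - n.val - 1) (L - n.val))⁻¹ else 1) 1 := by
  have hs := Point.sx_ne_zero (x := gen L N) gen_s_ne_zero
  have hadm := Point.cfg_admissible hL k (x := gen L N) gen_s_ne_zero
  have hx : rhoPoint k (gen L N) = (rhoB N hL).pt k := (rhoB_pt hL k).symm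
  have h1 := rPoint_cfg_of_ne_zero hL hn (rhoParam k) ((rhoB N hL).pt_s_ne_zero k)
    (pt_rRegular hL hN _ _ (ZMod.val_lt n))
  have h2 : (rB' hL hN n).cf k =
      ((rPoint n.val (rhoParam k) ((rhoB N hL).pt k)).cfg (rParam n (rhoParam k))).rev := by
    rw [rB', ParamBirational.mul_rhoB_cf, ParamBirational.cf, ParamBirational.mul_rB_pt]
    rfl
  have h3 : ((rhoB N hL).pt k).pairing (rhoParam k) (n.val + 1) n.val =
      (gen L N).pairing k (L - n.val - 1) (L - n.val) := by
    have e1 : ((rhoB N hL).pt k).pairing (rhoParam k) (n.val + 1) n.val =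
      ((rhoB N hL).cf k).D n.val := rfl
    have e2 : (gen L N).pairing k (L - n.val - 1) (L - n.val) =
      ((gen L N).cfg k).D' (-n.val + L) := by
      rw [neg_add_eq_sub]
      rfl
    rw [e1, e2, hadm.D'_add hs, cf_rhoB]
    simp only [Cfg.D, Cfg.D', Cfg.rev_q, Cfg.rev_p, neg_add']
  rw [h2, h1, h3, rhoParam_a, ← Cfg.rev_r_rev]
  have h4 : ((rhoB N hL).pt k).cfg (rhoParam k) = ((gen L N).cfg k).rev := cf_rhoB hL k
  rw [h4]
  have h5 : ∀ m : ℤ, ((-m : ℤ) : ZMod L) = n ↔ (m : ZMod L) = -n := by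
    simp [neg_eq_iff_eq_neg]
  ext j m
  · simp only [Cfg.rev_q, Cfg.gauge_q, h5]
  · simp only [Cfg.rev_p, Cfg.gauge_p, h5]

theorem rB'_px {n : ZMod L} (hn : n ≠ 0) (k : Params L N) (j : Fin (N + 1)) :
    (rB' hL hN n).field k ((gen L N).px ((rB' hL hN n).param k) j (L - n.val)) =
      (gen L N).px k j (L - n.val) * (1 + algebraMap ℂ _ (k.b n.val) /
        (gen L N).pairing k (L - n.val - 1) (L - n.val)) ∧
    (rB' hL hN n).field k ((gen L N).px ((rB' hL hN n).param k) j (L - n.val - 1)) =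
      (gen L N).px k j (L - n.val - 1) - algebraMap ℂ _ (k.b n.val) *
        (gen L N).px k j (L - n.val) / (gen L N).pairing k (L - n.val - 1) (L - n.val) := by
  have : Fact (1 < L) := ⟨by omega⟩
  rw [ParamBirational.field_px, ParamBirational.field_px]
  have h1 : ∀ m, ((rB' hL hN n).pt k).px ((rB' hL hN n).param k) j m = _ := fun m =>
    congrArg (fun C : Cfg N (RatField L N) => C.p j m) (rB'_cf hL hN hn k)
  have hD : ((gen L N).cfg k).D' (L - n.val) =
    (gen L N).pairing k (L - n.val - 1) (L - n.val) := rfl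
  have z1 := ZMod.one_ne_zero' hL
  have c1 : ((L - n.val : ℤ) : ZMod L) = -n := by simp
  have c2 : ((L - n.val - 1 : ℤ) : ZMod L) = -n - 1 := by rw [Int.cast_sub, c1, Int.cast_one]
  have c3 : -n ≠ -n - 1 := by simp [sub_eq_add_neg]
  rw [h1, h1]
  simp only [Cfg.gauge_p, Cfg.r'_p, c1, c2, if_pos, if_neg c3, if_neg c3.symm, sub_add_cancel, hD,
    Point.cfg_p, Pi.one_apply, mul_one, sub_zero, div_one, div_inv_eq_mul, true_and]
  ring

theorem piB_extended (k : Params L N) (j : Fin (N + 1)) (m : ℤ) :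
    (piB N hL).field k ((gen L N).qx j m) = (gen L N).qx j (m + 1) / (gen L N).qx j 1 ∧
    (piB N hL).field k ((gen L N).px ((piB N hL).param k) j m) =
      (gen L N).px k j (m + 1) * (gen L N).qx j 1 := by
  have h := piPoint_cfg hL k (x := gen L N) gen_s_ne_zero (gen_piRegular hL)
  rw [ParamBirational.field_qx, ParamBirational.field_px, piB_pt]
  constructor
  · refine (congrArg (fun C : Cfg N (RatField L N) => C.q j m) h).trans ?_
    simp only [Cfg.gauge_q, Cfg.shift_q, Point.cfg_q, Pi.one_apply, one_mul]
    exact inv_mul_eq_div _ _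
  · refine (congrArg (fun C : Cfg N (RatField L N) => C.p j m) h).trans ?_
    simp

theorem rhoB_extended (k : Params L N) (j : Fin (N + 1)) (m : ℤ) :
    (rhoB N hL).field k ((gen L N).qx j m) = (gen L N).qx j (L - m) / (gen L N).sx j ∧
    (rhoB N hL).field k ((gen L N).px ((rhoB N hL).param k) j m) =
      (gen L N).sx j * (gen L N).px k j (L - m) := by
  have h := rhoPoint_cfg hL k (x := gen L N) gen_s_ne_zero
  have hs := Point.sx_ne_zero (x := gen L N) gen_s_ne_zero j
  have hadm := Point.cfg_admissible hL k (x := gen L N) gen_s_ne_zero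
  have e1 := hadm.q_add j (-m)
  have e2 := hadm.p_add j (-m)
  rw [neg_add_eq_sub] at e1 e2
  rw [ParamBirational.field_qx, ParamBirational.field_px, rhoB_pt]
  constructor
  · refine (congrArg (fun C : Cfg N (RatField L N) => C.q j m) h).trans ?_
    rw [← Point.cfg_q k (gen L N), e1, mul_div_cancel_left₀ _ hs]
    rfl
  · refine (congrArg (fun C : Cfg N (RatField L N) => C.p j m) h).trans ?_
    rw [← Point.cfg_p k (gen L N), e2, mul_div_cancel₀ _ hs]
    rfl

theorem rB'_sq (n : ZMod L) : rB' hL hN n * rB' hL hN n = 1 := by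
  calc rB' hL hN n * rB' hL hN n = rhoB N hL * rB hL hN n * (rhoB N hL * rhoB N hL) *
        rB hL hN n * rhoB N hL := by simp only [rB', mul_assoc]
    _ = rhoB N hL * (rB hL hN n * rB hL hN n) * rhoB N hL := by
        rw [rhoB_sq, mul_one]
        simp only [mul_assoc]
    _ = 1 := by rw [rB_sq, mul_one, rhoB_sq]

theorem rB'_braid' (h3 : 3 ≤ L) {m n : ZMod L} (h : m = n + 1 ∨ n = m + 1) :
    (rB' hL hN m * rB' hL hN n) ^ 3 = 1 := by
  have hinv : (rhoB N hL)⁻¹ = rhoB N hL := inv_eq_of_mul_eq_one_left (rhoB_sq hL)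
  have h1 : ∀ n, rB' hL hN n = MulAut.conj (rhoB N hL) (rB hL hN n) := fun n => by
    rw [MulAut.conj_apply, hinv, rB']
  rw [h1, h1, ← map_mul, ← map_pow, rB_braid' hL hN h3 h, map_one]

end

end HLN
end

/-! ### Assembly of the transformations and their properties. -/

theorem mainTheorem5 (L N : ℕ) (hL : 2 ≤ L) (hN : 1 ≤ N) :
    ∃ (r r' : ZMod L → ParamBirational L N) (π ρ : ParamBirational L N),
      -- action on the parameters
      (∀ n k,
        (∀ m : ℤ, ((r n).param k).e m = k.e m
          + (if (m : ZMod L) = n then k.a n.val else 0)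
          - (if (m : ZMod L) = n + 1 then k.a n.val else 0)) ∧
        (∀ m : ℤ, ((r n).param k).κ m = k.κ m
          + (if (m : ZMod L) = n then k.a n.val else 0)
          - (if (m : ZMod L) = n + 1 then k.a n.val else 0)) ∧
        ((r n).param k).θ = k.θ) ∧
      (∀ n k,
        ((r' n).param k).e = k.e ∧
        (∀ m : ℤ, ((r' n).param k).κ m = k.κ m
          + (if (m : ZMod L) = -n then k.b n.val else 0)
          - (if (m : ZMod L) = -n - 1 then k.b n.val else 0)) ∧
        ((r' n).param k).θ = k.θ) ∧
      (∀ k, (∀ m, (π.param k).e m = k.e (m + 1) - 1 / (L : ℂ)) ∧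
        (∀ m, (π.param k).κ m = k.κ (m + 1)) ∧ (π.param k).θ = k.θ) ∧
      (∀ k, (∀ m, (ρ.param k).e m = k.κ (L - m) - k.e (L - m) - (∑ i, k.θ i) / (L : ℂ) + 1) ∧
        (∀ m, (ρ.param k).κ m = k.κ (L - m)) ∧ (ρ.param k).θ = k.θ) ∧
      -- action on the variables
      (∀ n, (r n).ActsBy (rPoint n.val)) ∧
      (∀ n, (r' n).ActsBy (rPoint' n.val)) ∧
      π.ActsBy piPoint ∧
      ρ.ActsBy rhoPoint ∧
      -- the same formulas hold for the variables with extended indices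
      (∀ n, n ≠ 0 → ∀ k i,
        (r n).field k ((gen L N).px ((r n).param k) i n.val) = (gen L N).px k i n.val *
          (1 + algebraMap ℂ _ (k.a n.val) / (gen L N).pairing k (n.val + 1) n.val) ∧
        (r n).field k ((gen L N).px ((r n).param k) i (n.val + 1)) =
          (gen L N).px k i (n.val + 1) - algebraMap ℂ _ (k.a n.val) * (gen L N).px k i n.val /
            (gen L N).pairing k (n.val + 1) n.val) ∧
      (∀ n, n ≠ 0 → ∀ k i,
        (r' n).field k ((gen L N).px ((r' n).param k) i (L - n.val)) =
          (gen L N).px k i (L - n.val) *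
          (1 + algebraMap ℂ _ (k.b n.val) /
            (gen L N).pairing k (L - n.val - 1) (L - n.val)) ∧
        (r' n).field k ((gen L N).px ((r' n).param k) i (L - n.val - 1)) =
          (gen L N).px k i (L - n.val - 1) -
            algebraMap ℂ _ (k.b n.val) * (gen L N).px k i (L - n.val) /
            (gen L N).pairing k (L - n.val - 1) (L - n.val)) ∧
      (∀ k i (m : ℤ),
        π.field k ((gen L N).qx i m) = (gen L N).qx i (m + 1) / (gen L N).qx i 1 ∧
        π.field k ((gen L N).px (π.param k) i m) =
          (gen L N).px k i (m + 1) * (gen L N).qx i 1) ∧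
      (∀ k i (m : ℤ),
        ρ.field k ((gen L N).qx i m) = (gen L N).qx i (L - m) / (gen L N).sx i ∧
        ρ.field k ((gen L N).px (ρ.param k) i m) =
          (gen L N).sx i * (gen L N).px k i (L - m)) ∧
      -- the transformations are canonical
      (∀ n, (r n).IsCanonical) ∧ (∀ n, (r' n).IsCanonical) ∧ π.IsCanonical ∧ ρ.IsCanonical ∧
      -- invariance of the Hamiltonian system, up to the change of parameters
      (∀ n, (r n).IsInvariant) ∧ (∀ n, (r' n).IsInvariant) ∧ π.IsInvariant ∧ ρ.IsInvariant ∧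
      (∀ n, (r n).MapsSolutions id (rPoint n.val) (rRegular n.val)) ∧
      (∀ n, (r' n).MapsSolutions id (rPoint' n.val) (rRegular' n.val)) ∧
      π.MapsSolutions id piPoint (fun _ => piRegular) ∧
      ρ.MapsSolutions (fun s i => 1 / s i) rhoPoint (fun _ _ => True) ∧
      -- relations
      (∀ n, r n ^ 2 = 1) ∧ (∀ n, r' n ^ 2 = 1) ∧
      (3 ≤ L → ∀ n, (r n * r (n + 1)) ^ 3 = 1 ∧ (r n * r (n - 1)) ^ 3 = 1) ∧
      (3 ≤ L → ∀ n, (r' n * r' (n + 1)) ^ 3 = 1 ∧ (r' n * r' (n - 1)) ^ 3 = 1) ∧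
      π ^ L = 1 ∧ ρ ^ 2 = 1 ∧
      (∀ n, π * r n = r (n + 1) * π) ∧
      (∀ n, π * r' n = r' (n - 1) * π) ∧
      (∀ n, ρ * r n = r' n * ρ) ∧
      -- two commuting realizations of the affine Weyl group
      (∃ R : (affineA L).Group →* ParamBirational L N,
        Function.Injective R ∧ ∀ n, R ((affineA L).simple n) = r n) ∧
      (∃ R' : (affineA L).Group →* ParamBirational L N,
        Function.Injective R' ∧ ∀ n, R' ((affineA L).simple n) = r' n) ∧
      (∀ m n, r m * r' n = r' n * r m) := by
  have : NeZero L := ⟨by omega⟩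
  refine ⟨rB hL hN, rB' hL hN, piB N hL, rhoB N hL,
    fun n k => ⟨fun _ => rfl, fun _ => rfl, rfl⟩, fun n k => ⟨?_, fun m => ?_, rfl⟩,
    fun k => ⟨fun _ => rfl, fun _ => rfl, rfl⟩, fun k => ⟨fun _ => rfl, fun _ => rfl, rfl⟩,
    fun n => ParamBirational.actsBy_of_pt (rB_pt hL hN n),
    fun n => ParamBirational.actsBy_of_pt (rB'_pt hL hN n),
    ParamBirational.actsBy_of_pt (piB_pt hL), ParamBirational.actsBy_of_pt (rhoB_pt hL),
    fun n hn k i => rB_px hL hN hn k i, fun n hn k i => rB'_px hL hN hn k i,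
    piB_extended hL, rhoB_extended hL,
    rB_isCanonical hL hN, rB'_isCanonical hL hN, piB_isCanonical hL, rhoB_isCanonical hL,
    rB_isInvariant hL hN, rB'_isInvariant hL hN, piB_isInvariant hL, rhoB_isInvariant hL,
    rB_mapsSolutions hL hN, rB'_mapsSolutions hL hN, piB_mapsSolutions hL, rhoB_mapsSolutions hL,
    fun n => (pow_two _).trans (rB_sq hL hN n), fun n => (pow_two _).trans (rB'_sq hL hN n),
    fun h3 n => ⟨rB_braid' hL hN h3 (.inr rfl), rB_braid' hL hN h3 (.inl (sub_add_cancel _ _).symm)⟩,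
    fun h3 n =>
      ⟨rB'_braid' hL hN h3 (.inr rfl), rB'_braid' hL hN h3 (.inl (sub_add_cancel _ _).symm)⟩,
    piB_pow hL, (pow_two _).trans (rhoB_sq hL), piB_rB hL hN, piB_rB' hL hN, rhoB_rB hL hN,
    exists_realization hL hN, exists_realization' hL hN, rB_rB'_comm hL hN⟩
  · rw [rB'_param_apply]
    exact rParam'_e k n
  · rw [rB'_param_apply, rParam'_κ]
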